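/- **Setting.** Let $\mathfrak g$ be a finite-dimensional complex simple Lie algebra with Killing form $\kappa$, $\mathfrak h$ a Cartan subalgebra, $\Pi$ a set of simple roots and $\alpha_{\mathfrak q}\in\Pi$. For $j\in\mathbb Z$ let $\mathfrak g(j)$ be the $j$-eigenspace of $\operatorname{ad}(H_{\mathfrak q})$, where $H_{\mathfrak q}\in\mathfrak h$ is defined by $\alpha(H_{\mathfrak q})=\delta_{\alpha,\alpha_{\mathfrak q}}$ for $\alpha\in\Pi$; put $\mathfrak l=\mathfrak g(0)$, $\mathfrak n=\bigoplus_{j>0}\mathfrak g(j)$, $\bar{\mathfrak n}=\bigoplus_{j<0}\mathfrak g(j)$, $\mathfrak q=\mathfrak l\oplus\mathfrak n$. Assume that $\mathfrak q$ is of quasi-Heisenberg type: $[\mathfrak n,[\mathfrak n,\mathfrak n]]=0$ and $\dim[\mathfrak n,\mathfrak n]>1$. (Then $\mathfrak g=\bigoplus_{j=-2}^{2}\mathfrak g(j)$, and $\mathfrak g(2)=\mathfrak z(\mathfrak n)$ is the center of $\mathfrak n$.) Let $\mathfrak g_0$ be a real form of $\mathfrak g$ such that $\mathfrak q$ and $\bar{\mathfrak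 n}$ are the complexifications of $\mathfrak q\cap\mathfrak g_0$ and $\bar{\mathfrak n}_0=\bar{\mathfrak n}\cap\mathfrak g_0$, and let $\bar N_0=\exp\bar{\mathfrak n}_0$ be the connected, simply connected nilpotent Lie group with Lie algebra $\bar{\mathfrak n}_0$. For $X\in\bar{\mathfrak n}_0$ let $(R(X)f)(n)=\frac{d}{dt}f(n\exp(tX))\big|_{t=0}$ on $C^\infty(\bar N_0,\mathbb C)$, and extend $R$ complex-linearly to $\bar{\mathfrak n}$ and then to an algebra homomorphism from $\mathcal U(\bar{\mathfrak n})$ to the algebra $\mathbb D$ of differential operators on $\bar N_0$ with coefficients in $C^\infty(\bar N_0,\mathbb C)$. Let $\lambda_{\mathfrak q}\in\mathfrak h^*$ be the fundamental weight of $\alpha_{\mathfrak q}$, extended by zero on the root spaces. For $s\in\mathbb C$, the Lie algebra $\mathfrak g$ acts on $C^\infty(\bar N_0,\mathbb C)$, the space of smooth sections over $\bar N_0$ of the line bundle $\mathcal L_s$, by $$(\pi_s(Y)f)(n)=s\,\lambda_{\mathfrak q}\big((\operatorname{Ad}(n^{-1})Y)_{\mathfrak q}\big)f(n)-\big(R((\operatorname{Ad}(n^{-1})Y)_{\bar{\mathfrak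 n}})f\big)(n),$$ where $Z=Z_{\mathfrak q}+Z_{\bar{\mathfrak n}}$ according to $\mathfrak g=\mathfrak q\oplus\bar{\mathfrak n}$. For an operator $D$ on $C^\infty(\bar N_0,\mathbb C)$ and $n\in\bar N_0$ let $D_n$ be the linear functional $f\mapsto (Df)(n)$. A list $D_1,\dots,D_m\in\mathbb D$ is a *conformally invariant system* (with respect to $\pi_s$) if $(D_1)_n,\dots,(D_m)_n$ are linearly independent for every $n\in\bar N_0$ and if for every $X\in\mathfrak g$ there is an $m\times m$ matrix $C(X)$ with entries in $C^\infty(\bar N_0,\mathbb C)$ such that $[\pi_s(X),D_i]=\sum_j C_{ji}(X)D_j$ for all $i$. Two lists $D_1,\dots,D_m$ and $D'_1,\dots,D'_m$ are *equivalent* if $D'_i=\sum_jA_{ji}D_j$ for some $A\in GL_m(C^\infty(\bar N_0,\mathbb C))$. Let $\omega=\sum_a X_a^*\otimes X_a\in\mathfrak g(-2)\otimes\mathfrak g(2)$, where $(X_a)$ is a basis of $\mathfrak g(2)$ and $(X_a^*)$ the $\kappa$-dual basis of $\mathfrak g(-2)$, and for $X\in\mathfrak g(1)$ let $$\tau_2(X)=\tfrac1{2!}\,(\operatorname{ad}(X)^2\otimes\mathrm{Id})\,\omega\in\mathfrak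 l\otimes\mathfrak z(\mathfrak n).$$ For $Y^*\in\mathfrak g(0)\otimes\mathfrak g(-2)\cong(\mathfrak l\otimes\mathfrak z(\mathfrak n))^*$ (identified by $\kappa\otimes\kappa$), the quadratic polynomial $\tilde\tau_2(Y^*)\colon X\mapsto Y^*(\tau_2(X))$ on $\mathfrak g(1)$ is viewed by $\kappa$ as an element of $\mathrm{Sym}^2(\mathfrak g(-1))$, and $$\Omega_2(Y^*)=R\big(\sigma(\tilde\tau_2(Y^*))\big),$$ with $\sigma\colon\mathrm{Sym}^2(\mathfrak g(-1))\to\mathcal U(\bar{\mathfrak n})$ the symmetrization. Let $V(\mu+\varepsilon)\subset\mathfrak l\otimes\mathfrak z(\mathfrak n)$ be a *special constituent*: an irreducible $\mathfrak l$-submodule of highest weight $\mu+\varepsilon$, where $\mu$ is the highest weight of $\mathfrak g(1)$, $\varepsilon$ is a root of $\mathfrak h$ in $\mathfrak g(1)$, and $\mu+\varepsilon$ is not the highest weight of $\mathfrak z(\mathfrak n)$. Let $V(\mu+\varepsilon)^*\subset\mathfrak g(0)\otimes\mathfrak g(-2)$ be its dual, that is, an $\mathfrak l$-submodule that is nondegenerately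 paired with $V(\mu+\varepsilon)$ by $\kappa\otimes\kappa$. A list $D_1,\dots,D_m\in\mathbb D$ of operators that commute with $\pi_s(X)$ for all $X\in\bar{\mathfrak n}$ is called *the $\Omega_2|_{V(\mu+\varepsilon)^*}$ system* if it is equivalent to $\Omega_2(Y_1^*),\dots,\Omega_2(Y_m^*)$ for some basis $Y_1^*,\dots,Y_m^*$ of $V(\mu+\varepsilon)^*$. **Proposition.** Let $s\in\mathbb C$ and suppose that $\Omega_2|_{V(\mu+\varepsilon)^*}\neq0$. Let $X_h$ be a highest weight vector of the $\mathfrak l$-module $\mathfrak g(1)$, let $Y_l^*$ be a lowest weight vector of the $\mathfrak l$-module $V(\mu+\varepsilon)^*$, and let $Y_1^*,\dots,Y_m^*$ be a basis of $V(\mu+\varepsilon)^*$. If, with $e$ the identity of $\bar N_0$, $$[\pi_s(X_h),\Omega_2(Y_l^*)]_e\in\operatorname{span}_{\mathbb C}\{\Omega_2(Y_1^*)_e,\dots,\Omega_2(Y_m^*)_e\},$$ then the list $\Omega_2(Y_1^*),\dots,\Omega_2(Y_m^*)$, and every list that is the $\Omega_2|_{V(\mu+\varepsilon)^*}$ system,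 is a conformally invariant system with respect to $\pi_s$. -/

import Mathlib

open scoped TensorProduct ContDiff
open Module LieAlgebra LieAlgebra.IsKilling LieModule

noncomputable section
namespace ConfInv

section Grading

variable {g : Type*} [LieRing g] [LieAlgebra ℂ g] [Module.Finite ℂ g] [LieAlgebra.IsSimple ℂ g]
  {H : LieSubalgebra ℂ g} [H.IsCartanSubalgebra]

/-- The element `H_q` of the Cartan subalgebra attached to the simple root `α_q`: it is the
fundamental coweight, so that `β(H_q)` is the multiplicity of `α_q` in `β` for every root `β`
(see `apply_gradingElement` and `simpleRoot_apply_gradingElement`). -/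
def gradingElement (b : (rootSystem H).Base) (q : b.support) : H :=
  (Module.evalEquiv ℂ H).symm (b.toWeightBasis.coord q)

lemma apply_gradingElement (b : (rootSystem H).Base) (q : b.support) (φ : Dual ℂ H) :
    φ (gradingElement b q) = b.toWeightBasis.coord q φ := by
  simp [gradingElement]

/-- The `j`-eigenspace `g(j)` of `ad H_q`. -/
def gr (b : (rootSystem H).Base) (q : b.support) (j : ℤ) : Submodule ℂ g :=
  (ad ℂ g (gradingElement b q : g)).eigenspace (j : ℂ)

lemma mem_gr {b : (rootSystem H).Base} {q : b.support} {j : ℤ} {x : g} :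
    x ∈ gr b q j ↔ ⁅(gradingElement b q : g), x⁆ = (j : ℂ) • x := by
  simp [gr]

lemma lie_mem_gr {b : (rootSystem H).Base} {q : b.support} {j k : ℤ} {x y : g}
    (hx : x ∈ gr b q j) (hy : y ∈ gr b q k) : ⁅x, y⁆ ∈ gr b q (j + k) := by
  rw [mem_gr] at *
  rw [leibniz_lie, hx, hy]
  push_cast
  simp [add_smul]

open Classical in
lemma simpleRoot_apply_gradingElement (b : (rootSystem H).Base) (q : b.support) {i : H.root}
    (hi : i ∈ b.support) :
    (i : Weight ℂ H g) (gradingElement b q) = if i = (q : H.root) then 1 else 0 := by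
  have h := apply_gradingElement b q ((rootSystem H).root i)
  have h2 := b.toWeightBasis_repr_root ⟨i, hi⟩
  simp only at h2
  rw [Basis.coord_apply, h2, Finsupp.single_apply] at h
  rw [rootSystem_root_apply, Weight.toLinear_apply] at h
  rw [h]
  by_cases hq : i = (q : H.root)
  · rw [if_pos hq, if_pos (Subtype.ext hq)]
  · rw [if_neg hq, if_neg fun h ↦ hq (congrArg Subtype.val h)]

open Classical in
lemma exists_int_weight (b : (rootSystem H).Base) (q : b.support) (α : Weight ℂ H g) :
    ∃ m : ℤ, α (gradingElement b q) = m := by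
  by_cases hα : α.IsZero
  · exact ⟨0, by simp [hα.eq]⟩
  · obtain ⟨i, rfl⟩ : ∃ i : H.root, (i : Weight ℂ H g) = α := ⟨⟨α, by simpa using hα⟩, rfl⟩
    have h := b.root_mem_span_int i
    have key : ∀ φ ∈ Submodule.span ℤ ((rootSystem H).root '' b.support),
        ∃ m : ℤ, φ (gradingElement b q) = m := by
      intro φ hφ
      induction hφ using Submodule.span_induction with
      | mem x hx =>
        obtain ⟨j, hj, rfl⟩ := hx
        have := simpleRoot_apply_gradingElement b q (i := j) (by simpa using hj)
        rw [rootSystem_root_apply]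
        refine ⟨if j = (q : H.root) then 1 else 0, ?_⟩
        simp only [Weight.toLinear_apply, this]
        split <;> simp
      | zero => exact ⟨0, by simp⟩
      | add x y _ _ hx hy =>
        obtain ⟨m, hm⟩ := hx
        obtain ⟨n, hn⟩ := hy
        exact ⟨m + n, by simp [hm, hn]⟩
      | smul a x _ hx =>
        obtain ⟨m, hm⟩ := hx
        exact ⟨a * m, by simp [hm]⟩
    obtain ⟨m, hm⟩ := key _ h
    exact ⟨m, by simpa using hm⟩

lemma rootSpace_le_gr (b : (rootSystem H).Base) (q : b.support) {α : H → ℂ} {m : ℤ}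
    (hm : α (gradingElement b q) = m) :
    (rootSpace H α).toSubmodule ≤ gr b q m := by
  intro x hx
  have := lie_eq_smul_of_mem_rootSpace (K := ℂ) (L := g) (H := H) hx (gradingElement b q)
  rw [mem_gr, ← hm, ← this]; rfl

lemma iSup_gr (b : (rootSystem H).Base) (q : b.support) : ⨆ j : ℤ, gr b q j = ⊤ := by
  rw [eq_top_iff]
  have h := iSup_genWeightSpace_eq_top' ℂ H g
  have h2 := congrArg LieSubmodule.toSubmodule h
  rw [LieSubmodule.iSup_toSubmodule, LieSubmodule.top_toSubmodule] at h2
  rw [← h2, iSup_le_iff]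
  intro α
  obtain ⟨m, hm⟩ := exists_int_weight b q α
  exact (rootSpace_le_gr b q hm).trans (le_iSup (gr b q) m)

lemma iSupIndep_gr (b : (rootSystem H).Base) (q : b.support) : iSupIndep (gr b q) :=
  (Module.End.eigenspaces_iSupIndep _).comp (f := fun j : ℤ ↦ (j : ℂ)) Int.cast_injective

/-- The Levi subalgebra `l = g(0)`. -/
def levi (b : (rootSystem H).Base) (q : b.support) : LieSubalgebra ℂ g where
  __ := gr b q 0
  lie_mem' {_ _} hx hy := lie_mem_gr (j := 0) (k := 0) hx hy

/-- The maximal parabolic subalgebra `q`, the sum of the `g(j)` with `j ≥ 0`. -/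
def parabolic (b : (rootSystem H).Base) (q : b.support) : Submodule ℂ g :=
  ⨆ j : ℕ, gr b q j

/-- The nilpotent radical `n` of `q`, the sum of the `g(j)` with `j > 0`. -/
def nilrad (b : (rootSystem H).Base) (q : b.support) : Submodule ℂ g :=
  ⨆ j : ℕ, gr b q (j + 1)

/-- The opposite nilpotent subalgebra `n̄`, the sum of the `g(j)` with `j < 0`. -/
def oppNilrad (b : (rootSystem H).Base) (q : b.support) : Submodule ℂ g :=
  ⨆ j : ℕ, gr b q (-(j + 1))

lemma gr_le_oppNilrad (b : (rootSystem H).Base) (q : b.support) {j : ℤ} (hj : j < 0) :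
    gr b q j ≤ oppNilrad b q := by
  refine le_trans (le_of_eq ?_) (le_iSup _ (-j - 1).toNat)
  congr 1; omega

lemma gr_le_nilrad (b : (rootSystem H).Base) (q : b.support) {j : ℤ} (hj : 0 < j) :
    gr b q j ≤ nilrad b q := by
  refine le_trans (le_of_eq ?_) (le_iSup _ (j - 1).toNat)
  congr 1; omega

lemma gr_le_parabolic (b : (rootSystem H).Base) (q : b.support) {j : ℤ} (hj : 0 ≤ j) :
    gr b q j ≤ parabolic b q := by
  refine le_trans (le_of_eq ?_) (le_iSup _ j.toNat)
  congr 1; omega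

lemma isCompl_oppNilrad_parabolic (b : (rootSystem H).Base) (q : b.support) :
    IsCompl (oppNilrad b q) (parabolic b q) := by
  constructor
  · refine ((iSupIndep_gr b q).disjoint_biSup_biSup (s := {j | j < 0}) (t := {j | 0 ≤ j})
      ?_).mono ?_ ?_
    · rw [Set.disjoint_left]; intro a ha hb; simp at *; omega
    · exact iSup_le fun j ↦ le_biSup (gr b q) (by simp; omega)
    · exact iSup_le fun j ↦ le_biSup (gr b q) (by simp)
  · rw [codisjoint_iff, eq_top_iff, ← iSup_gr b q]
    refine iSup_le fun j ↦ ?_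
    rcases lt_or_ge j 0 with hj | hj
    · exact (gr_le_oppNilrad b q hj).trans le_sup_left
    · exact (gr_le_parabolic b q hj).trans le_sup_right

lemma killingForm_gr {b : (rootSystem H).Base} {q : b.support} {j k : ℤ} (hjk : j + k ≠ 0)
    {x y : g} (hx : x ∈ gr b q j) (hy : y ∈ gr b q k) : killingForm ℂ g x y = 0 := by
  rw [mem_gr] at *
  have h := LieModule.traceForm_apply_lie_apply ℂ g g x (gradingElement b q : g) y
  have h2 : killingForm ℂ g ⁅x, (gradingElement b q : g)⁆ y
    = killingForm ℂ g x ⁅(gradingElement b q : g), y⁆ := h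
  rw [← lie_skew, hx, hy] at h2
  simp only [map_neg, map_smul, LinearMap.neg_apply, LinearMap.smul_apply, smul_eq_mul] at h2
  have : ((j + k : ℤ) : ℂ) * killingForm ℂ g x y = 0 := by push_cast; linear_combination -h2
  rcases mul_eq_zero.mp this with h | h
  · exact absurd (by exact_mod_cast h) hjk
  · exact h

lemma eq_zero_of_killingForm_gr {b : (rootSystem H).Base} {q : b.support} {j : ℤ}
    {x : g} (hx : x ∈ gr b q j) (h : ∀ y ∈ gr b q (-j), killingForm ℂ g x y = 0) : x = 0 := by
  have : ∀ y, killingForm ℂ g x y = 0 := by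
    intro y
    have hy : y ∈ ⨆ j : ℤ, gr b q j := by rw [iSup_gr]; trivial
    induction hy using Submodule.iSup_induction' with
    | mem k y hy =>
      by_cases hk : j + k = 0
      · obtain rfl : k = -j := by omega
        exact h y hy
      · exact killingForm_gr hk hx hy
    | zero => simp
    | add y z _ _ hy hz => simp [hy, hz]
  have hk := (LieAlgebra.IsKilling.killingForm_nondegenerate ℂ g)
  exact hk.1 x this

/-- The pairing of `g(-j)` with `g(j)` given by the Killing form. -/
def grPairing (b : (rootSystem H).Base) (q : b.support) (j : ℤ) :
    gr b q (-j) →ₗ[ℂ] gr b q j →ₗ[ℂ] ℂ :=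
  (killingForm ℂ g).domRestrict₁₂ _ _

instance (b : (rootSystem H).Base) (q : b.support) (j : ℤ) : (grPairing b q j).IsPerfPair := by
  apply LinearMap.IsPerfPair.of_injective
  · rw [injective_iff_map_eq_zero]
    rintro ⟨x, hx⟩ h
    ext
    refine eq_zero_of_killingForm_gr hx fun y hy ↦ ?_
    exact LinearMap.congr_fun h ⟨y, by simpa using hy⟩
  · rw [injective_iff_map_eq_zero]
    rintro ⟨x, hx⟩ h
    ext
    refine eq_zero_of_killingForm_gr hx fun y hy ↦ ?_
    rw [LieModule.traceForm_comm]
    exact LinearMap.congr_fun h ⟨y, hy⟩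

/-- A basis of `g(j)` (the constructions below do not depend on its choice). -/
def grBasis (b : (rootSystem H).Base) (q : b.support) (j : ℤ) :
    Basis (Fin (finrank ℂ (gr b q j))) ℂ (gr b q j) :=
  Module.finBasis ℂ _

/-- The basis of `g(-j)` that is dual to the basis of `g(j)` with respect to the Killing form
(see `killingForm_grDualBasis`). -/
def grDualBasis (b : (rootSystem H).Base) (q : b.support) (j : ℤ)
    (a : Fin (finrank ℂ (gr b q j))) : gr b q (-j) :=
  (grPairing b q j).toPerfPair.symm ((grBasis b q j).coord a)

lemma killingForm_grDualBasis (b : (rootSystem H).Base) (q : b.support) (j : ℤ)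
    (a c : Fin (finrank ℂ (gr b q j))) :
    killingForm ℂ g (grDualBasis b q j a) (grBasis b q j c) = if a = c then 1 else 0 := by
  have : (grPairing b q j) (grDualBasis b q j a) = (grBasis b q j).coord a := by
    exact LinearEquiv.apply_symm_apply (grPairing b q j).toPerfPair _
  have h2 := LinearMap.congr_fun this (grBasis b q j c)
  rw [Basis.coord_apply, Basis.repr_self, Finsupp.single_apply] at h2
  rw [show killingForm ℂ g (grDualBasis b q j a) (grBasis b q j c) = _ from h2]
  simp [eq_comm]


/-- If `α`, `β` and `α + β` are roots then `[g_α, g_β] = g_{α+β}`. -/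
lemma exists_lie_eq_of_mem_rootSpace_add {α β : Weight ℂ H g} (hα : α.IsNonZero)
    {z : g} (hz : z ∈ rootSpace H (α + β : H → ℂ)) (hz0 : z ≠ 0)
    (hne : (α + β : H → ℂ) ≠ 0) :
    ∃ e ∈ rootSpace H α, ∃ x ∈ rootSpace H β, ⁅e, x⁆ = z := by
  have hbot : rootSpace H ((1 : ℤ) • (α : H → ℂ) + β) ≠ ⊥ := by
    rw [one_smul]
    intro h
    rw [h] at hz
    exact hz0 (by simpa using hz)
  have htop := ((rootSpace_zsmul_add_ne_bot_iff α β hα 1).mp hbot).1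
  obtain ⟨n, hn⟩ : ∃ n : ℕ, chainTopCoeff α β = n + 1 := ⟨chainTopCoeff α β - 1, by omega⟩
  obtain ⟨x, hx, x_ne0⟩ := (chainTop α β).exists_ne_zero
  obtain ⟨h, e, f, isSl2, he, hf⟩ := exists_isSl2Triple_of_weight_isNonZero hα
  obtain rfl := isSl2.h_eq_coroot hα he hf
  have prim : isSl2.HasPrimitiveVectorWith x (chainLength α β : ℂ) :=
    have := lie_mem_genWeightSpace_of_mem_genWeightSpace he hx
    ⟨x_ne0, (chainLength_smul _ _ hx).symm, by rwa [genWeightSpace_add_chainTop _ _ hα] at this⟩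
  have hlen := chainTopCoeff_le_chainLength α β
  have h1 := prim.pow_toEnd_f_ne_zero_of_eq_nat rfl (i := n) (by omega)
  have h2 := prim.lie_e_pow_succ_toEnd_f n
  have h3 := toEnd_pow_apply_mem hf hx n
  have h4 := toEnd_pow_apply_mem hf hx (n + 1)
  have e3 : n • (-α : H → ℂ) + (chainTop α β : H → ℂ) = α + β := by
    ext y
    simp only [coe_chainTop, hn, Pi.add_apply, Pi.smul_apply, Pi.neg_apply]
    simp only [nsmul_eq_mul, zsmul_eq_mul]; push_cast; ring
  have e4 : (n + 1) • (-α : H → ℂ) + (chainTop α β : H → ℂ) = β := by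
    ext y
    simp only [coe_chainTop, hn, Pi.add_apply, Pi.smul_apply, Pi.neg_apply]
    simp only [nsmul_eq_mul, zsmul_eq_mul]; push_cast; ring
  rw [e3] at h3
  rw [e4] at h4
  have hbot' : rootSpace H (α + β : H → ℂ) ≠ ⊥ := by rwa [one_smul] at hbot
  let W : Weight ℂ H g := ⟨_, hbot'⟩
  have hW : W.IsNonZero := fun h ↦ hne h
  obtain ⟨k, hk⟩ : ∃ k : ℂ, k • ((toEnd ℂ g g f ^ n) x) = z := by
    simpa using (finrank_eq_one_iff_of_nonzero' (⟨_, h3⟩ : rootSpace H W) (by simpa using h1)).mp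
      (finrank_rootSpace_eq_one W hW) ⟨z, hz⟩
  have hc : ((n + 1 : ℂ) * ((chainLength α β : ℂ) - n)) ≠ 0 := by
    refine mul_ne_zero (by exact_mod_cast Nat.succ_ne_zero n) ?_
    rw [sub_ne_zero]
    exact_mod_cast (by omega : chainLength α β ≠ n)
  refine ⟨(k * ((n + 1 : ℂ) * ((chainLength α β : ℂ) - n))⁻¹) • e,
    Submodule.smul_mem _ _ he, _, h4, ?_⟩
  rw [smul_lie, h2, smul_smul, mul_assoc, inv_mul_cancel₀ hc, mul_one, hk]

/-- The derived algebra `[n, n]`. -/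
def nilradDerived (b : (rootSystem H).Base) (q : b.support) : Submodule ℂ g :=
  Submodule.span ℂ {z | ∃ x ∈ nilrad b q, ∃ y ∈ nilrad b q, ⁅x, y⁆ = z}

lemma lie_nilrad_of_mem_gr_zero {b : (rootSystem H).Base} {q : b.support} {x y : g}
    (hx : x ∈ gr b q 0) (hy : y ∈ nilrad b q) : ⁅x, y⁆ ∈ nilrad b q := by
  rw [nilrad] at hy
  induction hy using Submodule.iSup_induction' with
  | mem j y hy => exact gr_le_nilrad b q (j := 0 + (j + 1)) (by omega) (lie_mem_gr hx hy)
  | zero => simp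
  | add y z _ _ hy hz => rw [lie_add]; exact add_mem hy hz

lemma lie_nilradDerived_of_mem_gr_zero {b : (rootSystem H).Base} {q : b.support} {x y : g}
    (hx : x ∈ gr b q 0) (hy : y ∈ nilradDerived b q) : ⁅x, y⁆ ∈ nilradDerived b q := by
  induction hy using Submodule.span_induction with
  | mem y hy =>
    obtain ⟨u, hu, v, hv, rfl⟩ := hy
    rw [leibniz_lie]
    exact add_mem (Submodule.subset_span ⟨_, lie_nilrad_of_mem_gr_zero hx hu, _, hv, rfl⟩)
      (Submodule.subset_span ⟨_, hu, _, lie_nilrad_of_mem_gr_zero hx hv, rfl⟩)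
  | zero => simp
  | add y z _ _ hy hz => rw [lie_add]; exact add_mem hy hz
  | smul a y _ hy => rw [lie_smul]; exact Submodule.smul_mem _ _ hy

lemma lie_nilradDerived_eq_zero {b : (rootSystem H).Base} {q : b.support}
    (h : ∀ x ∈ nilrad b q, ∀ y ∈ nilrad b q, ∀ z ∈ nilrad b q, ⁅x, ⁅y, z⁆⁆ = 0) {x y : g}
    (hx : x ∈ nilrad b q) (hy : y ∈ nilradDerived b q) : ⁅x, y⁆ = 0 := by
  induction hy using Submodule.span_induction with
  | mem y hy =>
    obtain ⟨u, hu, v, hv, rfl⟩ := hy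
    exact h x hx u hu v hv
  | zero => simp
  | add y z _ _ hy hz => rw [lie_add, hy, hz, add_zero]
  | smul a y _ hy => rw [lie_smul, hy, smul_zero]

open Classical in
lemma posRoot_apply_le_two {b : (rootSystem H).Base} {q : b.support}
    (h : ∀ x ∈ nilrad b q, ∀ y ∈ nilrad b q, ∀ z ∈ nilrad b q, ⁅x, ⁅y, z⁆⁆ = 0)
    (i : H.root) (hi : b.IsPos i) :
    ∃ m : ℤ, (i : Weight ℂ H g) (gradingElement b q) = m ∧ 0 ≤ m ∧ m ≤ 2 ∧
      (m = 2 → (rootSpace H (i : Weight ℂ H g)).toSubmodule ≤ nilradDerived b q) := by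
  refine hi.induction_on_add (p := fun i ↦
    ∃ m : ℤ, (i : Weight ℂ H g) (gradingElement b q) = m ∧ 0 ≤ m ∧ m ≤ 2 ∧
      (m = 2 → (rootSpace H (i : Weight ℂ H g)).toSubmodule ≤ nilradDerived b q)) ?_ ?_
  · intro i hi
    rw [simpleRoot_apply_gradingElement b q hi]
    split
    · exact ⟨1, by simp⟩
    · exact ⟨0, by simp⟩
  · rintro i j k hk ⟨m, hm, h0, h2, hd⟩ hj
    have hk' : ((k : Weight ℂ H g) : H → ℂ) = (j : Weight ℂ H g) + (i : Weight ℂ H g) := by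
      ext y
      have := LinearMap.congr_fun hk y
      simp only [rootSystem_root_apply, LinearMap.add_apply, Weight.toLinear_apply] at this
      rw [this, Pi.add_apply, add_comm]
    have hk0 : ((j : Weight ℂ H g) + (i : Weight ℂ H g) : H → ℂ) ≠ 0 := by
      rw [← hk']
      exact fun h ↦ (LieSubalgebra.isNonZero_coe_root k) h
    have hdec : ∀ z ∈ rootSpace H (k : Weight ℂ H g), z ≠ 0 →
        ∃ e ∈ rootSpace H (j : Weight ℂ H g), ∃ x ∈ rootSpace H (i : Weight ℂ H g),
          ⁅e, x⁆ = z := fun z hz hz0 ↦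
      exists_lie_eq_of_mem_rootSpace_add (LieSubalgebra.isNonZero_coe_root j)
        (by rwa [← hk']) hz0 hk0
    have hval := simpleRoot_apply_gradingElement b q hj
    by_cases hjq : j = (q : H.root)
    · rw [if_pos hjq] at hval
      have hjn : (rootSpace H (j : Weight ℂ H g)).toSubmodule ≤ nilrad b q :=
        (rootSpace_le_gr b q (m := 1) (by simpa using hval)).trans (gr_le_nilrad b q (by omega))
      have hm2 : m ≠ 2 := by
        intro hm2
        obtain ⟨z, hz, hz0⟩ := (k : Weight ℂ H g).exists_ne_zero
        obtain ⟨e, he, x, hx, rfl⟩ := hdec z hz hz0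
        exact hz0 (lie_nilradDerived_eq_zero h (hjn he) (hd hm2 hx))
      refine ⟨m + 1, ?_, by omega, by omega, ?_⟩
      · rw [hk', Pi.add_apply, hval, hm]; push_cast; ring
      · intro hm1 z hz
        by_cases hz0 : z = 0
        · rw [hz0]; exact zero_mem _
        obtain ⟨e, he, x, hx, rfl⟩ := hdec z hz hz0
        have hin : (rootSpace H (i : Weight ℂ H g)).toSubmodule ≤ nilrad b q :=
          (rootSpace_le_gr b q hm).trans (gr_le_nilrad b q (by omega))
        exact Submodule.subset_span ⟨e, hjn he, x, hin hx, rfl⟩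
    · rw [if_neg hjq] at hval
      refine ⟨m, ?_, h0, h2, ?_⟩
      · rw [hk', Pi.add_apply, hval, hm, zero_add]
      · intro hm2 z hz
        by_cases hz0 : z = 0
        · rw [hz0]; exact zero_mem _
        obtain ⟨e, he, x, hx, rfl⟩ := hdec z hz hz0
        exact lie_nilradDerived_of_mem_gr_zero
          (rootSpace_le_gr b q (m := 0) (by simpa using hval) he) (hd hm2 hx)

lemma gr_eq_bot {b : (rootSystem H).Base} {q : b.support}
    (h : ∀ x ∈ nilrad b q, ∀ y ∈ nilrad b q, ∀ z ∈ nilrad b q, ⁅x, ⁅y, z⁆⁆ = 0)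
    {j : ℤ} (hj : j < -2) : gr b q j = ⊥ := by
  have hw : ∀ α : Weight ℂ H g, ∃ m : ℤ, α (gradingElement b q) = m ∧ m ≠ j := by
    intro α
    by_cases hα : α.IsZero
    · exact ⟨0, by simp [hα.eq], by omega⟩
    · obtain ⟨i, rfl⟩ : ∃ i : H.root, (i : Weight ℂ H g) = α := ⟨⟨α, by simpa using hα⟩, rfl⟩
      let := (rootSystem H).indexNeg
      rcases RootPairing.Base.IsPos.or_neg b i with hi | hi
      · obtain ⟨m, hm, h0, -⟩ := posRoot_apply_le_two h i hi
        exact ⟨m, hm, by omega⟩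
      · obtain ⟨m, hm, h0, h2, -⟩ := posRoot_apply_le_two h (-i) hi
        refine ⟨-m, ?_, by omega⟩
        have e0 : (rootSystem H).root (-i) = -(rootSystem H).root i := by
          rw [RootPairing.indexNeg_neg, RootPairing.root_reflectionPerm,
            RootPairing.reflection_apply_self]
        have e := LinearMap.congr_fun e0 (gradingElement b q)
        have e2 : ((-i : H.root) : Weight ℂ H g) (gradingElement b q) =
          -((i : Weight ℂ H g) (gradingElement b q)) := e
        rw [e2] at hm
        push_cast
        rw [← hm, neg_neg]
  have htop : ⨆ k, ⨆ (_ : k ≠ j), gr b q k = ⊤ := by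
    rw [eq_top_iff]
    have h2 := congrArg LieSubmodule.toSubmodule (iSup_genWeightSpace_eq_top' ℂ H g)
    rw [LieSubmodule.iSup_toSubmodule, LieSubmodule.top_toSubmodule] at h2
    rw [← h2, iSup_le_iff]
    intro α
    obtain ⟨m, hm, hmj⟩ := hw α
    exact (rootSpace_le_gr b q hm).trans (le_biSup (gr b q) hmj)
  have := iSupIndep_gr b q j
  rwa [htop, disjoint_top] at this

/-- If `n` is two-step nilpotent then so is `n̄`. -/
lemma lie_lie_oppNilrad {b : (rootSystem H).Base} {q : b.support}
    (h : ∀ x ∈ nilrad b q, ∀ y ∈ nilrad b q, ∀ z ∈ nilrad b q, ⁅x, ⁅y, z⁆⁆ = 0)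
    {x y z : g} (hx : x ∈ oppNilrad b q) (hy : y ∈ oppNilrad b q) (hz : z ∈ oppNilrad b q) :
    ⁅x, ⁅y, z⁆⁆ = 0 := by
  rw [oppNilrad] at hx hy hz
  induction hx using Submodule.iSup_induction' with
  | zero => simp
  | add x x' _ _ h1 h2 => rw [add_lie, h1, h2, add_zero]
  | mem j x hx =>
  induction hy using Submodule.iSup_induction' with
  | zero => simp
  | add x x' _ _ h1 h2 => rw [add_lie, lie_add, h1, h2, add_zero]
  | mem k y hy =>
  induction hz using Submodule.iSup_induction' with
  | zero => simp
  | add x x' _ _ h1 h2 => rw [lie_add, lie_add, h1, h2, add_zero]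
  | mem l z hz =>
  have := lie_mem_gr hx (lie_mem_gr hy hz)
  rw [gr_eq_bot h (by omega)] at this
  simpa using this

lemma lie_mem_oppNilrad {b : (rootSystem H).Base} {q : b.support}
    {x y : g} (hx : x ∈ oppNilrad b q) (hy : y ∈ oppNilrad b q) : ⁅x, y⁆ ∈ oppNilrad b q := by
  rw [oppNilrad] at hx hy
  induction hx using Submodule.iSup_induction' with
  | zero => simp
  | add x x' _ _ h1 h2 => rw [add_lie]; exact add_mem h1 h2
  | mem j x hx =>
  induction hy using Submodule.iSup_induction' with
  | zero => simp
  | add x x' _ _ h1 h2 => rw [lie_add]; exact add_mem h1 h2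
  | mem k y hy => exact gr_le_oppNilrad b q (by omega) (lie_mem_gr hx hy)


end Grading

section NBar

variable {g : Type*} [LieRing g] [LieAlgebra ℂ g] [Module.Finite ℂ g] [LieAlgebra.IsSimple ℂ g]

/-- A maximal parabolic subalgebra of quasi-Heisenberg type of a complex simple Lie algebra `g`,
together with a real form. The data are a base of the root system of `(g, H)`, hence a positive
system, a simple root `α_q` (the `node`), which determines `q = l ⊕ n`, and the
complex conjugation `conj` of `g` with respect to a real form `g₀ = {x | conj x = x}`.

* `n` is quasi-Heisenberg: `[n, [n, n]] = 0` and `dim [n, n] > 1`;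
* `conj` is an antilinear involutive automorphism of `g`, and both `q` and `n̄` are
  complexifications of their intersections with `g₀`. -/
structure QuasiHeisenbergDatum (H : LieSubalgebra ℂ g) [H.IsCartanSubalgebra] where
  /-- the simple roots -/
  base : (rootSystem H).Base
  /-- the simple root `α_q` -/
  node : base.support
  lie_lie_nilrad : ∀ x ∈ nilrad base node, ∀ y ∈ nilrad base node, ∀ z ∈ nilrad base node,
    ⁅x, ⁅y, z⁆⁆ = 0
  one_lt_finrank : 1 < finrank ℂ (nilradDerived base node)
  /-- the conjugation of `g` with respect to the real form -/
  conj : g →ₛₗ[starRingEnd ℂ] g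
  conj_conj : ∀ x, conj (conj x) = x
  conj_lie : ∀ x y, conj ⁅x, y⁆ = ⁅conj x, conj y⁆
  conj_parabolic : ∀ x ∈ parabolic base node, conj x ∈ parabolic base node
  conj_oppNilrad : ∀ x ∈ oppNilrad base node, conj x ∈ oppNilrad base node

namespace QuasiHeisenbergDatum

variable {H : LieSubalgebra ℂ g} [H.IsCartanSubalgebra] (P : QuasiHeisenbergDatum H)

/-- The Levi subalgebra `l = g(0)`. -/
abbrev levi : LieSubalgebra ℂ g := ConfInv.levi P.base P.node

/-- `n̄` -/
abbrev nbar : Submodule ℂ g := oppNilrad P.base P.node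

/-- The real form `n̄₀ = n̄ ∩ g₀` of `n̄`. -/
def nbar₀ : Submodule ℝ g where
  carrier := {x | x ∈ P.nbar ∧ P.conj x = x}
  zero_mem' := ⟨zero_mem _, map_zero _⟩
  add_mem' := fun ⟨h1, h2⟩ ⟨h3, h4⟩ ↦ ⟨add_mem h1 h3, by rw [map_add, h2, h4]⟩
  smul_mem' := fun r x ⟨h1, h2⟩ ↦ ⟨P.nbar.smul_mem (r : ℂ) h1, by
    rw [← Complex.coe_smul, map_smulₛₗ, h2, Complex.conj_ofReal]⟩

/-- The Lie bracket of `n̄₀`. -/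
def nbarBracket (x y : P.nbar₀) : P.nbar₀ :=
  ⟨⁅(x : g), (y : g)⁆, lie_mem_oppNilrad x.2.1 y.2.1, by rw [P.conj_lie, x.2.2, y.2.2]⟩

/-- The connected, simply connected (unipotent) Lie group `N̄₀` with Lie algebra `n̄₀`. Its
exponential map `exp : n̄₀ → N̄₀` is a diffeomorphism with inverse `log`, through which the group is
realized here. -/
@[ext] structure NBar where
  exp ::
  /-- the inverse of the exponential map -/
  log : P.nbar₀

variable {P}

namespace NBar

/-- The Baker-Campbell-Hausdorff multiplication `exp x exp y = exp (x + y + [x, y] / 2)`, which is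
exact as `n̄₀` is two-step nilpotent. -/
instance : Mul P.NBar :=
  ⟨fun x y ↦ exp (x.log + y.log + (2⁻¹ : ℝ) • P.nbarBracket x.log y.log)⟩

instance : One P.NBar := ⟨exp 0⟩

instance : Inv P.NBar := ⟨fun x ↦ exp (-x.log)⟩

lemma log_mul (x y : P.NBar) :
    (((x * y).log : P.nbar₀) : g) = x.log + y.log + (2⁻¹ : ℝ) • ⁅(x.log : g), (y.log : g)⁆ := rfl

lemma log_one : ((1 : P.NBar).log : P.nbar₀) = 0 := rfl

lemma log_inv (x : P.NBar) : (x⁻¹).log = -x.log := rfl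

lemma ext' {x y : P.NBar} (h : (x.log : g) = y.log) : x = y := NBar.ext (Subtype.ext h)

instance : Group P.NBar where
  mul_assoc x y z := by
    apply ext'
    have h (a b c : P.NBar) : ⁅(a.log : g), ⁅(b.log : g), (c.log : g)⁆⁆ = 0 :=
      lie_lie_oppNilrad P.lie_lie_nilrad a.log.2.1 b.log.2.1 c.log.2.1
    have h' (a b c : P.NBar) : ⁅⁅(a.log : g), (b.log : g)⁆, (c.log : g)⁆ = 0 := by
      rw [← lie_skew, h, neg_zero]
    simp only [log_mul, ← Complex.coe_smul, add_lie, lie_add, smul_lie, lie_smul, h, h']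
    module
  one_mul x := by apply ext'; simp [log_mul, log_one]
  mul_one x := by apply ext'; simp [log_mul, log_one]
  inv_mul_cancel x := by apply ext'; simp [log_mul, log_one, log_inv]

end NBar

variable (P)

/-- Linear coordinates on `n̄₀`; by `exp` they give a global chart of `N̄₀`. -/
def coords : P.nbar₀ ≃ₗ[ℝ] (Fin (finrank ℝ P.nbar₀) → ℝ) :=
  (Module.finBasis ℝ P.nbar₀).equivFun

variable {P} in
/-- A function on `N̄₀`, written in the exponential chart. -/
def inChart (f : P.NBar → ℂ) (v : Fin (finrank ℝ P.nbar₀) → ℝ) : ℂ :=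
  f (NBar.exp (P.coords.symm v))

/-- The algebra `C^∞(N̄₀, ℂ)`, which is also the space of smooth sections of the trivial line
bundle `L_s` over `N̄₀`. -/
def SmoothFn : Subalgebra ℂ (P.NBar → ℂ) where
  carrier := {f | ContDiff ℝ ∞ (inChart f)}
  mul_mem' {a c} (h1 : ContDiff ℝ ∞ (inChart a)) (h2 : ContDiff ℝ ∞ (inChart c)) :=
    show ContDiff ℝ ∞ (fun v ↦ inChart a v * inChart c v) from h1.mul h2
  add_mem' {a c} (h1 : ContDiff ℝ ∞ (inChart a)) (h2 : ContDiff ℝ ∞ (inChart c)) :=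
    show ContDiff ℝ ∞ (fun v ↦ inChart a v + inChart c v) from h1.add h2
  algebraMap_mem' r := show ContDiff ℝ ∞ (fun _ ↦ r) from contDiff_const

variable {P}

lemma contDiff_inChart (f : P.SmoothFn) : ContDiff ℝ ∞ (inChart (f : P.NBar → ℂ)) := f.2

/-- The left-invariant vector field on `N̄₀` given by `X`, written in the exponential chart. -/
def leftInvField (X : P.nbar₀) (v : Fin (finrank ℝ P.nbar₀) → ℝ) :
    Fin (finrank ℝ P.nbar₀) → ℝ :=
  P.coords (X + (2⁻¹ : ℝ) • P.nbarBracket (P.coords.symm v) X)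

lemma inChart_eq (f : P.NBar → ℂ) (n : P.NBar) : inChart f (P.coords n.log) = f n := by
  simp [inChart]

lemma contDiff_leftInvField (X : P.nbar₀) : ContDiff ℝ ∞ (leftInvField X) := by
  let L : (Fin (finrank ℝ P.nbar₀) → ℝ) →ₗ[ℝ] (Fin (finrank ℝ P.nbar₀) → ℝ) :=
    { toFun := fun v ↦ P.coords ((2⁻¹ : ℝ) • P.nbarBracket (P.coords.symm v) X)
      map_add' := fun v w ↦ by
        rw [← map_add, ← smul_add]
        congr 2
        ext
        simp [nbarBracket]
      map_smul' := fun r v ↦ by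
        rw [RingHom.id_apply, ← map_smul, smul_comm]
        congr 2
        ext
        simp [nbarBracket, ← Complex.coe_smul] }
  have : leftInvField X = fun v ↦ P.coords X + L.toContinuousLinearMap v := by
    ext v
    simp [leftInvField, L]
  rw [this]
  exact contDiff_const.add (ContinuousLinearMap.contDiff _)

lemma hasDerivAt_mul_exp (f : P.SmoothFn) (n : P.NBar) (X : P.nbar₀) :
    HasDerivAt (fun t : ℝ ↦ (f : P.NBar → ℂ) (n * NBar.exp (t • X)))
      (fderiv ℝ (inChart (f : P.NBar → ℂ)) (P.coords n.log) (leftInvField X (P.coords n.log))) 0 := by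
  have h1 : (fun t : ℝ ↦ (f : P.NBar → ℂ) (n * NBar.exp (t • X))) =
      fun t ↦ inChart (f : P.NBar → ℂ)
        (P.coords n.log + t • leftInvField X (P.coords n.log)) := by
    ext t
    rw [inChart, leftInvField, LinearEquiv.symm_apply_apply, ← map_smul, ← map_add,
      LinearEquiv.symm_apply_apply]
    refine congrArg (f : P.NBar → ℂ) (NBar.ext' ?_)
    simp [NBar.log_mul, nbarBracket, ← Complex.coe_smul]
    module
  rw [h1]
  have hd : HasFDerivAt (inChart (f : P.NBar → ℂ))
      (fderiv ℝ (inChart (f : P.NBar → ℂ)) (P.coords n.log))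
      (P.coords n.log + (0 : ℝ) • leftInvField X (P.coords n.log)) := by
    rw [zero_smul, add_zero]
    exact (((contDiff_inChart f).differentiable (by simp)) _).hasFDerivAt
  have hl : HasDerivAt (fun t : ℝ ↦ P.coords n.log + t • leftInvField X (P.coords n.log))
      (leftInvField X (P.coords n.log)) 0 := by
    simpa using ((hasDerivAt_id (0 : ℝ)).smul_const (leftInvField X (P.coords n.log))).const_add
      (P.coords n.log)
  exact hd.comp_hasDerivAt (0 : ℝ) hl

/-- Right differentiation by `X ∈ n̄₀`: `(R(X) f)(n) = d/dt f(n exp(tX))` at `t = 0`. -/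
def rightDeriv (X : P.nbar₀) : Module.End ℂ P.SmoothFn where
  toFun f := ⟨fun n ↦ deriv (fun t : ℝ ↦ (f : P.NBar → ℂ) (n * NBar.exp (t • X))) 0, by
    have : (inChart fun n ↦ deriv (fun t : ℝ ↦ (f : P.NBar → ℂ) (n * NBar.exp (t • X))) 0) =
        fun v ↦ fderiv ℝ (inChart (f : P.NBar → ℂ)) v (leftInvField X v) := by
      ext v
      rw [inChart, (hasDerivAt_mul_exp f _ X).deriv]
      simp
    change ContDiff ℝ ∞ _
    rw [this]
    exact ((contDiff_inChart f).fderiv_right (m := ∞) (by simp)).clm_apply (contDiff_leftInvField X)⟩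
  map_add' f h := by
    ext n
    exact ((hasDerivAt_mul_exp f n X).add (hasDerivAt_mul_exp h n X)).deriv.trans
      (by rw [← (hasDerivAt_mul_exp f n X).deriv, ← (hasDerivAt_mul_exp h n X).deriv]; rfl)
  map_smul' c f := by
    ext n
    exact ((hasDerivAt_mul_exp f n X).const_mul c).deriv.trans
      (by rw [← (hasDerivAt_mul_exp f n X).deriv]; rfl)

lemma rightDeriv_apply (X : P.nbar₀) (f : P.SmoothFn) (n : P.NBar) :
    (rightDeriv X f : P.NBar → ℂ) n =
      fderiv ℝ (inChart (f : P.NBar → ℂ)) (P.coords n.log) (leftInvField X (P.coords n.log)) :=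
  (hasDerivAt_mul_exp f n X).deriv

lemma rightDeriv_add (X Y : P.nbar₀) : rightDeriv (X + Y) = rightDeriv X + rightDeriv Y := by
  ext f n
  have : leftInvField (X + Y) (P.coords n.log) =
      leftInvField X (P.coords n.log) + leftInvField Y (P.coords n.log) := by
    rw [leftInvField, leftInvField, leftInvField, ← map_add]
    congr 1
    ext
    simp [nbarBracket]
    abel
  change (rightDeriv (X + Y) f : P.NBar → ℂ) n =
    (rightDeriv X f : P.NBar → ℂ) n + (rightDeriv Y f : P.NBar → ℂ) n
  rw [rightDeriv_apply, rightDeriv_apply, rightDeriv_apply, this, map_add]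

lemma rightDeriv_smul (r : ℝ) (X : P.nbar₀) : rightDeriv (r • X) = (r : ℂ) • rightDeriv X := by
  ext f n
  have : leftInvField (r • X) (P.coords n.log) = r • leftInvField X (P.coords n.log) := by
    rw [leftInvField, leftInvField, ← map_smul]
    congr 1
    ext
    simp [nbarBracket, ← Complex.coe_smul]
    module
  change (rightDeriv (r • X) f : P.NBar → ℂ) n = r * (rightDeriv X f : P.NBar → ℂ) n
  rw [rightDeriv_apply, rightDeriv_apply, this, map_smul, Complex.real_smul]

variable (P)

/-- The real part of `Z ∈ n̄ = n̄₀ ⊕ i n̄₀`. -/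
def rePart (Z : P.nbar) : P.nbar₀ :=
  ⟨(2⁻¹ : ℂ) • ((Z : g) + P.conj Z),
    P.nbar.smul_mem _ (add_mem Z.2 (P.conj_oppNilrad _ Z.2)), by
    rw [map_smulₛₗ, map_add, P.conj_conj, map_inv₀, Complex.conj_ofNat, add_comm]⟩

/-- The imaginary part of `Z ∈ n̄ = n̄₀ ⊕ i n̄₀`. -/
def imPart (Z : P.nbar) : P.nbar₀ :=
  ⟨(2⁻¹ * -Complex.I) • ((Z : g) - P.conj Z),
    P.nbar.smul_mem _ (sub_mem Z.2 (P.conj_oppNilrad _ Z.2)), by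
    rw [map_smulₛₗ, map_sub, P.conj_conj, map_mul, map_inv₀, Complex.conj_ofNat, map_neg,
      Complex.conj_I, neg_neg, ← neg_sub (Z : g), smul_neg, mul_neg, neg_smul]⟩

lemma rePart_add_imPart (Z : P.nbar) :
    ((P.rePart Z : P.nbar₀) : g) + Complex.I • ((P.imPart Z : P.nbar₀) : g) = Z := by
  simp only [rePart, imPart, smul_smul]
  rw [show Complex.I * (2⁻¹ * -Complex.I) = 2⁻¹ by linear_combination (-2⁻¹) * Complex.I_mul_I]
  module

/-- The action `R` of `n̄` on `C^∞(N̄₀, ℂ)` by right differentiation, extended `ℂ`-linearly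
from `n̄₀`. -/
def R : P.nbar →ₗ[ℂ] Module.End ℂ P.SmoothFn where
  toFun Z := rightDeriv (P.rePart Z) + Complex.I • rightDeriv (P.imPart Z)
  map_add' Z W := by
    have h1 : P.rePart (Z + W) = P.rePart Z + P.rePart W := by
      ext; simp [rePart]; module
    have h2 : P.imPart (Z + W) = P.imPart Z + P.imPart W := by
      ext; simp [imPart]; module
    rw [h1, h2, rightDeriv_add, rightDeriv_add]
    module
  map_smul' c Z := by
    have hc : c = c.re + c.im * Complex.I := (Complex.re_add_im c).symm
    have hcc : starRingEnd ℂ c = c.re - c.im * Complex.I := by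
      apply Complex.ext <;> simp
    have h1 : P.rePart (c • Z) = c.re • P.rePart Z + (-c.im) • P.imPart Z := by
      ext
      simp only [rePart, imPart, Submodule.coe_smul, map_smulₛₗ, Submodule.coe_add,
        ← Complex.coe_smul, Complex.ofReal_neg]
      match_scalars
      · linear_combination 2⁻¹ * hc
      · linear_combination 2⁻¹ * hcc
    have h2 : P.imPart (c • Z) = c.re • P.imPart Z + c.im • P.rePart Z := by
      ext
      simp only [rePart, imPart, Submodule.coe_smul, map_smulₛₗ, Submodule.coe_add,
        ← Complex.coe_smul]
      match_scalars
      · linear_combination (2⁻¹ * -Complex.I) * hc - 2⁻¹ * c.im * Complex.I_mul_I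
      · linear_combination (2⁻¹ * Complex.I) * hcc - 2⁻¹ * c.im * Complex.I_mul_I
    rw [h1, h2, rightDeriv_add, rightDeriv_add, rightDeriv_smul, rightDeriv_smul,
      rightDeriv_smul, rightDeriv_smul, RingHom.id_apply]
    nth_rewrite 5 [← Complex.re_add_im c]
    push_cast
    match_scalars
    · ring
    · linear_combination (-(c.im : ℂ)) * Complex.I_mul_I


/-- The exponential `exp(ad x)` for `ad x` nilpotent: the powers of a nilpotent endomorphism
with exponent at least `dim g` vanish, so that the finite sum is the exponential series. -/
def expAd (x : g) : Module.End ℂ g :=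
  ∑ k ∈ Finset.range (finrank ℂ g), ((k.factorial : ℂ)⁻¹) • (ad ℂ g x) ^ k

variable {P} in
/-- The adjoint action of `N̄₀` on `g`, `Ad(exp x) = exp(ad x)`. -/
def Ad (n : P.NBar) : Module.End ℂ g := expAd (n.log : g)

lemma contDiff_dual_ad_pow (Y : g) (k : ℕ) (φ : Dual ℂ g) :
    ContDiff ℝ ∞ fun v ↦ φ (((ad ℂ g (-(P.coords.symm v : g))) ^ k) Y) := by
  induction k generalizing φ with
  | zero => exact (contDiff_const : ContDiff ℝ ∞ fun _ : Fin (finrank ℝ P.nbar₀) → ℝ ↦ φ Y)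
  | succ k ih =>
    have : (fun v ↦ φ (((ad ℂ g (-(P.coords.symm v : g))) ^ (k + 1)) Y)) = fun v ↦
        ∑ a, ((v a : ℝ) : ℂ) * (-(φ ∘ₗ ad ℂ g (P.coords.symm (Pi.single a 1) : g)))
          (((ad ℂ g (-(P.coords.symm v : g))) ^ k) Y) := by
      ext v
      have hv : (P.coords.symm v : g) =
          ∑ a, ((v a : ℝ) : ℂ) • (P.coords.symm (Pi.single a 1) : g) := by
        conv_lhs => rw [← Finset.univ_sum_single v]
        rw [map_sum, AddSubmonoidClass.coe_finsetSum]
        refine Finset.sum_congr rfl fun a _ ↦ ?_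
        rw [show (Pi.single a (v a) : Fin (finrank ℝ P.nbar₀) → ℝ) = v a • Pi.single a 1 by
          rw [← Pi.single_smul, smul_eq_mul, mul_one], map_smul]
        simp [← Complex.coe_smul]
      rw [pow_succ', Module.End.mul_apply]
      generalize ((ad ℂ g (-(P.coords.symm v : g))) ^ k) Y = W
      rw [hv]
      simp [-Complex.coe_smul]
    rw [this]
    refine ContDiff.sum fun a _ ↦ ContDiff.mul ?_ (ih _)
    exact Complex.ofRealCLM.contDiff.comp (contDiff_apply ℝ ℝ a)

/-- The smooth functions `n ↦ φ(Ad(n⁻¹) Y)`. -/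
def adCoeff (φ : Dual ℂ g) (Y : g) : P.SmoothFn :=
  ⟨fun n ↦ φ (Ad n⁻¹ Y), by
    change ContDiff ℝ ∞ fun v ↦ φ (expAd (-(P.coords.symm v : g)) Y)
    simp only [expAd, LinearMap.sum_apply, LinearMap.smul_apply, map_sum, map_smul]
    exact ContDiff.sum fun k _ ↦ contDiff_const.mul (P.contDiff_dual_ad_pow Y k φ)⟩

/-- The projection `Y ↦ Y_n̄` along `g = n̄ ⊕ q`. -/
def toNbar : g →ₗ[ℂ] P.nbar :=
  Submodule.projectionOnto _ _ (isCompl_oppNilrad_parabolic P.base P.node)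

/-- The projection `Y ↦ Y_q` along `g = n̄ ⊕ q`. -/
def toQ : g →ₗ[ℂ] parabolic P.base P.node :=
  Submodule.projectionOnto _ _ (isCompl_oppNilrad_parabolic P.base P.node).symm

/-- The fundamental weight `λ_q` of the simple root `α_q`. -/
def fundamentalWeight : Dual ℂ H := P.base.toCoweightBasis.coord P.node

/-- The weight `λ_q` as a functional on `g` by means of the Killing form: it is equal to `λ_q` on the
Cartan subalgebra and vanishes on the root spaces. Its restriction to `q` is the differential
of the character `χ_q`. -/
def lambdaQ : Dual ℂ g :=
  killingForm ℂ g ((cartanEquivDual (K := ℂ) H).symm P.fundamentalWeight : g)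

lemma lambdaQ_apply (h : H) : P.lambdaQ h = P.fundamentalWeight h := by
  rw [← LinearMap.congr_fun ((cartanEquivDual (K := ℂ) H).apply_symm_apply P.fundamentalWeight) h]
  rfl

lemma lambdaQ_apply_rootSpace (α : H.root) {x : g} (hx : x ∈ rootSpace H (α : Weight ℂ H g)) :
    P.lambdaQ x = 0 := by
  refine killingForm_apply_eq_zero_of_mem_rootSpace_of_add_ne_zero ℂ g H (α := 0)
    (β := (α : Weight ℂ H g)) ?_ hx ?_
  · exact toLieSubmodule_le_rootSpace_zero ℂ g H (Subtype.property _)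
  · rw [zero_add]; exact fun h ↦ (LieSubalgebra.isNonZero_coe_root α) h

/-- The action `π_s` of `g` on the smooth sections of `L_s` over `N̄₀`:
`(π_s(Y) f)(n) = s λ_q((Ad(n⁻¹)Y)_q) f(n) - (R((Ad(n⁻¹)Y)_n̄) f)(n)`. -/
def piS (s : ℂ) (Y : g) : Module.End ℂ P.SmoothFn where
  toFun f := ⟨fun n ↦ s * P.lambdaQ (P.toQ (Ad n⁻¹ Y)) * (f : P.NBar → ℂ) n
      - (P.R (P.toNbar (Ad n⁻¹ Y)) f : P.NBar → ℂ) n, by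
    let B := Module.finBasis ℂ P.nbar
    have : (fun n ↦ s * P.lambdaQ (P.toQ (Ad n⁻¹ Y)) * (f : P.NBar → ℂ) n
      - (P.R (P.toNbar (Ad n⁻¹ Y)) f : P.NBar → ℂ) n) =
      ((s • P.adCoeff (P.lambdaQ ∘ₗ (Submodule.subtype _) ∘ₗ P.toQ) Y * f
        - ∑ a, P.adCoeff (B.coord a ∘ₗ P.toNbar) Y * P.R (B a) f : P.SmoothFn) :
          P.NBar → ℂ) := by
      ext n
      have h : P.toNbar (Ad n⁻¹ Y) = ∑ a, B.coord a (P.toNbar (Ad n⁻¹ Y)) • B a := by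
        simp
      conv_lhs => rw [h, map_sum]
      simp only [map_smul, LinearMap.sum_apply, LinearMap.smul_apply]
      simp [adCoeff, mul_assoc]
    rw [this]
    exact Subtype.property _⟩
  map_add' f h := by
    ext n
    simp
    ring
  map_smul' c f := by
    ext n
    simp
    ring

/-- The linear functional `D_n : f ↦ (D f)(n)`. -/
def evalAt (n : P.NBar) (D : Module.End ℂ P.SmoothFn) : Dual ℂ P.SmoothFn :=
  (LinearMap.proj n ∘ₗ P.SmoothFn.val.toLinearMap) ∘ₗ D

/-- The algebra `𝔻(L_s)` of differential operators on the trivial line bundle over `N̄₀`: it is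
generated by the multiplications by smooth functions and by the smooth vector fields, that is,
the derivations of `C^∞(N̄₀, ℂ)`. -/
def diffOps : Subalgebra ℂ (Module.End ℂ P.SmoothFn) :=
  Algebra.adjoin ℂ (Set.range (LinearMap.mulLeft ℂ (A := P.SmoothFn)) ∪
    Set.range fun ξ : Derivation ℂ P.SmoothFn P.SmoothFn ↦ (ξ : P.SmoothFn →ₗ[ℂ] P.SmoothFn))

variable {P} in
/-- A list `D_1, …, D_m` of differential operators is a conformally invariant system with respect to
`π` if it is linearly independent at each point and if `[π(X), D_i] = ∑ j, C_{ji}(X) D_j` for each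
`X`, with a matrix `C(X)` of smooth functions. -/
structure IsConformallyInvariant (π : g → Module.End ℂ P.SmoothFn) {m : ℕ}
    (D : Fin m → Module.End ℂ P.SmoothFn) : Prop where
  mem_diffOps : ∀ i, D i ∈ P.diffOps
  linearIndependent : ∀ n : P.NBar, LinearIndependent ℂ fun i ↦ P.evalAt n (D i)
  exists_structure : ∀ X : g, ∃ C : Matrix (Fin m) (Fin m) P.SmoothFn, ∀ i,
    π X * D i - D i * π X = ∑ j, C j i • D j

variable {P} in
/-- Equivalence of two lists of operators: `D'_i = ∑ j, A_{ji} D_j` with `A` an invertible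
matrix of smooth functions. -/
def AreEquivalent {m : ℕ} (D D' : Fin m → Module.End ℂ P.SmoothFn) : Prop :=
  ∃ A : GL (Fin m) P.SmoothFn, ∀ i, D' i = ∑ j, (A : Matrix (Fin m) (Fin m) P.SmoothFn) j i • D j

/-- The element `ω = ∑ a, X_a^* ⊗ X_a` of `g(-2) ⊗ g(2)`, with `X_a` a basis of `g(2)` and `X_a^*` the
dual basis of `g(-2)` with respect to the Killing form. -/
def omega : g ⊗[ℂ] g :=
  ∑ a, (grDualBasis P.base P.node 2 a : g) ⊗ₜ[ℂ] (grBasis P.base P.node 2 a : g)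

/-- The covariant map `τ₂(X) = (1/2!) (ad(X)² ⊗ id) ω` on `g(1)`, with values in
`g(0) ⊗ g(2) = l ⊗ z(n)`. -/
def tau₂ (X : g) : g ⊗[ℂ] g :=
  (2⁻¹ : ℂ) • TensorProduct.map ((ad ℂ g X) ^ 2) LinearMap.id P.omega

/-- The pairing `(A ⊗ B, C ⊗ D) ↦ κ(A, C) κ(B, D)` given by the Killing form `κ`. -/
def tensorPairing : LinearMap.BilinForm ℂ (g ⊗[ℂ] g) :=
  LinearMap.BilinForm.tmul (killingForm ℂ g) (killingForm ℂ g)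

/-- The quadratic polynomial `X ↦ Y*(τ₂(X))` on `g(1)`. Here the dual module
`l* ⊗ z(n)*` of `l ⊗ z(n)` with respect to the Killing form is `g(0) ⊗ g(-2)`. -/
def tauTilde₂ (Y : g ⊗[ℂ] g) (X : gr P.base P.node 1) : ℂ :=
  tensorPairing Y (P.tau₂ X)

/-- The inclusion of `g(-1)` in `n̄`. -/
def grToNbar : gr P.base P.node (-1) →ₗ[ℂ] P.nbar :=
  Submodule.inclusion (gr_le_oppNilrad P.base P.node (by omega))

/-- The differential operator `Ω₂(Y*) = R ∘ σ ∘ τ̃₂(Y*)`. With `X_a` a basis of `g(1)` and `X_a^*` the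
dual basis of `g(-1)`, the quadratic polynomial `p = τ̃₂(Y*)` on `g(1)` with
polar form `B`, `B(X, X) = p(X)`, is identified with `∑ a c, B(X_a, X_c) X_a^* X_c^*` in
`Sym²(g(-1))`, and the symmetrization is `σ(xy) = (xy + yx) / 2`. -/
def Omega₂ (Y : g ⊗[ℂ] g) : Module.End ℂ P.SmoothFn :=
  let E a := P.R (P.grToNbar (grDualBasis P.base P.node 1 a))
  ∑ a, ∑ c, (2⁻¹ * QuadraticMap.polar (P.tauTilde₂ Y)
      (grBasis P.base P.node 1 a) (grBasis P.base P.node 1 c)) •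
    ((2⁻¹ : ℂ) • (E a * E c + E c * E a))

section HighestWeights

variable {M : Type*} [AddCommGroup M] [Module ℂ M] [LieRingModule g M] [LieModule ℂ g M]

/-- A highest weight vector of weight `ν` in a `g`-module, for the action of `l`: a nonzero vector on
which the Cartan subalgebra acts by `ν` and that is killed by the root spaces of the positive roots
of `l`. -/
structure IsHighestWeightVector (v : M) (ν : Dual ℂ H) : Prop where
  ne_zero : v ≠ 0
  weight : ∀ h : H, ⁅(h : g), v⁆ = ν h • v
  lie_eq_zero : ∀ α : H.root, P.base.IsPos α →
    (rootSpace H (α : Weight ℂ H g)).toSubmodule ≤ gr P.base P.node 0 →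
      ∀ x ∈ rootSpace H (α : Weight ℂ H g), ⁅x, v⁆ = 0

/-- A lowest weight vector of weight `ν`, for the action of `l`. -/
structure IsLowestWeightVector (v : M) (ν : Dual ℂ H) : Prop where
  ne_zero : v ≠ 0
  weight : ∀ h : H, ⁅(h : g), v⁆ = ν h • v
  lie_eq_zero : ∀ α : H.root, P.base.IsPos α →
    (rootSpace H (α : Weight ℂ H g)).toSubmodule ≤ gr P.base P.node 0 →
      ∀ x ∈ rootSpace H (-(α : Weight ℂ H g)), ⁅x, v⁆ = 0

/-- `ν` is a highest weight of the `l`-module `W`. -/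
def HasHighestWeight (W : Submodule ℂ M) (ν : Dual ℂ H) : Prop :=
  ∃ v ∈ W, P.IsHighestWeightVector v ν

end HighestWeights

/-- `V = V(μ + ε)` is a special constituent of `l ⊗ z(n) = g(0) ⊗ g(2)`: an irreducible `l`-submodule
with highest weight `μ + ε`, where `μ` is the highest weight of `g(1)`, `ε` is a root of `g(1)`, and
`μ + ε` is not the highest weight of `z(n) = g(2)`. -/
structure IsSpecialConstituent (V : LieSubmodule ℂ P.levi (g ⊗[ℂ] g)) (μ ε : Dual ℂ H) :
    Prop where
  le : V.toSubmodule ≤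
    Submodule.map₂ (TensorProduct.mk ℂ g g) (gr P.base P.node 0) (gr P.base P.node 2)
  irreducible : LieModule.IsIrreducible ℂ P.levi V
  highestWeight_gr_one : P.HasHighestWeight (gr P.base P.node 1) μ
  root : ∃ β : H.root, (rootSystem H).root β = ε ∧
    (rootSpace H (β : Weight ℂ H g)).toSubmodule ≤ gr P.base P.node 1
  highestWeight : P.HasHighestWeight V.toSubmodule (μ + ε)
  ne_highestWeight_gr_two : ∀ γ, P.HasHighestWeight (gr P.base P.node 2) γ → μ + ε ≠ γ

/-- `Vd` is the dual module `V*` of `V ⊆ g(0) ⊗ g(2)` with respect to the Killing form: an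
`l`-submodule of `g(0) ⊗ g(-2)` on which the pairing with `V` is nondegenerate. -/
structure IsKillingDual (V Vd : LieSubmodule ℂ P.levi (g ⊗[ℂ] g)) : Prop where
  le : Vd.toSubmodule ≤
    Submodule.map₂ (TensorProduct.mk ℂ g g) (gr P.base P.node 0) (gr P.base P.node (-2))
  left_nondegenerate : ∀ y ∈ Vd, (∀ v ∈ V, tensorPairing y v = 0) → y = 0
  right_nondegenerate : ∀ v ∈ V, (∀ y ∈ Vd, tensorPairing y v = 0) → v = 0

/-- A list of operators in `𝔻(L_s)` that commute with `π_s(X)` for `X ∈ n̄` is the `Ω₂|_{V*}` system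
if it is equivalent to `Ω₂(Y_1*), …, Ω₂(Y_m*)` for a basis `Y_1*, …, Y_m*` of `V*`. -/
structure IsOmega₂System (s : ℂ) (Vd : LieSubmodule ℂ P.levi (g ⊗[ℂ] g)) {m : ℕ}
    (D : Fin m → Module.End ℂ P.SmoothFn) : Prop where
  mem_diffOps : ∀ i, D i ∈ P.diffOps
  commute : ∀ i, ∀ X ∈ P.nbar, P.piS s X * D i - D i * P.piS s X = 0
  exists_equivalent : ∃ Y : Basis (Fin m) ℂ Vd, AreEquivalent (fun i ↦ P.Omega₂ (Y i)) D

end QuasiHeisenbergDatum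
end NBar
end ConfInv
end

/-!
Conformal invariance of the `Ω₂|_{V*}` system follows from a single condition at the identity for
the following reasons.

*Reduction to the identity.* The value of `π_s(Y) f` at `n` is that of `T(Ad(n⁻¹) Y) f`, where
`T(y) = s λ_q(y_q) - R(y_n̄)` (`piSymbol`). From this one reads off that `π_s` is a
representation, that `π_s(X)` commutes with `R(Z)` for `X, Z ∈ n̄`, that `[π_s(A), R(Z)] = R([A,
Z])` for `A ∈ l`, and that left translation by `n` carries `π_s(X)` to `π_s(Ad(n⁻¹) X)`, while it
commutes with the operators `Ω₂(Y*)`. Hence `[π_s(X), Ω₂(Y*)]_n` is the left translate of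
`[π_s(Ad(n⁻¹) X), Ω₂(Y*)]_e` (`evalAt_piComm_Omega₂`). As `n̄` has only the degrees `-1` and `-2`,
the group law is given by the Baker-Campbell-Hausdorff formula with one bracket, and `Ad` is a
polynomial of degree at most four (`exp₄_add_add_half`).

*Reduction to one pair of vectors.* Let `S` be the span of the functionals `Ω₂(Y*)_e` with `Y* ∈
V*`. As `Ω₂` is `l`-equivariant, the condition `[π_s(X), Ω₂(Y*)]_e ∈ S` behaves well under `l`: if
it holds for `(X, Y*)`, then the sum of the functionals of `([A, X], Y*)` and `(X, [A, Y*])` is in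
`S` (`commAtOne_lie_add_mem`). For `X = X_h` the first of them vanishes when `A` is a positive
root vector of `l`, so that the condition spreads from `Y_l*` to the subspace that the positive
root vectors generate from `Y_l*`, which is `V*` (`le_of_isLowestWeightVector_mem`). Then it
spreads from `X_h` to the `l`-module `g(1)`, which is generated by any of its weight vectors
(`gr_one_le_of_mem`): a positive root is a sum of simple roots whose partial sums are roots, and
if its `α_q`-coefficient is one, this joins it to `α_q` by roots of `l`.

*From the identity to the group.* Now `[π_s(X), Ω₂(Y*)]_e ∈ S` for all `X` of degree at most one,
a condition that is stable under `Ad(n⁻¹)`. Since `V*` is irreducible and `Ω₂` does not vanish on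
it, `Y* ↦ Ω₂(Y*)_e` is injective on `V*` (`Omega₂At_injOn`), and the coefficients with respect to
a basis are matrix coefficients of `Ad(n⁻¹)`, hence smooth functions of `n`. The elements `X` such
that the commutator with `π_s(X)` preserves the span of the system over the smooth functions form
a Lie subalgebra, and `g` is generated in degrees at most one, because `g(2) = [g(1), g(1)]`
(`eq_top_of_grLE_one_le`).
-/

noncomputable section

namespace ConfInv

/-! ### The truncated exponential series -/

section TruncatedExponential

variable {A : Type*} [Ring A] [Algebra ℂ A]

/-- The exponential series up to degree four, which is the exponential of an element whose fifth
power vanishes. -/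
def exp₄ (x : A) : A := ∑ k ∈ Finset.range 5, ((k.factorial : ℂ)⁻¹) • x ^ k

/-- The Baker-Campbell-Hausdorff formula `exp (x + y + c / 2) = exp x exp y` for `c = xy - yx`
central in the algebra generated by `x` and `y`, when all monomials of weight at least five vanish. -/
lemma exp₄_add_add_half {x y c : A} (h : y * x = x * y - c) (hcx : c * x = x * c)
    (hcy : c * y = y * c) (h0 : ∀ i j k : ℕ, 5 ≤ i + j + 2 * k → x ^ i * y ^ j * c ^ k = 0) :
    exp₄ (x + y + (2⁻¹ : ℂ) • c) = exp₄ x * exp₄ y := by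
  have h' : ∀ z, y * (x * z) = x * (y * z) - c * z := fun z ↦ by
    rw [← mul_assoc, h]; noncomm_ring
  have hcy' : ∀ z, c * (y * z) = y * (c * z) := fun z ↦ by rw [← mul_assoc, hcy, mul_assoc]
  set w := x + y with hw
  have w2 : w ^ 2 = x ^ 2 + (2 : ℂ) • (x * y) + y ^ 2 - c := by
    rw [hw, ← Nat.cast_ofNat (R := ℂ), Nat.cast_smul_eq_nsmul]
    simp only [pow_succ, pow_zero, one_mul, mul_add, add_mul, h]
    noncomm_ring
  have w3 : w ^ 3 = x ^ 3 + (3 : ℂ) • (x ^ 2 * y) + (3 : ℂ) • (x * y ^ 2) + y ^ 3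
      - (3 : ℂ) • (x * c) - (3 : ℂ) • (y * c) := by
    rw [hw, ← Nat.cast_ofNat (R := ℂ), Nat.cast_smul_eq_nsmul, Nat.cast_smul_eq_nsmul,
      Nat.cast_smul_eq_nsmul, Nat.cast_smul_eq_nsmul]
    simp only [pow_succ, pow_zero, one_mul, mul_add, add_mul, mul_sub, sub_mul, mul_assoc, h, h',
      hcx, hcy]
    noncomm_ring
  have w4 : w ^ 4 = x ^ 4 + (4 : ℂ) • (x ^ 3 * y) + (6 : ℂ) • (x ^ 2 * y ^ 2)
      + (4 : ℂ) • (x * y ^ 3) + y ^ 4 - (6 : ℂ) • (x ^ 2 * c) - (12 : ℂ) • (x * (y * c))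
      - (6 : ℂ) • (y ^ 2 * c) + (3 : ℂ) • c ^ 2 := by
    simp only [← Nat.cast_ofNat (R := ℂ), Nat.cast_smul_eq_nsmul, hw]
    simp only [pow_succ, pow_zero, one_mul, mul_add, add_mul, mul_sub, sub_mul, mul_assoc, h, h',
      hcx, hcy, hcy']
    noncomm_ring
  have hcw : Commute w c := Commute.add_left (a := x) (b := y) hcx.symm hcy.symm
  have v1 : x * c ^ 2 = 0 := by simpa using h0 1 0 2 (by norm_num)
  have v2 : y * c ^ 2 = 0 := by simpa using h0 0 1 2 (by norm_num)
  have v3 : c ^ 3 = 0 := by simpa using h0 0 0 3 (by norm_num)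
  have v4 : c ^ 4 = 0 := by simpa using h0 0 0 4 (by norm_num)
  have v5 : w * c ^ 2 = 0 := by rw [hw, add_mul, v1, v2, add_zero]
  have v6 : w ^ 2 * c ^ 2 = 0 := by rw [pow_two w, mul_assoc, v5, mul_zero]
  have v7 : w * c ^ 3 = 0 := by rw [v3, mul_zero]
  have v8 : w ^ 3 * c = 0 := by
    have a1 : x ^ 3 * c = 0 := by simpa using h0 3 0 1 (by norm_num)
    have a2 : x ^ 2 * (y * c) = 0 := by simpa [mul_assoc] using h0 2 1 1 (by norm_num)
    have a3 : x * (y ^ 2 * c) = 0 := by simpa [mul_assoc] using h0 1 2 1 (by norm_num)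
    have a4 : y ^ 3 * c = 0 := by simpa using h0 0 3 1 (by norm_num)
    rw [w3]
    simp only [add_mul, sub_mul, smul_mul_assoc, mul_assoc, a1, a2, a3, a4, ← pow_two, v1, v2]
    simp
  have z2 : (w + (2⁻¹ : ℂ) • c) ^ 2 = w ^ 2 + w * c + (4⁻¹ : ℂ) • c ^ 2 := by
    simp only [pow_two, add_mul, mul_add, smul_mul_assoc, mul_smul_comm, ← hcw.eq]
    module
  have z3 : (w + (2⁻¹ : ℂ) • c) ^ 3 = w ^ 3 + (3 / 2 : ℂ) • (w ^ 2 * c) := by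
    rw [pow_succ, z2]
    have e : w * c * w = w ^ 2 * c := by rw [mul_assoc, ← hcw.eq, pow_two, mul_assoc]
    have e' : c ^ 2 * w = 0 := by rw [← (hcw.pow_right 2).eq, v5]
    have e2 : w * c * c = 0 := by rw [mul_assoc, ← pow_two, v5]
    have e3 : c ^ 2 * c = 0 := by rw [← pow_succ, v3]
    simp only [add_mul, mul_add, smul_mul_assoc, mul_smul_comm, e, e', e2, e3,
      ← pow_succ]
    module
  have z4 : (w + (2⁻¹ : ℂ) • c) ^ 4 = w ^ 4 := by
    rw [pow_succ, z3]
    have e : w ^ 2 * c * w = 0 := by rw [mul_assoc, ← hcw.eq, ← mul_assoc, ← pow_succ, v8]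
    have e2 : w ^ 2 * c * c = 0 := by rw [mul_assoc, ← pow_two, v6]
    simp only [add_mul, mul_add, smul_mul_assoc, mul_smul_comm, e, e2, v8, ← pow_succ]
    module
  have m (i j : ℕ) (hij : 5 ≤ i + j) : x ^ i * y ^ j = 0 := by
    simpa using h0 i j 0 (by omega)
  have m41 : x ^ 4 * y = 0 := by simpa using m 4 1 (by norm_num)
  have m14 : x * y ^ 4 = 0 := by simpa using m 1 4 (by norm_num)
  simp only [exp₄, Finset.sum_range_succ, Finset.sum_range_zero, zero_add, pow_zero, pow_one, z2,
    z3, z4, mul_add, add_mul, smul_mul_assoc, mul_smul_comm, one_mul, mul_one, m41, m14,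
    m 4 2 (by norm_num), m 4 3 (by norm_num), m 4 4 (by norm_num), m 3 2 (by norm_num),
    m 3 3 (by norm_num), m 3 4 (by norm_num), m 2 3 (by norm_num), m 2 4 (by norm_num)]
  rw [w2, w3, w4, hw]
  simp only [add_mul, sub_mul, smul_mul_assoc, mul_assoc, ← pow_two, Nat.factorial]
  push_cast
  module

end TruncatedExponential

lemma ad_mul_comm_of_lie_eq_zero {g : Type*} [LieRing g] [LieAlgebra ℂ g] {x y : g}
    (h : ⁅x, y⁆ = 0) : ad ℂ g x * ad ℂ g y = ad ℂ g y * ad ℂ g x := by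
  ext z
  have := leibniz_lie x y z
  rw [h, zero_lie, zero_add] at this
  simpa using this

/-! ### The grading of `g` and its filtration -/

section Grading

variable {g : Type*} [LieRing g] [LieAlgebra ℂ g] [Module.Finite ℂ g] [LieAlgebra.IsSimple ℂ g]
  {H : LieSubalgebra ℂ g} [H.IsCartanSubalgebra]

lemma gr_le_iSup_rootSpace (b : (rootSystem H).Base) (q : b.support) (j : ℤ) :
    gr b q j ≤ ⨆ (α : Weight ℂ H g) (_ : α (gradingElement b q) = j),
      (rootSpace H α).toSubmodule := by
  intro x hx
  set Q := ⨆ (α : Weight ℂ H g) (_ : α (gradingElement b q) = j), (rootSpace H α).toSubmodule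
  have hQ : Q ≤ gr b q j := iSup₂_le fun α hα ↦ rootSpace_le_gr b q hα
  have htop : Q ⊔ ⨆ k, ⨆ (_ : k ≠ j), gr b q k = ⊤ := by
    rw [eq_top_iff]
    have h2 := congrArg LieSubmodule.toSubmodule (iSup_genWeightSpace_eq_top' ℂ H g)
    rw [LieSubmodule.iSup_toSubmodule, LieSubmodule.top_toSubmodule] at h2
    rw [← h2, iSup_le_iff]
    intro α
    obtain ⟨m, hm⟩ := exists_int_weight b q α
    by_cases hmj : m = j
    · exact le_sup_of_le_left (le_iSup₂_of_le α (hmj ▸ hm) le_rfl)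
    · exact le_sup_of_le_right ((rootSpace_le_gr b q hm).trans (le_biSup (gr b q) hmj))
  obtain ⟨y, hy, z, hz, rfl⟩ := Submodule.mem_sup.mp (htop ▸ Submodule.mem_top : x ∈ _)
  have hz' : z ∈ gr b q j := by simpa using sub_mem hx (hQ hy)
  rw [Submodule.disjoint_def.mp (iSupIndep_gr b q j) z hz' hz, add_zero]
  exact hy

lemma gr_eq_bot_of_two_lt {b : (rootSystem H).Base} {q : b.support}
    (h : ∀ x ∈ nilrad b q, ∀ y ∈ nilrad b q, ∀ z ∈ nilrad b q, ⁅x, ⁅y, z⁆⁆ = 0)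
    {j : ℤ} (hj : 2 < j) : gr b q j = ⊥ := by
  rw [eq_bot_iff]
  intro x hx
  refine eq_zero_of_killingForm_gr hx fun y hy ↦ ?_
  rw [gr_eq_bot h (by omega)] at hy
  rw [(Submodule.mem_bot ℂ).mp hy, map_zero]

/-- The increasing filtration of `g` by the sums of the `g(j)` with `j ≤ k`. -/
def grLE (b : (rootSystem H).Base) (q : b.support) (k : ℤ) : Submodule ℂ g :=
  ⨆ (j : ℤ) (_ : j ≤ k), gr b q j

lemma gr_le_grLE (b : (rootSystem H).Base) (q : b.support) {j k : ℤ} (h : j ≤ k) :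
    gr b q j ≤ grLE b q k := le_iSup₂_of_le j h le_rfl

lemma grLE_mono (b : (rootSystem H).Base) (q : b.support) {j k : ℤ} (h : j ≤ k) :
    grLE b q j ≤ grLE b q k := iSup₂_le fun _ hi ↦ gr_le_grLE b q (hi.trans h)

lemma lie_mem_grLE {b : (rootSystem H).Base} {q : b.support} {j k : ℤ} {x y : g}
    (hx : x ∈ grLE b q j) (hy : y ∈ grLE b q k) : ⁅x, y⁆ ∈ grLE b q (j + k) := by
  have h1 (i : ℤ) (hi : i ≤ j) : gr b q i ≤ (grLE b q (j + k)).comap (ad ℂ g y) := by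
    intro x hx
    rw [Submodule.mem_comap, ad_apply, ← lie_skew, neg_mem_iff]
    have h2 : grLE b q k ≤ (grLE b q (j + k)).comap (ad ℂ g x) :=
      iSup₂_le fun l hl y hy ↦ gr_le_grLE b q (by omega) (lie_mem_gr hx hy)
    exact h2 hy
  rw [← lie_skew, neg_mem_iff]
  exact iSup₂_le h1 hx

lemma oppNilrad_eq_grLE (b : (rootSystem H).Base) (q : b.support) :
    oppNilrad b q = grLE b q (-1) :=
  le_antisymm (iSup_le fun j ↦ gr_le_grLE b q (by omega))
    (iSup₂_le fun _ hj ↦ gr_le_oppNilrad b q (by omega))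

lemma grLE_two {b : (rootSystem H).Base} {q : b.support}
    (h : ∀ x ∈ nilrad b q, ∀ y ∈ nilrad b q, ∀ z ∈ nilrad b q, ⁅x, ⁅y, z⁆⁆ = 0) :
    grLE b q 2 = ⊤ := by
  rw [eq_top_iff, ← iSup_gr b q]
  refine iSup_le fun j ↦ ?_
  rcases le_or_gt j 2 with hj | hj
  · exact gr_le_grLE b q hj
  · rw [gr_eq_bot_of_two_lt h hj]; exact bot_le

lemma grLE_eq_bot {b : (rootSystem H).Base} {q : b.support}
    (h : ∀ x ∈ nilrad b q, ∀ y ∈ nilrad b q, ∀ z ∈ nilrad b q, ⁅x, ⁅y, z⁆⁆ = 0)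
    {k : ℤ} (hk : k < -2) : grLE b q k = ⊥ := by
  rw [eq_bot_iff]
  exact iSup₂_le fun j hj ↦ (gr_eq_bot h (by omega)).le

lemma ad_pow_mem_grLE {b : (rootSystem H).Base} {q : b.support} {j k : ℤ} {x y : g}
    (hx : x ∈ grLE b q j) (hy : y ∈ grLE b q k) (i : ℕ) :
    (ad ℂ g x ^ i) y ∈ grLE b q (i * j + k) := by
  induction i with
  | zero => simpa using hy
  | succ i ih =>
    rw [pow_succ', Module.End.mul_apply]
    exact grLE_mono b q (by push_cast; linarith) (lie_mem_grLE hx ih)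

lemma lie_mem_parabolic {b : (rootSystem H).Base} {q : b.support} {x y : g}
    (hx : x ∈ parabolic b q) (hy : y ∈ parabolic b q) : ⁅x, y⁆ ∈ parabolic b q := by
  have h1 (i : ℕ) : gr b q i ≤ (parabolic b q).comap (ad ℂ g y) := by
    intro x hx
    rw [Submodule.mem_comap, ad_apply, ← lie_skew, neg_mem_iff]
    have h2 : parabolic b q ≤ (parabolic b q).comap (ad ℂ g x) :=
      iSup_le fun l y hy ↦ gr_le_parabolic b q (by omega) (lie_mem_gr hx hy)
    exact h2 hy
  rw [← lie_skew, neg_mem_iff]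
  exact iSup_le h1 hx

end Grading

end ConfInv

namespace ConfInv
namespace QuasiHeisenbergDatum

variable {g : Type*} [LieRing g] [LieAlgebra ℂ g] [Module.Finite ℂ g] [LieAlgebra.IsSimple ℂ g]
  {H : LieSubalgebra ℂ g} [H.IsCartanSubalgebra] (P : QuasiHeisenbergDatum H)

/-! ### The adjoint action of the unipotent group -/

lemma ad_pow_eq_zero {x : g} (hx : x ∈ P.nbar) {k : ℕ} (hk : 5 ≤ k) : ad ℂ g x ^ k = 0 := by
  ext y
  have hy : y ∈ grLE P.base P.node 2 := by rw [grLE_two P.lie_lie_nilrad]; trivial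
  rw [nbar, oppNilrad_eq_grLE] at hx
  have := ad_pow_mem_grLE hx hy k
  rw [grLE_eq_bot P.lie_lie_nilrad (by omega)] at this
  simpa using this

lemma ad_pow_mul_eq_zero {x y : g} (hx : x ∈ P.nbar) (hy : y ∈ P.nbar) {i j k : ℕ}
    (h : 5 ≤ i + j + 2 * k) : ad ℂ g x ^ i * ad ℂ g y ^ j * ad ℂ g ⁅x, y⁆ ^ k = 0 := by
  ext z
  have hz : z ∈ grLE P.base P.node 2 := by rw [grLE_two P.lie_lie_nilrad]; trivial
  rw [nbar, oppNilrad_eq_grLE] at hx hy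
  have := ad_pow_mem_grLE hx (ad_pow_mem_grLE hy (ad_pow_mem_grLE (lie_mem_grLE hx hy) hz k) j) i
  rw [grLE_eq_bot P.lie_lie_nilrad (by omega)] at this
  simpa [mul_assoc] using this

lemma expAd_eq_exp₄ {x : g} (hx : x ∈ P.nbar) : expAd x = exp₄ (ad ℂ g x) := by
  have hn : ∀ k, finrank ℂ g ≤ k → ad ℂ g x ^ k = 0 := by
    intro k hk
    have h := Module.End.ker_pow_eq_ker_pow_finrank_of_le (f := ad ℂ g x) hk
    have h5 := Module.End.ker_pow_eq_ker_pow_finrank_of_le (f := ad ℂ g x) (m := max k 5)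
      (hk.trans (le_max_left _ _))
    rw [P.ad_pow_eq_zero hx (le_max_right _ _), LinearMap.ker_zero] at h5
    rw [← LinearMap.ker_eq_top, h, ← h5]
  have key : ∀ N M : ℕ, N ≤ M → (∀ k, N ≤ k → ad ℂ g x ^ k = 0) →
      ∑ k ∈ Finset.range N, ((k.factorial : ℂ)⁻¹) • ad ℂ g x ^ k =
        ∑ k ∈ Finset.range M, ((k.factorial : ℂ)⁻¹) • ad ℂ g x ^ k := by
    intro N M hNM h
    refine Finset.sum_subset (Finset.range_mono hNM) fun k _ hk ↦ ?_
    rw [h k (by simpa using hk), smul_zero]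
  rw [expAd, exp₄, key _ (max 5 (finrank ℂ g)) (le_max_right _ _) hn,
    key _ (max 5 (finrank ℂ g)) (le_max_left _ _) fun k ↦ P.ad_pow_eq_zero hx]

lemma lie_lie_nbar {x y z : g} (hx : x ∈ P.nbar) (hy : y ∈ P.nbar) (hz : z ∈ P.nbar) :
    ⁅x, ⁅y, z⁆⁆ = 0 := lie_lie_oppNilrad P.lie_lie_nilrad hx hy hz

variable {P}

lemma log_mem (n : P.NBar) : (n.log : g) ∈ P.nbar := n.log.2.1

lemma Ad_one : (Ad (1 : P.NBar) : Module.End ℂ g) = 1 := by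
  rw [Ad, P.expAd_eq_exp₄ (log_mem _), NBar.log_one]
  simp [exp₄, Finset.sum_range_succ]

lemma Ad_mul (x y : P.NBar) : Ad (x * y) = Ad x * Ad y := by
  have hx := log_mem x
  have hy := log_mem y
  rw [Ad, Ad, Ad, P.expAd_eq_exp₄ (log_mem _), P.expAd_eq_exp₄ hx, P.expAd_eq_exp₄ hy,
    ← exp₄_add_add_half (x := ad ℂ g x.log) (y := ad ℂ g y.log)
      (c := ad ℂ g ⁅(x.log : g), (y.log : g)⁆) _ _ _ (fun i j k ↦ P.ad_pow_mul_eq_zero hx hy),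
    NBar.log_mul, ← Complex.coe_smul, map_add, map_add, map_smul]
  · norm_num
  · ext z; simp
  · exact ad_mul_comm_of_lie_eq_zero (by rw [← lie_skew, P.lie_lie_nbar hx hx hy, neg_zero])
  · exact ad_mul_comm_of_lie_eq_zero (by rw [← lie_skew, P.lie_lie_nbar hy hx hy, neg_zero])

lemma Ad_lie (n : P.NBar) (x y : g) : Ad n ⁅x, y⁆ = ⁅Ad n x, Ad n y⁆ := by
  let _ : Module ℚ g := Module.compHom g (algebraMap ℚ ℂ)
  let _ : LieAlgebra ℚ g :=
    { lie_smul := fun t x y ↦ lie_smul (algebraMap ℚ ℂ t) x y }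
  have e := P.ad_pow_eq_zero (log_mem n) le_rfl
  have h : Ad n = IsNilpotent.exp (ad ℂ g (n.log : g)) := by
    rw [Ad, P.expAd_eq_exp₄ (log_mem n), IsNilpotent.exp_eq_sum e, exp₄]
    refine Finset.sum_congr rfl fun k _ ↦ ?_
    ext z
    change _ = algebraMap ℚ ℂ (k.factorial : ℚ)⁻¹ • (ad ℂ g (n.log : g) ^ k) z
    simp
  let D : LieDerivation ℂ g g :=
    { toLinearMap := ad ℂ g (n.log : g)
      leibniz' := fun a b ↦ by simp only [ad_apply]; rw [leibniz_lie, ← lie_skew b]; abel }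
  have hD : IsNilpotent D.toLinearMap := ⟨5, e⟩
  have := (LieDerivation.exp D hD).map_lie x y
  rw [LieDerivation.exp_map_apply, LieDerivation.exp_map_apply, LieDerivation.exp_map_apply] at this
  rw [h]
  exact this

/-- `Ad n` is unipotent with respect to the filtration by degree. -/
lemma Ad_sub_self_mem_grLE (n : P.NBar) {k : ℤ} {x : g} (hx : x ∈ grLE P.base P.node k) :
    Ad n x - x ∈ grLE P.base P.node (k - 1) := by
  have hn := log_mem n
  rw [nbar, oppNilrad_eq_grLE] at hn
  have h (i : ℕ) (hi : 1 ≤ i) : (ad ℂ g n.log ^ i) x ∈ grLE P.base P.node (k - 1) :=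
    grLE_mono _ _ (by omega) (ad_pow_mem_grLE hn hx i)
  have e : Ad n x - x = ∑ i ∈ Finset.range 4,
      (((i + 1).factorial : ℂ)⁻¹) • (ad ℂ g n.log ^ (i + 1)) x := by
    rw [Ad, P.expAd_eq_exp₄ (log_mem n), exp₄, Finset.sum_range_succ']
    simp
  rw [e]
  exact Submodule.sum_mem _ fun i _ ↦ Submodule.smul_mem _ _ (h _ (by omega))

lemma Ad_mem_grLE (n : P.NBar) {k : ℤ} {x : g} (hx : x ∈ grLE P.base P.node k) :
    Ad n x ∈ grLE P.base P.node k := by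
  have := add_mem (grLE_mono _ _ (by omega) (Ad_sub_self_mem_grLE n hx)) hx
  simpa using this

lemma Ad_exp_inv (t : ℝ) (X : P.nbar₀) :
    (Ad (NBar.exp (t • X))⁻¹ : Module.End ℂ g) = exp₄ ((-t : ℂ) • ad ℂ g (X : g)) := by
  rw [Ad, P.expAd_eq_exp₄ (log_mem _), NBar.log_inv]
  congr 1
  simp [← Complex.coe_smul]

variable (P)

/-! ### The decomposition `g = n̄ ⊕ q` and the character of `q` -/

lemma toNbar_add_toQ (x : g) : (P.toNbar x : g) + P.toQ x = x := by
  rw [toNbar, toQ]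
  exact Submodule.projection_add_projection_eq_self (isCompl_oppNilrad_parabolic P.base P.node) x

lemma toNbar_of_mem {x : g} (hx : x ∈ P.nbar) : P.toNbar x = ⟨x, hx⟩ :=
  Submodule.projectionOnto_apply_of_mem_left _ hx

lemma toNbar_of_mem_parabolic {x : g} (hx : x ∈ parabolic P.base P.node) : P.toNbar x = 0 :=
  (Submodule.projectionOnto_apply_eq_zero_iff _).mpr hx

lemma toQ_of_mem {x : g} (hx : x ∈ P.nbar) : P.toQ x = 0 :=
  (Submodule.projectionOnto_apply_eq_zero_iff _).mpr hx

lemma toQ_of_mem_parabolic {x : g} (hx : x ∈ parabolic P.base P.node) : P.toQ x = ⟨x, hx⟩ :=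
  Submodule.projectionOnto_apply_of_mem_left _ hx

lemma toQ_Ad_of_mem_levi (n : P.NBar) {A : g} (hA : A ∈ gr P.base P.node 0) :
    (P.toQ (Ad n A) : g) = A := by
  have h := Ad_sub_self_mem_grLE n (gr_le_grLE _ _ le_rfl hA)
  rw [zero_sub, ← oppNilrad_eq_grLE] at h
  have h2 : Ad n A = (Ad n A - A) + A := by abel
  rw [h2, map_add, P.toQ_of_mem h, P.toQ_of_mem_parabolic (gr_le_parabolic _ _ le_rfl hA), zero_add]

lemma Ad_mem_nbar (n : P.NBar) {x : g} (hx : x ∈ P.nbar) : Ad n x ∈ P.nbar := by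
  rw [nbar, oppNilrad_eq_grLE] at hx ⊢
  exact Ad_mem_grLE n hx

open Classical in
/-- The element of the Cartan subalgebra that represents `λ_q` with respect to the Killing form is
proportional to `H_q`. -/
lemma exists_apply_cartanEquivDual_symm_fundamentalWeight : ∃ c : ℂ, ∀ φ : Dual ℂ H,
    φ ((cartanEquivDual (K := ℂ) H).symm P.fundamentalWeight) =
      c * φ (gradingElement P.base P.node) := by
  set t := (cartanEquivDual (K := ℂ) H).symm P.fundamentalWeight
  have h0 (i : P.base.support) (hi : i ≠ P.node) : (rootSystem H).root i t = 0 := by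
    have h1 : P.fundamentalWeight ((rootSystem H).coroot i) = 0 := by
      have := P.base.toCoweightBasis_repr_coroot i
      rw [fundamentalWeight, Basis.coord_apply, this, Finsupp.single_apply, if_neg hi]
    have h2 := traceForm_coroot (i : H.root).1 t
    have h3 : cartanEquivDual (K := ℂ) H t = P.fundamentalWeight :=
      LinearEquiv.apply_symm_apply _ _
    have h4 : traceForm ℂ H g (coroot (i : H.root).1) t = 0 := by
      rw [LieModule.traceForm_comm, ← h1, ← h3]
      rfl
    have hα : (i : H.root).1.IsNonZero := LieSubalgebra.isNonZero_coe_root _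
    rw [h4] at h2
    have h5 := root_apply_cartanEquivDual_symm_ne_zero hα
    rw [rootSystem_root_apply, Weight.toLinear_apply]
    have h6 := h2.symm
    rw [nsmul_eq_mul, smul_eq_mul, mul_eq_zero] at h6
    simpa [h5] using h6
  refine ⟨(rootSystem H).root P.node t, fun φ ↦ ?_⟩
  have : Dual.eval ℂ H t =
      (rootSystem H).root P.node t • P.base.toWeightBasis.coord P.node := by
    refine P.base.toWeightBasis.ext fun i ↦ ?_
    rw [LinearMap.smul_apply, Basis.coord_apply, Basis.repr_self, Finsupp.single_apply]
    by_cases hi : i = P.node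
    · subst hi; simp
    · rw [if_neg hi, smul_zero, Dual.eval_apply, RootPairing.Base.toWeightBasis_apply, h0 i hi]
  rw [apply_gradingElement, ← smul_eq_mul, ← LinearMap.smul_apply, ← this, Dual.eval_apply]

/-- `λ_q` is a character of `q`. -/
lemma lambdaQ_lie {x y : g} (hx : x ∈ parabolic P.base P.node) (hy : y ∈ parabolic P.base P.node) :
    P.lambdaQ ⁅x, y⁆ = 0 := by
  obtain ⟨c, hc⟩ := P.exists_apply_cartanEquivDual_symm_fundamentalWeight
  set t := (cartanEquivDual (K := ℂ) H).symm P.fundamentalWeight with ht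
  have htx {j : ℤ} {x : g} (hx : x ∈ gr P.base P.node j) : ⁅(t : g), x⁆ = (c * j) • x := by
    have : gr P.base P.node j ≤ (ad ℂ g (t : g)).eigenspace (c * j) := by
      refine (gr_le_iSup_rootSpace _ _ _).trans (iSup₂_le fun α hα y hy ↦ ?_)
      have h1 := lie_eq_smul_of_mem_rootSpace (K := ℂ) (L := g) (H := H) hy t
      rw [Module.End.mem_eigenspace_iff, ad_apply, ← hα]
      have h2 := hc α.toLinear
      rw [Weight.toLinear_apply, Weight.toLinear_apply] at h2
      rw [← h2]
      exact h1
    simpa using Module.End.mem_eigenspace_iff.mp (this hx)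
  have h1 (j : ℕ) : gr P.base P.node j ≤ (LinearMap.ker P.lambdaQ).comap (ad ℂ g y) := by
    intro x hx
    rw [Submodule.mem_comap, ad_apply, ← lie_skew, neg_mem_iff]
    have h2 : parabolic P.base P.node ≤ (LinearMap.ker P.lambdaQ).comap (ad ℂ g x) := by
      refine iSup_le fun k y hy ↦ ?_
      rw [Submodule.mem_comap, ad_apply, LinearMap.mem_ker]
      have e : P.lambdaQ ⁅x, y⁆ = killingForm ℂ g ⁅(t : g), x⁆ y :=
        (LieModule.traceForm_apply_lie_apply ℂ g g (t : g) x y).symm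
      rw [e, htx hx, map_smul, LinearMap.smul_apply]
      by_cases hjk : j = 0
      · simp [hjk]
      · rw [killingForm_gr (by omega) hx hy, smul_zero]
    exact h2 hy
  have := iSup_le h1 hx
  rw [Submodule.mem_comap, ad_apply, ← lie_skew, neg_mem_iff] at this
  exact this

end QuasiHeisenbergDatum

end ConfInv

namespace ConfInv
namespace QuasiHeisenbergDatum

variable {g : Type*} [LieRing g] [LieAlgebra ℂ g] [Module.Finite ℂ g] [LieAlgebra.IsSimple ℂ g]
  {H : LieSubalgebra ℂ g} [H.IsCartanSubalgebra] {P : QuasiHeisenbergDatum H}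

/-! ### Right differentiation -/

lemma rightDeriv_mul (X : P.nbar₀) (f h : P.SmoothFn) :
    rightDeriv X (f * h) = rightDeriv X f * h + f * rightDeriv X h := by
  ext n
  have hf := hasDerivAt_mul_exp f n X
  have hh := hasDerivAt_mul_exp h n X
  refine (hf.mul hh).deriv.trans ?_
  rw [zero_smul, show NBar.exp (0 : P.nbar₀) = 1 from rfl, mul_one, ← rightDeriv_apply,
    ← rightDeriv_apply]
  rfl

/-- The linear part of the affine vector field `leftInvField X`. -/
def leftInvLinear (X : P.nbar₀) :
    (Fin (finrank ℝ P.nbar₀) → ℝ) →ₗ[ℝ] (Fin (finrank ℝ P.nbar₀) → ℝ) where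
  toFun v := P.coords ((2⁻¹ : ℝ) • P.nbarBracket (P.coords.symm v) X)
  map_add' v w := by
    rw [← map_add, ← smul_add]
    congr 2
    ext
    simp [nbarBracket]
  map_smul' r v := by
    rw [RingHom.id_apply, ← map_smul, smul_comm]
    congr 2
    ext
    simp [nbarBracket, ← Complex.coe_smul]

lemma leftInvField_eq (X : P.nbar₀) :
    leftInvField X = fun v ↦ P.coords X + (leftInvLinear X).toContinuousLinearMap v := by
  ext v
  simp [leftInvField, leftInvLinear]

lemma hasFDerivAt_leftInvField (X : P.nbar₀) (v : Fin (finrank ℝ P.nbar₀) → ℝ) :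
    HasFDerivAt (leftInvField X) (leftInvLinear X).toContinuousLinearMap v := by
  rw [leftInvField_eq]
  exact (ContinuousLinearMap.hasFDerivAt _).const_add _

/-- The bracket of two left-invariant vector fields is the left-invariant vector field of the
bracket, as `n̄₀` is two-step nilpotent. -/
lemma leftInvLinear_sub (X Y : P.nbar₀) (v : Fin (finrank ℝ P.nbar₀) → ℝ) :
    leftInvLinear Y (leftInvField X v) - leftInvLinear X (leftInvField Y v) =
      leftInvField (P.nbarBracket X Y) v := by
  simp only [leftInvLinear, leftInvField, LinearMap.coe_mk, AddHom.coe_mk,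
    LinearEquiv.symm_apply_apply]
  rw [← map_sub]
  congr 1
  ext
  set u := P.coords.symm v
  have h1 : ⁅(u : g), ⁅(X : g), (Y : g)⁆⁆ = 0 := P.lie_lie_nbar u.2.1 X.2.1 Y.2.1
  have h2 : ⁅⁅(u : g), (X : g)⁆, (Y : g)⁆ = 0 := by
    rw [← lie_skew, P.lie_lie_nbar Y.2.1 u.2.1 X.2.1, neg_zero]
  have h3 : ⁅⁅(u : g), (Y : g)⁆, (X : g)⁆ = 0 := by
    rw [← lie_skew, P.lie_lie_nbar X.2.1 u.2.1 Y.2.1, neg_zero]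
  have h4 : ⁅(Y : g), (X : g)⁆ = -⁅(X : g), (Y : g)⁆ := (lie_skew _ _).symm
  simp only [nbarBracket, ← Complex.coe_smul, Submodule.coe_sub, Submodule.coe_add,
    Submodule.coe_smul, add_lie, smul_lie, h1, h2, h3, h4]
  push_cast
  module

lemma inChart_rightDeriv (X : P.nbar₀) (f : P.SmoothFn) :
    inChart (rightDeriv X f : P.NBar → ℂ) =
      fun v ↦ fderiv ℝ (inChart (f : P.NBar → ℂ)) v (leftInvField X v) := by
  ext v
  rw [inChart, rightDeriv_apply]
  simp

lemma rightDeriv_nbarBracket (X Y : P.nbar₀) :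
    rightDeriv (P.nbarBracket X Y) = rightDeriv X * rightDeriv Y - rightDeriv Y * rightDeriv X := by
  ext f n
  set F := inChart (f : P.NBar → ℂ) with hF
  set v := P.coords n.log with hv
  have hF2 : ContDiff ℝ ∞ F := contDiff_inChart f
  have hd : DifferentiableAt ℝ (fderiv ℝ F) v :=
    (hF2.fderiv_right (m := ∞) (by simp)).differentiable (by simp) v
  have hsymm : IsSymmSndFDerivAt ℝ F v :=
    hF2.contDiffAt.isSymmSndFDerivAt (by
      rw [minSmoothness_of_isRCLikeNormedField]
      exact WithTop.coe_le_coe.mpr le_top)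
  have key (X Y : P.nbar₀) : (rightDeriv X (rightDeriv Y f) : P.NBar → ℂ) n =
      fderiv ℝ (fderiv ℝ F) v (leftInvField X v) (leftInvField Y v) +
        fderiv ℝ F v (leftInvLinear Y (leftInvField X v)) := by
    rw [rightDeriv_apply, inChart_rightDeriv, ← hF, ← hv,
      (hd.hasFDerivAt.clm_apply (hasFDerivAt_leftInvField Y v)).fderiv]
    simp [add_comm]
  change (rightDeriv _ f : P.NBar → ℂ) n =
    (rightDeriv X (rightDeriv Y f) : P.NBar → ℂ) n - (rightDeriv Y (rightDeriv X f) : P.NBar → ℂ) n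
  rw [key, key, rightDeriv_apply, ← leftInvLinear_sub, map_sub,
    hsymm.eq (leftInvField X v) (leftInvField Y v)]
  ring

lemma rightDeriv_adCoeff (X : P.nbar₀) (φ : Dual ℂ g) (Y : g) :
    rightDeriv X (P.adCoeff φ Y) = -P.adCoeff (φ ∘ₗ ad ℂ g (X : g)) Y := by
  ext n
  set y := Ad n⁻¹ Y
  have h1 : (fun t : ℝ ↦ (P.adCoeff φ Y : P.NBar → ℂ) (n * NBar.exp (t • X))) =
      fun t : ℝ ↦ ∑ k ∈ Finset.range 5,
        (((k.factorial : ℂ)⁻¹) * φ ((ad ℂ g (X : g) ^ k) y)) * (-t : ℂ) ^ k := by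
    ext t
    change φ (Ad (n * NBar.exp (t • X))⁻¹ Y) = _
    rw [mul_inv_rev, Ad_mul, Ad_exp_inv, exp₄, Module.End.mul_apply, LinearMap.sum_apply, map_sum]
    refine Finset.sum_congr rfl fun k _ ↦ ?_
    rw [smul_pow, LinearMap.smul_apply, LinearMap.smul_apply, map_smul, map_smul]
    simp only [smul_eq_mul]
    ring
  have h2 : HasDerivAt (fun t : ℝ ↦ ∑ k ∈ Finset.range 5,
        (((k.factorial : ℂ)⁻¹) * φ ((ad ℂ g (X : g) ^ k) y)) * (-t : ℂ) ^ k)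
      (-φ ⁅(X : g), y⁆) 0 := by
    have h3 (k : ℕ) (a : ℂ) : HasDerivAt (fun t : ℝ ↦ a * (-t : ℂ) ^ k)
        (a * (k * (-(0 : ℝ) : ℂ) ^ (k - 1) * (-1))) 0 := by
      have h4 : HasDerivAt (fun t : ℝ ↦ (-t : ℂ)) (-1) 0 := (Complex.ofRealCLM.hasDerivAt).neg
      exact (h4.pow k).const_mul a
    have h5 := HasDerivAt.fun_sum fun k (_ : k ∈ Finset.range 5) ↦ h3 k
      (((k.factorial : ℂ)⁻¹) * φ ((ad ℂ g (X : g) ^ k) y))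
    exact h5.congr_deriv (by simp [Finset.sum_range_succ])
  change deriv (fun t : ℝ ↦ (P.adCoeff φ Y : P.NBar → ℂ) (n * NBar.exp (t • X))) 0 = _
  rw [h1, h2.deriv]
  rfl

/-! ### The action `R` of `n̄` -/

lemma R_coe (X : P.nbar₀) : P.R ⟨X, X.2.1⟩ = rightDeriv X := by
  have h1 : P.rePart ⟨X, X.2.1⟩ = X := by
    ext
    simp only [rePart, X.2.2]
    module
  have h2 : P.imPart ⟨X, X.2.1⟩ = 0 := by
    ext
    simp only [imPart, X.2.2, sub_self, smul_zero]
    rfl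
  have h3 : rightDeriv (0 : P.nbar₀) = 0 := by simpa using rightDeriv_smul 0 (0 : P.nbar₀)
  change rightDeriv (P.rePart _) + Complex.I • rightDeriv (P.imPart _) = _
  rw [h1, h2, h3, smul_zero, add_zero]

lemma exists_eq_add_I_smul (Z : P.nbar) : ∃ X Y : P.nbar₀,
    Z = ⟨X, X.2.1⟩ + Complex.I • ⟨Y, Y.2.1⟩ :=
  ⟨P.rePart Z, P.imPart Z, Subtype.ext (P.rePart_add_imPart Z).symm⟩

lemma R_mul (Z : P.nbar) (f h : P.SmoothFn) : P.R Z (f * h) = P.R Z f * h + f * P.R Z h := by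
  obtain ⟨X, Y, rfl⟩ := exists_eq_add_I_smul Z
  simp only [map_add, map_smul, R_coe, LinearMap.add_apply, LinearMap.smul_apply, rightDeriv_mul,
    add_mul, mul_add, smul_add, smul_mul_assoc, mul_smul_comm]
  abel

/-- The bracket of `n̄`. -/
def nbarLie (Z W : P.nbar) : P.nbar := ⟨⁅(Z : g), (W : g)⁆, lie_mem_oppNilrad Z.2 W.2⟩

lemma R_nbarLie (Z W : P.nbar) : P.R (nbarLie Z W) = P.R Z * P.R W - P.R W * P.R Z := by
  obtain ⟨X, Y, rfl⟩ := exists_eq_add_I_smul Z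
  obtain ⟨X', Y', rfl⟩ := exists_eq_add_I_smul W
  have h (A B : P.nbar₀) : P.R (nbarLie ⟨A, A.2.1⟩ ⟨B, B.2.1⟩) =
      rightDeriv A * rightDeriv B - rightDeriv B * rightDeriv A := by
    rw [← rightDeriv_nbarBracket, ← R_coe]
    rfl
  have e (i : ℂ) (x y x' y' : P.nbar) : nbarLie (x + i • y) (x' + i • y') =
      nbarLie x x' + i • nbarLie x y' + i • nbarLie y x' + i • i • nbarLie y y' := by
    ext
    simp only [nbarLie, Submodule.coe_add, Submodule.coe_smul, add_lie, lie_add, smul_lie, lie_smul]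
    module
  have key {A : Type _} [Ring A] [Algebra ℂ A] (i : ℂ) (x y x' y' : A) :
      x * x' - x' * x + i • (x * y' - y' * x) + i • (y * x' - x' * y) +
        i • i • (y * y' - y' * y) = (x + i • y) * (x' + i • y') - (x' + i • y') * (x + i • y) := by
    simp only [add_mul, mul_add, smul_mul_assoc, mul_smul_comm]
    module
  rw [e, map_add, map_add, map_add, map_add, map_add, map_smul, map_smul, map_smul, map_smul,
    map_smul, map_smul, h, h, h, h, R_coe, R_coe, R_coe, R_coe]
  exact key (A := Module.End ℂ P.SmoothFn) _ _ _ _ _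

lemma R_adCoeff (Z : P.nbar) (φ : Dual ℂ g) (Y : g) :
    P.R Z (P.adCoeff φ Y) = -P.adCoeff (φ ∘ₗ ad ℂ g (Z : g)) Y := by
  obtain ⟨X, W, rfl⟩ := exists_eq_add_I_smul Z
  simp only [map_add, map_smul, R_coe, LinearMap.add_apply, LinearMap.smul_apply,
    rightDeriv_adCoeff]
  ext n
  change -φ _ + Complex.I * (-φ _) = -φ _
  simp
  ring

/-- Differentiation of a function `n ↦ (T(Ad(n⁻¹) Y) f)(n)` with `T` linear. -/
lemma R_apply_of_eq (Z : P.nbar) (T : g →ₗ[ℂ] Module.End ℂ P.SmoothFn) (Y : g)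
    (f F : P.SmoothFn) (hF : ∀ n, (F : P.NBar → ℂ) n = (T (Ad n⁻¹ Y) f : P.NBar → ℂ) n)
    (n : P.NBar) : (P.R Z F : P.NBar → ℂ) n =
      (P.R Z (T (Ad n⁻¹ Y) f) : P.NBar → ℂ) n - (T ⁅(Z : g), Ad n⁻¹ Y⁆ f : P.NBar → ℂ) n := by
  let B := Module.finBasis ℂ g
  have hT (y : g) : T y f = ∑ a, B.coord a y • T (B a) f := by
    conv_lhs => rw [← B.sum_repr y, map_sum, LinearMap.sum_apply]
    simp
  have hF' : F = ∑ a, P.adCoeff (B.coord a) Y * T (B a) f := by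
    ext n
    rw [hF, hT]
    simp [adCoeff]
  rw [hF', hT ⁅_, _⁆, hT (Ad n⁻¹ Y)]
  simp only [map_sum, map_smul, R_mul, R_adCoeff]
  simp [adCoeff, Finset.sum_add_distrib]
  ring

end QuasiHeisenbergDatum

end ConfInv

namespace ConfInv
namespace QuasiHeisenbergDatum

variable {g : Type*} [LieRing g] [LieAlgebra ℂ g] [Module.Finite ℂ g] [LieAlgebra.IsSimple ℂ g]
  {H : LieSubalgebra ℂ g} [H.IsCartanSubalgebra] (P : QuasiHeisenbergDatum H)

/-! ### The representation `π_s` -/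

/-- The operator `s λ_q(y_q) - R(y_n̄)`. The value of `π_s(Y) f` at `n` is that of this operator for
`y = Ad(n⁻¹) Y`. -/
def piSymbol (s : ℂ) : g →ₗ[ℂ] Module.End ℂ P.SmoothFn :=
  (s • (P.lambdaQ ∘ₗ (Submodule.subtype _) ∘ₗ P.toQ)).smulRight
    (1 : Module.End ℂ P.SmoothFn) + P.R ∘ₗ (-P.toNbar)

variable {P}

lemma piSymbol_apply (s : ℂ) (y : g) :
    P.piSymbol s y =
      (s * P.lambdaQ (P.toQ y)) • (1 : Module.End ℂ P.SmoothFn) - P.R (P.toNbar y) := by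
  change (s * P.lambdaQ (P.toQ y)) • (1 : Module.End ℂ P.SmoothFn) + P.R (-P.toNbar y) = _
  rw [map_neg]
  exact (sub_eq_add_neg _ _).symm

lemma piS_apply (s : ℂ) (Y : g) (f : P.SmoothFn) (n : P.NBar) :
    (P.piS s Y f : P.NBar → ℂ) n = (P.piSymbol s (Ad n⁻¹ Y) f : P.NBar → ℂ) n := by
  rw [piSymbol_apply]
  rfl

lemma piSymbol_neg_coe (s : ℂ) (Z : P.nbar) : P.piSymbol s (-(Z : g)) = P.R Z := by
  change (s * P.lambdaQ (P.toQ (-(Z : g)))) • (1 : Module.End ℂ P.SmoothFn)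
    + P.R (-P.toNbar (-(Z : g))) = _
  rw [map_neg P.toQ, map_neg P.toNbar, P.toQ_of_mem Z.2, P.toNbar_of_mem Z.2]
  simp

lemma piSymbol_of_mem_parabolic (s : ℂ) {y : g} (hy : y ∈ parabolic P.base P.node) :
    P.piSymbol s y = (s * P.lambdaQ y) • (1 : Module.End ℂ P.SmoothFn) := by
  change (s * P.lambdaQ (P.toQ y)) • (1 : Module.End ℂ P.SmoothFn) + P.R (-P.toNbar y) = _
  rw [P.toQ_of_mem_parabolic hy, P.toNbar_of_mem_parabolic hy]
  simp

lemma piSymbol_lie_of_mem_parabolic (s : ℂ) {x y : g} (hx : x ∈ parabolic P.base P.node)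
    (hy : y ∈ parabolic P.base P.node) : P.piSymbol s ⁅x, y⁆ = 0 := by
  rw [piSymbol_of_mem_parabolic s (lie_mem_parabolic hx hy), P.lambdaQ_lie hx hy, mul_zero,
    zero_smul]

lemma piSymbol_lie_of_mem_nbar (s : ℂ) (Z W : P.nbar) :
    P.piSymbol s ⁅(Z : g), (W : g)⁆ = P.R W * P.R Z - P.R Z * P.R W := by
  rw [← R_nbarLie, ← piSymbol_neg_coe s, nbarLie, lie_skew]

lemma piSymbol_mul_R_sub (s : ℂ) (y : g) (Z : P.nbar) :
    P.piSymbol s y * P.R Z - P.R Z * P.piSymbol s y + P.piSymbol s ⁅(Z : g), y⁆ =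
      P.piSymbol s ⁅(Z : g), (P.toQ y : g)⁆ := by
  have h : ⁅(Z : g), y⁆ = ⁅(Z : g), (P.toNbar y : g)⁆ + ⁅(Z : g), (P.toQ y : g)⁆ := by
    rw [← lie_add, P.toNbar_add_toQ]
  rw [h, map_add, piSymbol_lie_of_mem_nbar, piSymbol_apply]
  have key {A : Type _} [Ring A] [Algebra ℂ A] (c : ℂ) (r z d : A) :
      (c • (1 : A) - r) * z - z * (c • (1 : A) - r) + (r * z - z * r + d) = d := by
    simp only [sub_mul, mul_sub, smul_mul_assoc, mul_smul_comm, one_mul, mul_one]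
    abel
  exact key (A := Module.End ℂ P.SmoothFn) _ _ _ _

lemma piSymbol_lie (s : ℂ) (y y' : g) :
    (P.piSymbol s y * P.piSymbol s y' + P.piSymbol s ⁅(P.toNbar y : g), y'⁆) -
      (P.piSymbol s y' * P.piSymbol s y + P.piSymbol s ⁅(P.toNbar y' : g), y⁆) =
        P.piSymbol s ⁅y, y'⁆ := by
  have h0 : ⁅y, y'⁆ = ⁅(P.toNbar y : g), y'⁆ - ⁅(P.toNbar y' : g), y⁆
      - ⁅(P.toNbar y : g), (P.toNbar y' : g)⁆ + ⁅(P.toQ y : g), (P.toQ y' : g)⁆ := by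
    have e (a b a' b' : g) :
        ⁅a + b, a' + b'⁆ = ⁅a, a' + b'⁆ - ⁅a', a + b⁆ - ⁅a, a'⁆ + ⁅b, b'⁆ := by
      rw [← lie_skew a']
      simp only [add_lie, lie_add]
      abel
    have := e (P.toNbar y) (P.toQ y) (P.toNbar y') (P.toQ y')
    rwa [P.toNbar_add_toQ, P.toNbar_add_toQ] at this
  have h1 : P.piSymbol s ⁅y, y'⁆ + P.piSymbol s ⁅(P.toNbar y' : g), y⁆
      + P.piSymbol s ⁅(P.toNbar y : g), (P.toNbar y' : g)⁆ =
        P.piSymbol s ⁅(P.toNbar y : g), y'⁆ := by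
    rw [← add_zero (P.piSymbol s ⁅(P.toNbar y : g), y'⁆),
      ← piSymbol_lie_of_mem_parabolic s (P.toQ y).2 (P.toQ y').2, ← map_add, ← map_add, ← map_add]
    congr 1
    rw [h0]
    abel
  rw [← h1, piSymbol_lie_of_mem_nbar, piSymbol_apply (y := y), piSymbol_apply (y := y')]
  have key {A : Type _} [Ring A] [Algebra ℂ A] (c c' : ℂ) (r r' d d' : A) :
      (c • (1 : A) - r) * (c' • (1 : A) - r') + (d + d' + (r' * r - r * r')) -
        ((c' • (1 : A) - r') * (c • (1 : A) - r) + d') = d := by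
    simp only [sub_mul, mul_sub, smul_mul_assoc, mul_smul_comm, one_mul, mul_one, smul_sub]
    rw [smul_comm c]
    abel
  exact key (A := Module.End ℂ P.SmoothFn) _ _ _ _ _ _

lemma R_piS_apply (s : ℂ) (Y : g) (Z : P.nbar) (f : P.SmoothFn) (n : P.NBar) :
    (P.R Z (P.piS s Y f) : P.NBar → ℂ) n =
      (P.R Z (P.piSymbol s (Ad n⁻¹ Y) f) : P.NBar → ℂ) n -
        (P.piSymbol s ⁅(Z : g), Ad n⁻¹ Y⁆ f : P.NBar → ℂ) n :=
  R_apply_of_eq Z (P.piSymbol s) Y f _ (piS_apply s Y f) n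

lemma piS_mul_R_sub_apply (s : ℂ) (Y : g) (Z : P.nbar) (f : P.SmoothFn) (n : P.NBar) :
    ((P.piS s Y * P.R Z - P.R Z * P.piS s Y) f : P.NBar → ℂ) n =
      (P.piSymbol s ⁅(Z : g), (P.toQ (Ad n⁻¹ Y) : g)⁆ f : P.NBar → ℂ) n := by
  rw [← piSymbol_mul_R_sub]
  change (P.piS s Y (P.R Z f) : P.NBar → ℂ) n - (P.R Z (P.piS s Y f) : P.NBar → ℂ) n = _
  rw [R_piS_apply, piS_apply]
  change _ = (P.piSymbol s (Ad n⁻¹ Y) (P.R Z f) : P.NBar → ℂ) n -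
    (P.R Z (P.piSymbol s (Ad n⁻¹ Y) f) : P.NBar → ℂ) n + _
  ring

/-- `π_s(X)` commutes with `R(Z)` for `X, Z ∈ n̄`. -/
lemma piS_mul_R_of_mem_nbar (s : ℂ) {X : g} (hX : X ∈ P.nbar) (Z : P.nbar) :
    P.piS s X * P.R Z - P.R Z * P.piS s X = 0 := by
  ext f n
  rw [piS_mul_R_sub_apply, P.toQ_of_mem (P.Ad_mem_nbar _ hX)]
  simp

lemma piS_mul_R_of_mem_levi (s : ℂ) {A : g} (hA : A ∈ gr P.base P.node 0) (Z : P.nbar)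
    (hAZ : ⁅A, (Z : g)⁆ ∈ P.nbar) :
    P.piS s A * P.R Z - P.R Z * P.piS s A = P.R ⟨⁅A, (Z : g)⁆, hAZ⟩ := by
  ext f n
  rw [piS_mul_R_sub_apply, P.toQ_Ad_of_mem_levi _ hA, ← lie_skew]
  exact congrArg (fun D : Module.End ℂ P.SmoothFn ↦ (D f : P.NBar → ℂ) n)
    (piSymbol_neg_coe s ⟨_, hAZ⟩)

/-- `π_s` is a representation of `g`. -/
lemma piS_lie (s : ℂ) (Y Y' : g) :
    P.piS s ⁅Y, Y'⁆ = P.piS s Y * P.piS s Y' - P.piS s Y' * P.piS s Y := by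
  have key (Y Y' : g) (f : P.SmoothFn) (n : P.NBar) :
      (P.piS s Y (P.piS s Y' f) : P.NBar → ℂ) n =
        ((P.piSymbol s (Ad n⁻¹ Y) * P.piSymbol s (Ad n⁻¹ Y') +
          P.piSymbol s ⁅(P.toNbar (Ad n⁻¹ Y) : g), Ad n⁻¹ Y'⁆) f : P.NBar → ℂ) n := by
    rw [piS_apply, piSymbol_apply (y := Ad n⁻¹ Y)]
    change (s * P.lambdaQ (P.toQ (Ad n⁻¹ Y))) * (P.piS s Y' f : P.NBar → ℂ) n
      - (P.R (P.toNbar (Ad n⁻¹ Y)) (P.piS s Y' f) : P.NBar → ℂ) n =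
      (s * P.lambdaQ (P.toQ (Ad n⁻¹ Y))) * (P.piSymbol s (Ad n⁻¹ Y') f : P.NBar → ℂ) n
      - (P.R (P.toNbar (Ad n⁻¹ Y)) (P.piSymbol s (Ad n⁻¹ Y') f) : P.NBar → ℂ) n
      + (P.piSymbol s ⁅(P.toNbar (Ad n⁻¹ Y) : g), Ad n⁻¹ Y'⁆ f : P.NBar → ℂ) n
    rw [R_piS_apply, piS_apply]
    ring
  ext f n
  change _ = (P.piS s Y (P.piS s Y' f) : P.NBar → ℂ) n - (P.piS s Y' (P.piS s Y f) : P.NBar → ℂ) n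
  rw [key, key, piS_apply, Ad_lie, ← piSymbol_lie]
  rfl

lemma piS_add (s : ℂ) (X Y : g) : P.piS s (X + Y) = P.piS s X + P.piS s Y := by
  ext f n
  change _ = (P.piS s X f : P.NBar → ℂ) n + (P.piS s Y f : P.NBar → ℂ) n
  rw [piS_apply, piS_apply, piS_apply, map_add, map_add]
  rfl

lemma piS_smul (s c : ℂ) (X : g) : P.piS s (c • X) = c • P.piS s X := by
  ext f n
  change _ = c * (P.piS s X f : P.NBar → ℂ) n
  rw [piS_apply, piS_apply, map_smul, map_smul]
  rfl

/-- The commutator of `π_s(X)` with the multiplication by `a` is the multiplication by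
`π_0(X) a`. -/
lemma piS_smul_sub (s : ℂ) (X : g) (a : P.SmoothFn) (D : Module.End ℂ P.SmoothFn) :
    P.piS s X * (a • D) - (a • D) * P.piS s X =
      P.piS 0 X a • D + a • (P.piS s X * D - D * P.piS s X) := by
  ext f n
  change (P.piS s X (a * D f) : P.NBar → ℂ) n
      - (a : P.NBar → ℂ) n * (D (P.piS s X f) : P.NBar → ℂ) n =
    (P.piS 0 X a : P.NBar → ℂ) n * (D f : P.NBar → ℂ) n + (a : P.NBar → ℂ) n *
      ((P.piS s X (D f) : P.NBar → ℂ) n - (D (P.piS s X f) : P.NBar → ℂ) n)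
  have h (s : ℂ) (f : P.SmoothFn) : (P.piS s X f : P.NBar → ℂ) n =
      s * P.lambdaQ (P.toQ (Ad n⁻¹ X)) * (f : P.NBar → ℂ) n
        - (P.R (P.toNbar (Ad n⁻¹ X)) f : P.NBar → ℂ) n := rfl
  rw [h, h, h, R_mul]
  change _ * ((a : P.NBar → ℂ) n * (D f : P.NBar → ℂ) n)
    - ((P.R (P.toNbar (Ad n⁻¹ X)) a : P.NBar → ℂ) n * (D f : P.NBar → ℂ) n
      + (a : P.NBar → ℂ) n * (P.R (P.toNbar (Ad n⁻¹ X)) (D f) : P.NBar → ℂ) n) - _ = _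
  ring

lemma evalAt_one_piS_mul (s : ℂ) {A : g} (hA : A ∈ gr P.base P.node 0)
    (D : Module.End ℂ P.SmoothFn) :
    P.evalAt 1 (P.piS s A * D) = (s * P.lambdaQ A) • P.evalAt 1 D := by
  ext f
  change (P.piS s A (D f) : P.NBar → ℂ) 1 = s * P.lambdaQ A * (D f : P.NBar → ℂ) 1
  rw [piS_apply, inv_one, Ad_one, Module.End.one_apply,
    piSymbol_of_mem_parabolic s (gr_le_parabolic _ _ le_rfl hA)]
  rfl

/-! ### Left translation -/

/-- Left translation `(L_n f)(x) = f(n x)`. -/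
def leftTranslate (n : P.NBar) : Module.End ℂ P.SmoothFn where
  toFun f := ⟨fun x ↦ (f : P.NBar → ℂ) (n * x), by
    have : (inChart fun x ↦ (f : P.NBar → ℂ) (n * x)) = fun v ↦ inChart (f : P.NBar → ℂ)
        (P.coords n.log + v - (leftInvLinear n.log).toContinuousLinearMap v) := by
      ext v
      rw [inChart, inChart]
      refine congrArg (f : P.NBar → ℂ) (NBar.ext' ?_)
      rw [map_sub, map_add]
      simp only [leftInvLinear, NBar.log_mul, nbarBracket, LinearMap.coe_toContinuousLinearMap',
        LinearMap.coe_mk, AddHom.coe_mk, LinearEquiv.symm_apply_apply, Submodule.coe_sub,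
        Submodule.coe_add, Submodule.coe_smul, ← Complex.coe_smul]
      rw [← lie_skew (n.log : g)]
      module
    change ContDiff ℝ ∞ _
    rw [this]
    exact (contDiff_inChart f).comp
      ((contDiff_const.add contDiff_id).sub (ContinuousLinearMap.contDiff _))⟩
  map_add' _ _ := rfl
  map_smul' _ _ := rfl

lemma leftTranslate_mul_R (n : P.NBar) (Z : P.nbar) :
    leftTranslate n * P.R Z = P.R Z * leftTranslate n := by
  have h (X : P.nbar₀) : leftTranslate n * rightDeriv X = rightDeriv X * leftTranslate n := by
    ext f x
    change deriv (fun t : ℝ ↦ (f : P.NBar → ℂ) (n * x * NBar.exp (t • X))) 0 =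
      deriv (fun t : ℝ ↦ (f : P.NBar → ℂ) (n * (x * NBar.exp (t • X)))) 0
    simp only [mul_assoc]
  obtain ⟨X, Y, rfl⟩ := exists_eq_add_I_smul Z
  rw [map_add, map_smul, R_coe, R_coe, mul_add, add_mul, mul_smul_comm, smul_mul_assoc, h, h]

lemma leftTranslate_mul_piS (s : ℂ) (n : P.NBar) (Y : g) :
    leftTranslate n * P.piS s Y = P.piS s (Ad n⁻¹ Y) * leftTranslate n := by
  ext f x
  change (P.piS s Y f : P.NBar → ℂ) (n * x) =
    (P.piS s (Ad n⁻¹ Y) (leftTranslate n f) : P.NBar → ℂ) x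
  rw [piS_apply, piS_apply, mul_inv_rev, Ad_mul, Module.End.mul_apply, piSymbol_apply]
  generalize Ad x⁻¹ (Ad n⁻¹ Y) = y
  have := congrArg (fun D : Module.End ℂ P.SmoothFn ↦ (D f : P.NBar → ℂ) x)
    (leftTranslate_mul_R n (P.toNbar y))
  change (P.R (P.toNbar y) f : P.NBar → ℂ) (n * x) =
    (P.R (P.toNbar y) (leftTranslate n f) : P.NBar → ℂ) x at this
  change _ * (f : P.NBar → ℂ) (n * x) - (P.R (P.toNbar y) f : P.NBar → ℂ) (n * x) =
    _ * (f : P.NBar → ℂ) (n * x) - (P.R (P.toNbar y) (leftTranslate n f) : P.NBar → ℂ) x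
  rw [this]

lemma leftTranslate_inv (n : P.NBar) : leftTranslate n * leftTranslate n⁻¹ = 1 := by
  ext f x
  change (f : P.NBar → ℂ) (n⁻¹ * (n * x)) = (f : P.NBar → ℂ) x
  rw [inv_mul_cancel_left]

lemma evalAt_eq (n : P.NBar) (D : Module.End ℂ P.SmoothFn) :
    P.evalAt n D = P.evalAt 1 (leftTranslate n * D) := by
  ext f
  change (D f : P.NBar → ℂ) n = (D f : P.NBar → ℂ) (n * 1)
  rw [mul_one]

end QuasiHeisenbergDatum

end ConfInv

namespace ConfInv

section DualBases

variable {g : Type*} [LieRing g] [LieAlgebra ℂ g] [Module.Finite ℂ g] [LieAlgebra.IsSimple ℂ g]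
  {H : LieSubalgebra ℂ g} [H.IsCartanSubalgebra]

/-! ### Dual bases with respect to the Killing form -/

lemma sum_killingForm_smul_grBasis {b : (rootSystem H).Base} {q : b.support} {j : ℤ} {x : g}
    (hx : x ∈ gr b q j) :
    ∑ a, killingForm ℂ g (grDualBasis b q j a) x • (grBasis b q j a : g) = x := by
  have h (a) : killingForm ℂ g (grDualBasis b q j a) x = (grBasis b q j).coord a ⟨x, hx⟩ := by
    have : grPairing b q j (grDualBasis b q j a) = (grBasis b q j).coord a :=
      LinearEquiv.apply_symm_apply (grPairing b q j).toPerfPair _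
    rw [← this]
    rfl
  simp only [h]
  have := congrArg (gr b q j).subtype ((grBasis b q j).sum_repr ⟨x, hx⟩)
  rw [map_sum] at this
  exact this

lemma sum_killingForm_smul_grDualBasis {b : (rootSystem H).Base} {q : b.support} {j : ℤ} {z : g}
    (hz : z ∈ gr b q (-j)) :
    ∑ a, killingForm ℂ g z (grBasis b q j a) • (grDualBasis b q j a : g) = z := by
  rw [← sub_eq_zero]
  refine eq_zero_of_killingForm_gr (b := b) (q := q) (j := -j)
    (sub_mem (Submodule.sum_mem _ fun a _ ↦ Submodule.smul_mem _ _ (Subtype.property _)) hz)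
    fun y hy ↦ ?_
  rw [neg_neg] at hy
  rw [map_sub, LinearMap.sub_apply, sub_eq_zero]
  conv_rhs => rw [← sum_killingForm_smul_grBasis hy]
  simp [mul_comm]

/-- The element `∑ a, X_a ⊗ X_a^*` of `g(j) ⊗ g(-j)` is invariant under `l`. -/
lemma sum_lie_grDualBasis {b : (rootSystem H).Base} {q : b.support} (j : ℤ) {M : Type*}
    [AddCommGroup M] [Module ℂ M] (F : g →ₗ[ℂ] g →ₗ[ℂ] M) {A : g} (hA : A ∈ gr b q 0) :
    ∑ a, F (grBasis b q j a) ⁅A, (grDualBasis b q j a : g)⁆ =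
      -∑ a, F ⁅A, (grBasis b q j a : g)⁆ (grDualBasis b q j a) := by
  have h1 (a) : ⁅A, (grDualBasis b q j a : g)⁆ =
      ∑ c, killingForm ℂ g ⁅A, (grDualBasis b q j a : g)⁆ (grBasis b q j c) •
        (grDualBasis b q j c : g) :=
    (sum_killingForm_smul_grDualBasis (by simpa using lie_mem_gr hA (grDualBasis b q j a).2)).symm
  have h2 (c) : ⁅A, (grBasis b q j c : g)⁆ =
      ∑ a, killingForm ℂ g (grDualBasis b q j a) ⁅A, (grBasis b q j c : g)⁆ •
        (grBasis b q j a : g) :=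
    (sum_killingForm_smul_grBasis (by simpa using lie_mem_gr hA (grBasis b q j c).2)).symm
  have h3 (a c) : killingForm ℂ g ⁅A, (grDualBasis b q j a : g)⁆ (grBasis b q j c) =
      -killingForm ℂ g (grDualBasis b q j a) ⁅A, (grBasis b q j c : g)⁆ := by
    have : killingForm ℂ g ⁅(grDualBasis b q j a : g), A⁆ (grBasis b q j c) =
        killingForm ℂ g (grDualBasis b q j a) ⁅A, (grBasis b q j c : g)⁆ :=
      LieModule.traceForm_apply_lie_apply ℂ g g _ _ _
    rw [← lie_skew, map_neg, LinearMap.neg_apply, this]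
  have e1 : ∑ a, F (grBasis b q j a) ⁅A, (grDualBasis b q j a : g)⁆ = ∑ a, ∑ c,
      -(killingForm ℂ g (grDualBasis b q j a) ⁅A, (grBasis b q j c : g)⁆ •
        F (grBasis b q j a) (grDualBasis b q j c)) := by
    refine Finset.sum_congr rfl fun a _ ↦ ?_
    rw [h1, map_sum]
    refine Finset.sum_congr rfl fun c _ ↦ ?_
    rw [map_smul, h3, neg_smul]
  have e2 : ∑ c, F ⁅A, (grBasis b q j c : g)⁆ (grDualBasis b q j c) = ∑ c, ∑ a,
      killingForm ℂ g (grDualBasis b q j a) ⁅A, (grBasis b q j c : g)⁆ •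
        F (grBasis b q j a) (grDualBasis b q j c) := by
    refine Finset.sum_congr rfl fun c _ ↦ ?_
    conv_lhs => rw [h2, map_sum, LinearMap.sum_apply]
    simp only [map_smul, LinearMap.smul_apply]
  rw [e1, e2, Finset.sum_comm]
  simp only [Finset.sum_neg_distrib]

/-- The contraction of bilinear forms on `g(j)` with bilinear maps on `g(-j)` is equivariant. -/
lemma sum_smul_lie_grDualBasis {b : (rootSystem H).Base} {q : b.support} (j : ℤ) {M : Type*}
    [AddCommGroup M] [Module ℂ M] (S : g →ₗ[ℂ] g →ₗ[ℂ] M) (B : g →ₗ[ℂ] g →ₗ[ℂ] ℂ)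
    {A : g} (hA : A ∈ gr b q 0) :
    ∑ a, ∑ c, B (grBasis b q j a) (grBasis b q j c) •
        (S ⁅A, (grDualBasis b q j a : g)⁆ (grDualBasis b q j c) +
          S (grDualBasis b q j a) ⁅A, (grDualBasis b q j c : g)⁆) =
      ∑ a, ∑ c, (-(B ⁅A, (grBasis b q j a : g)⁆ (grBasis b q j c) +
        B (grBasis b q j a) ⁅A, (grBasis b q j c : g)⁆)) •
          S (grDualBasis b q j a) (grDualBasis b q j c) := by
  have h1 (c) := sum_lie_grDualBasis j (LinearMap.mk₂ ℂ (fun x z ↦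
    B x (grBasis b q j c) • S z (grDualBasis b q j c)) (by simp [add_smul]) (by simp [mul_smul])
    (by simp) (fun r x z ↦ by simp [smul_comm r])) hA
  have h2 (a) := sum_lie_grDualBasis j (LinearMap.mk₂ ℂ (fun x z ↦
    B (grBasis b q j a) x • S (grDualBasis b q j a) z) (by simp [add_smul]) (by simp [mul_smul])
    (by simp) (fun r x z ↦ by simp [smul_comm r])) hA
  simp only [LinearMap.mk₂_apply] at h1 h2
  simp only [smul_add, neg_smul, add_smul, Finset.sum_add_distrib, neg_add, Finset.sum_neg_distrib]
  rw [Finset.sum_comm, Finset.sum_congr rfl fun c _ ↦ h1 c, Finset.sum_congr rfl fun a _ ↦ h2 a,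
    Finset.sum_neg_distrib, Finset.sum_neg_distrib, Finset.sum_comm]

end DualBases

namespace QuasiHeisenbergDatum

section InvariantPairing

variable {g : Type*} [LieRing g] [LieAlgebra ℂ g]

lemma tensorPairing_lie (A : g) (Y t : g ⊗[ℂ] g) :
    tensorPairing ⁅A, Y⁆ t = -tensorPairing Y ⁅A, t⁆ := by
  have hk (A x y : g) : killingForm ℂ g ⁅A, x⁆ y = -killingForm ℂ g x ⁅A, y⁆ := by
    have : killingForm ℂ g ⁅x, A⁆ y = killingForm ℂ g x ⁅A, y⁆ :=
      LieModule.traceForm_apply_lie_apply ℂ g g _ _ _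
    rw [← lie_skew, map_neg, LinearMap.neg_apply, this]
  induction Y using TensorProduct.induction_on with
  | zero => simp
  | add Y Y' h h' => rw [lie_add, map_add, map_add, LinearMap.add_apply, h, h',
      LinearMap.add_apply, neg_add]
  | tmul a c =>
    induction t using TensorProduct.induction_on with
    | zero => simp
    | add t t' h h' => rw [lie_add, map_add, map_add, h, h', neg_add]
    | tmul x y =>
      simp only [tensorPairing, TensorProduct.LieModule.lie_tmul_right, map_add,
        LinearMap.add_apply]
      simp only [LinearMap.BilinForm.tensorDistrib_tmul, LinearMap.BilinForm.tmul, hk, smul_eq_mul]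
      ring

lemma lie_map_ad (A x y : g) (t : g ⊗[ℂ] g) :
    ⁅A, TensorProduct.map (ad ℂ g x * ad ℂ g y) LinearMap.id t⁆ =
      TensorProduct.map (ad ℂ g ⁅A, x⁆ * ad ℂ g y) LinearMap.id t +
      TensorProduct.map (ad ℂ g x * ad ℂ g ⁅A, y⁆) LinearMap.id t +
      TensorProduct.map (ad ℂ g x * ad ℂ g y) LinearMap.id ⁅A, t⁆ := by
  induction t using TensorProduct.induction_on with
  | zero => simp
  | add t t' h h' => rw [map_add, map_add, map_add, lie_add, lie_add, map_add, h, h']; abel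
  | tmul a c =>
    simp only [TensorProduct.LieModule.lie_tmul_right, map_add, TensorProduct.map_tmul,
      Module.End.mul_apply, ad_apply, LinearMap.id_apply]
    rw [leibniz_lie A x, leibniz_lie A y, lie_add, TensorProduct.add_tmul, TensorProduct.add_tmul]
    abel

end InvariantPairing

variable {g : Type*} [LieRing g] [LieAlgebra ℂ g] [Module.Finite ℂ g] [LieAlgebra.IsSimple ℂ g]
  {H : LieSubalgebra ℂ g} [H.IsCartanSubalgebra] (P : QuasiHeisenbergDatum H)

/-! ### The operators `Ω₂(Y*)` -/

lemma lie_omega {A : g} (hA : A ∈ gr P.base P.node 0) : ⁅A, P.omega⁆ = 0 := by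
  have := sum_lie_grDualBasis 2 (TensorProduct.mk ℂ g g).flip hA
  simp only [LinearMap.flip_apply, TensorProduct.mk_apply] at this
  rw [omega, lie_sum]
  simp only [TensorProduct.LieModule.lie_tmul_right, Finset.sum_add_distrib, this]
  simp

/-- The symmetric bilinear map on `g(1)` with values in `l ⊗ z(n)` whose quadratic map is `τ₂`. -/
def tauPolar (x y : g) : g ⊗[ℂ] g :=
  (4⁻¹ : ℂ) • TensorProduct.map (ad ℂ g x * ad ℂ g y + ad ℂ g y * ad ℂ g x) LinearMap.id P.omega

lemma polar_tauTilde₂ (Y : g ⊗[ℂ] g) (x y : gr P.base P.node 1) :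
    2⁻¹ * QuadraticMap.polar (P.tauTilde₂ Y) x y = tensorPairing Y (P.tauPolar x y) := by
  have h : P.tau₂ (x + y : g) = P.tau₂ x + P.tau₂ y + (2 : ℂ) • P.tauPolar x y := by
    have e : (ad ℂ g (x + y : g)) ^ 2 = (ad ℂ g (x : g)) ^ 2 + (ad ℂ g (y : g)) ^ 2 +
        (ad ℂ g (x : g) * ad ℂ g y + ad ℂ g (y : g) * ad ℂ g x) := by
      rw [map_add]; noncomm_ring
    rw [tau₂, tau₂, tau₂, tauPolar, e, TensorProduct.map_add_left, TensorProduct.map_add_left,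
      LinearMap.add_apply, LinearMap.add_apply]
    module
  rw [QuadraticMap.polar, tauTilde₂, tauTilde₂, tauTilde₂, Submodule.coe_add, h]
  simp only [map_add, map_smul, smul_eq_mul]
  ring

lemma lie_tauPolar {A : g} (hA : A ∈ gr P.base P.node 0) (x y : g) :
    ⁅A, P.tauPolar x y⁆ = P.tauPolar ⁅A, x⁆ y + P.tauPolar x ⁅A, y⁆ := by
  simp only [tauPolar, lie_smul, TensorProduct.map_add_left, LinearMap.add_apply, lie_add,
    lie_map_ad, P.lie_omega hA, map_zero, add_zero]
  module

/-- The polar form of `τ̃₂(Y*)`. -/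
def tauForm (Y : g ⊗[ℂ] g) : g →ₗ[ℂ] g →ₗ[ℂ] ℂ :=
  LinearMap.mk₂ ℂ (fun x y ↦ tensorPairing Y (P.tauPolar x y))
    (fun x x' y ↦ by
      simp only [tauPolar, map_add, add_mul, mul_add, TensorProduct.map_add_left,
        LinearMap.add_apply, map_smul, smul_eq_mul]
      ring)
    (fun c x y ↦ by
      simp only [tauPolar, map_smul, smul_mul_assoc, mul_smul_comm, ← smul_add,
        TensorProduct.map_smul_left, LinearMap.smul_apply, smul_eq_mul]
      ring)
    (fun x x' y ↦ by
      simp only [tauPolar, map_add, add_mul, mul_add, TensorProduct.map_add_left,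
        LinearMap.add_apply, map_smul, smul_eq_mul]
      ring)
    (fun c x y ↦ by
      simp only [tauPolar, map_smul, smul_mul_assoc, mul_smul_comm, ← smul_add,
        TensorProduct.map_smul_left, LinearMap.smul_apply, smul_eq_mul]
      ring)

lemma tauForm_apply (Y : g ⊗[ℂ] g) (x y : g) :
    P.tauForm Y x y = tensorPairing Y (P.tauPolar x y) := rfl

lemma tauForm_lie {A : g} (hA : A ∈ gr P.base P.node 0) (Y : g ⊗[ℂ] g) (x y : g) :
    P.tauForm ⁅A, Y⁆ x y = -(P.tauForm Y ⁅A, x⁆ y + P.tauForm Y x ⁅A, y⁆) := by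
  simp only [tauForm_apply]
  rw [tensorPairing_lie, P.lie_tauPolar hA, map_add]

/-- The symmetrized product `(R(z) R(w) + R(w) R(z)) / 2` of elements of `n̄`. -/
def symProd : g →ₗ[ℂ] g →ₗ[ℂ] Module.End ℂ P.SmoothFn :=
  LinearMap.mk₂ ℂ (fun z w ↦ (2⁻¹ : ℂ) •
    (P.R (P.toNbar z) * P.R (P.toNbar w) + P.R (P.toNbar w) * P.R (P.toNbar z)))
    (fun z z' w ↦ by simp only [map_add, add_mul, mul_add, smul_add]; abel)
    (fun c z w ↦ by
      simp only [map_smul, smul_mul_assoc, mul_smul_comm, ← smul_add]; rw [smul_comm])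
    (fun z z' w ↦ by simp only [map_add, add_mul, mul_add, smul_add]; abel)
    (fun c z w ↦ by
      simp only [map_smul, smul_mul_assoc, mul_smul_comm, ← smul_add]; rw [smul_comm])

lemma symProd_apply (z w : g) : P.symProd z w = (2⁻¹ : ℂ) •
    (P.R (P.toNbar z) * P.R (P.toNbar w) + P.R (P.toNbar w) * P.R (P.toNbar z)) := rfl

lemma Omega₂_eq (Y : g ⊗[ℂ] g) : P.Omega₂ Y = ∑ a, ∑ c,
    P.tauForm Y (grBasis P.base P.node 1 a) (grBasis P.base P.node 1 c) •
      P.symProd (grDualBasis P.base P.node 1 a) (grDualBasis P.base P.node 1 c) := by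
  have h (z : gr P.base P.node (-1)) : P.grToNbar z = P.toNbar z :=
    (P.toNbar_of_mem (gr_le_oppNilrad P.base P.node (by omega) z.2)).symm
  simp only [Omega₂, polar_tauTilde₂, symProd_apply, h]
  rfl

/-- `Ω₂` as a linear map. -/
def Omega₂Hom : g ⊗[ℂ] g →ₗ[ℂ] Module.End ℂ P.SmoothFn where
  toFun := P.Omega₂
  map_add' Y Y' := by
    simp only [Omega₂_eq, tauForm_apply, map_add, LinearMap.add_apply, add_smul,
      Finset.sum_add_distrib]
  map_smul' c Y := by
    simp only [Omega₂_eq, tauForm_apply, map_smul, LinearMap.smul_apply, smul_assoc,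
      Finset.smul_sum, RingHom.id_apply]

variable {P}

lemma piS_mul_symProd (s : ℂ) {A : g} (hA : A ∈ gr P.base P.node 0) {z w : g}
    (hz : z ∈ gr P.base P.node (-1)) (hw : w ∈ gr P.base P.node (-1)) :
    P.piS s A * P.symProd z w =
      P.symProd ⁅A, z⁆ w + P.symProd z ⁅A, w⁆ + P.symProd z w * P.piS s A := by
  have h {z : g} (hz : z ∈ gr P.base P.node (-1)) : P.piS s A * P.R (P.toNbar z) =
      P.R (P.toNbar ⁅A, z⁆) + P.R (P.toNbar z) * P.piS s A := by
    have h1 := gr_le_oppNilrad P.base P.node (by omega) hz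
    have h2 := gr_le_oppNilrad P.base P.node (by omega) (lie_mem_gr hA hz)
    rw [P.toNbar_of_mem h1, P.toNbar_of_mem h2]
    exact (sub_eq_iff_eq_add (G := Module.End ℂ P.SmoothFn)).mp
      (piS_mul_R_of_mem_levi s hA ⟨z, h1⟩ h2)
  simp only [symProd_apply, mul_smul_comm, smul_mul_assoc, ← smul_add]
  congr 1
  rw [mul_add, ← mul_assoc, ← mul_assoc, h hz, h hw, add_mul, add_mul, mul_assoc _ (P.piS s A),
    mul_assoc _ (P.piS s A), h hz, h hw, mul_add, mul_add, add_mul]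
  simp only [mul_assoc]
  abel

/-- `Ω₂` is equivariant for the action of `l`. -/
lemma piS_mul_Omega₂ (s : ℂ) {A : g} (hA : A ∈ gr P.base P.node 0) (Y : g ⊗[ℂ] g) :
    P.piS s A * P.Omega₂ Y = P.Omega₂ ⁅A, Y⁆ + P.Omega₂ Y * P.piS s A := by
  rw [Omega₂_eq, Omega₂_eq, Finset.mul_sum, Finset.sum_mul]
  simp only [Finset.mul_sum, Finset.sum_mul, mul_smul_comm, smul_mul_assoc, P.tauForm_lie hA,
    piS_mul_symProd s hA (Subtype.property _) (Subtype.property _)]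
  have := sum_smul_lie_grDualBasis (M := Module.End ℂ P.SmoothFn) 1 P.symProd (P.tauForm Y) hA
  refine Eq.trans ?_ (congrArg (· + _) this)
  rw [← Finset.sum_add_distrib]
  refine Finset.sum_congr rfl fun a _ ↦ ?_
  rw [← Finset.sum_add_distrib]
  refine Finset.sum_congr rfl fun c _ ↦ ?_
  rw [← smul_add]

lemma leftTranslate_mul_Omega₂ (n : P.NBar) (Y : g ⊗[ℂ] g) :
    leftTranslate n * P.Omega₂ Y = P.Omega₂ Y * leftTranslate n := by
  have h (z w : g) : leftTranslate n * P.symProd z w = P.symProd z w * leftTranslate n := by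
    rw [symProd_apply, mul_smul_comm, smul_mul_assoc, mul_add, add_mul, ← mul_assoc, ← mul_assoc,
      leftTranslate_mul_R, leftTranslate_mul_R, mul_assoc, mul_assoc, leftTranslate_mul_R,
      leftTranslate_mul_R, mul_assoc, mul_assoc]
  simp only [Omega₂_eq, Finset.mul_sum, Finset.sum_mul, mul_smul_comm, smul_mul_assoc, h]

lemma piS_mul_Omega₂_of_mem_nbar (s : ℂ) {X : g} (hX : X ∈ P.nbar) (Y : g ⊗[ℂ] g) :
    P.piS s X * P.Omega₂ Y = P.Omega₂ Y * P.piS s X := by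
  have h0 (Z : P.nbar) : P.piS s X * P.R Z = P.R Z * P.piS s X :=
    sub_eq_zero.mp (piS_mul_R_of_mem_nbar s hX Z)
  have h (z w : g) : P.piS s X * P.symProd z w = P.symProd z w * P.piS s X := by
    rw [symProd_apply, mul_smul_comm, smul_mul_assoc, mul_add, add_mul, ← mul_assoc, ← mul_assoc,
      h0, h0, mul_assoc, mul_assoc, h0, h0, mul_assoc, mul_assoc]
  simp only [Omega₂_eq, Finset.mul_sum, Finset.sum_mul, mul_smul_comm, smul_mul_assoc, h]

lemma Omega₂_mem_diffOps (Y : g ⊗[ℂ] g) : P.Omega₂ Y ∈ P.diffOps := by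
  have hR (Z : P.nbar) : P.R Z ∈ P.diffOps := by
    refine Algebra.subset_adjoin (Or.inr ⟨Derivation.mk' (P.R Z) fun a b ↦ ?_, rfl⟩)
    rw [R_mul, smul_eq_mul, smul_eq_mul, mul_comm b, add_comm]
  rw [Omega₂_eq]
  refine sum_mem fun a _ ↦ sum_mem fun c _ ↦ Subalgebra.smul_mem _ ?_ _
  exact Subalgebra.smul_mem _ (add_mem (mul_mem (hR _) (hR _)) (mul_mem (hR _) (hR _))) _

end QuasiHeisenbergDatum

end ConfInv

namespace ConfInv

variable {g : Type*} [LieRing g] [LieAlgebra ℂ g] [Module.Finite ℂ g] [LieAlgebra.IsSimple ℂ g]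
  {H : LieSubalgebra ℂ g} [H.IsCartanSubalgebra]

/-! ### Irreducibility of the modules `g(1)` and `V*` of the Levi subalgebra -/

lemma exists_root_neg (b : (rootSystem H).Base) (i : H.root) : ∃ j : H.root,
    ((j : Weight ℂ H g) : H → ℂ) = -(i : Weight ℂ H g) ∧ (b.IsPos i ∨ b.IsPos j) := by
  let := (rootSystem H).indexNeg
  refine ⟨-i, ?_, RootPairing.Base.IsPos.or_neg b i⟩
  have e0 : (rootSystem H).root (-i) = -(rootSystem H).root i := by
    rw [RootPairing.indexNeg_neg, RootPairing.root_reflectionPerm,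
      RootPairing.reflection_apply_self]
  ext y
  exact LinearMap.congr_fun e0 y

lemma isPos_of_apply_gradingElement_pos {b : (rootSystem H).Base} {q : b.support}
    (h : ∀ x ∈ nilrad b q, ∀ y ∈ nilrad b q, ∀ z ∈ nilrad b q, ⁅x, ⁅y, z⁆⁆ = 0)
    {i : H.root} {j : ℤ} (hj : 0 < j) (hi : (i : Weight ℂ H g) (gradingElement b q) = j) :
    b.IsPos i := by
  obtain ⟨k, hk, hp | hp⟩ := exists_root_neg b i
  · exact hp
  · obtain ⟨m, hm, h0, -⟩ := posRoot_apply_le_two h k hp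
    rw [hk, Pi.neg_apply, hi] at hm
    have : -j = m := by exact_mod_cast hm
    omega

/-- If `G` is stable under `l` and contains `g_β`, then it contains `g_{α + β}` for every root `α`
of `l`. -/
lemma rootSpace_le_of_eq_add {b : (rootSystem H).Base} {q : b.support} {G : Submodule ℂ g}
    (hG : ∀ A ∈ gr b q 0, ∀ x ∈ G, ⁅A, x⁆ ∈ G) {α β γ : Weight ℂ H g} (hα : α.IsNonZero)
    (hγ : γ.IsNonZero) (h : (γ : H → ℂ) = α + β) (h0 : α (gradingElement b q) = 0)
    (hβ : (rootSpace H β).toSubmodule ≤ G) : (rootSpace H γ).toSubmodule ≤ G := by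
  intro z hz
  by_cases hz0 : z = 0
  · rw [hz0]; exact zero_mem _
  obtain ⟨e, he, x, hx, rfl⟩ := exists_lie_eq_of_mem_rootSpace_add (α := α) (β := β) hα
    (by rwa [← h]) hz0 (by rw [← h]; exact fun h' ↦ hγ h')
  exact hG e (rootSpace_le_gr b q (m := 0) (by simpa using h0) he) x (hβ hx)

open Classical in
/-- An `l`-stable subspace that contains the root space of a root of `g(1)` contains that of
`α_q`: when simple roots are subtracted from the root one by one, the first occurrence of `α_q`
leaves a root of `l`. -/
lemma rootSpace_node_le {b : (rootSystem H).Base} {q : b.support} {G : Submodule ℂ g}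
    (hG : ∀ A ∈ gr b q 0, ∀ x ∈ G, ⁅A, x⁆ ∈ G) {i : H.root} (hi : b.IsPos i)
    (h1 : (i : Weight ℂ H g) (gradingElement b q) = 1)
    (hiG : (rootSpace H (i : Weight ℂ H g)).toSubmodule ≤ G) :
    (rootSpace H ((q : H.root) : Weight ℂ H g)).toSubmodule ≤ G := by
  refine hi.induction_on_add (p := fun i ↦ (i : Weight ℂ H g) (gradingElement b q) = 1 →
    (rootSpace H (i : Weight ℂ H g)).toSubmodule ≤ G →
      (rootSpace H ((q : H.root) : Weight ℂ H g)).toSubmodule ≤ G) ?_ ?_ h1 hiG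
  · intro i hi h1 hiG
    rw [simpleRoot_apply_gradingElement b q hi] at h1
    by_cases hq : i = (q : H.root)
    · rwa [← hq]
    · simp [hq] at h1
  · intro i j k hk ih hj h1 hkG
    have hk' (y : H) : (k : Weight ℂ H g) y = (i : Weight ℂ H g) y + (j : Weight ℂ H g) y :=
      LinearMap.congr_fun hk y
    have hval := simpleRoot_apply_gradingElement b q hj
    rw [hk', hval] at h1
    by_cases hjq : j = (q : H.root)
    · rw [if_pos hjq] at h1
      have hi0 : (i : Weight ℂ H g) (gradingElement b q) = 0 := by simpa using h1
      rw [← hjq]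
      refine rootSpace_le_of_eq_add hG (α := -(i : Weight ℂ H g)) (β := k) ?_
        (LieSubalgebra.isNonZero_coe_root j) ?_ ?_ hkG
      · exact Weight.IsNonZero.neg (LieSubalgebra.isNonZero_coe_root i)
      · ext y; simp [hk']
      · simp [hi0]
    · rw [if_neg hjq, add_zero] at h1
      refine ih h1 (rootSpace_le_of_eq_add hG (α := -(j : Weight ℂ H g)) (β := k) ?_
        (LieSubalgebra.isNonZero_coe_root i) ?_ ?_ hkG)
      · exact Weight.IsNonZero.neg (LieSubalgebra.isNonZero_coe_root j)
      · ext y; simp [hk']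
      · simp [hval, hjq]

open Classical in
/-- The root space of `α_q` generates the `l`-module `g(1)`. -/
lemma rootSpace_le_of_rootSpace_node_le {b : (rootSystem H).Base} {q : b.support}
    {G : Submodule ℂ g} (hG : ∀ A ∈ gr b q 0, ∀ x ∈ G, ⁅A, x⁆ ∈ G) {i : H.root} (hi : b.IsPos i)
    (h1 : (i : Weight ℂ H g) (gradingElement b q) = 1)
    (hq : (rootSpace H ((q : H.root) : Weight ℂ H g)).toSubmodule ≤ G) :
    (rootSpace H (i : Weight ℂ H g)).toSubmodule ≤ G := by
  refine hi.induction_on_add (p := fun i ↦ (i : Weight ℂ H g) (gradingElement b q) = 1 →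
    (rootSpace H (i : Weight ℂ H g)).toSubmodule ≤ G) ?_ ?_ h1
  · intro i hi h1
    rw [simpleRoot_apply_gradingElement b q hi] at h1
    by_cases hiq : i = (q : H.root)
    · rwa [hiq]
    · simp [hiq] at h1
  · intro i j k hk ih hj h1
    have hk' (y : H) : (k : Weight ℂ H g) y = (i : Weight ℂ H g) y + (j : Weight ℂ H g) y :=
      LinearMap.congr_fun hk y
    have hval := simpleRoot_apply_gradingElement b q hj
    rw [hk', hval] at h1
    by_cases hjq : j = (q : H.root)
    · rw [if_pos hjq] at h1
      have hi0 : (i : Weight ℂ H g) (gradingElement b q) = 0 := by simpa using h1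
      exact rootSpace_le_of_eq_add hG (α := i) (β := j) (LieSubalgebra.isNonZero_coe_root i)
        (LieSubalgebra.isNonZero_coe_root k) (by ext y; simp [hk']) hi0 (by rwa [hjq])
    · rw [if_neg hjq, add_zero] at h1
      exact rootSpace_le_of_eq_add hG (α := j) (β := i) (LieSubalgebra.isNonZero_coe_root j)
        (LieSubalgebra.isNonZero_coe_root k) (by ext y; simp [hk', add_comm])
        (by simp [hval, hjq]) (ih h1)

/-- The `l`-module `g(1)` is generated by any nonzero weight vector. -/
lemma gr_one_le_of_mem {b : (rootSystem H).Base} {q : b.support}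
    (h : ∀ x ∈ nilrad b q, ∀ y ∈ nilrad b q, ∀ z ∈ nilrad b q, ⁅x, ⁅y, z⁆⁆ = 0)
    {G : Submodule ℂ g} (hG : ∀ A ∈ gr b q 0, ∀ x ∈ G, ⁅A, x⁆ ∈ G) {x : g} (hxG : x ∈ G)
    (hx : x ∈ gr b q 1) (hx0 : x ≠ 0) {ν : H → ℂ} (hν : ∀ h : H, ⁅(h : g), x⁆ = ν h • x) :
    gr b q 1 ≤ G := by
  have hmem : x ∈ rootSpace H ν :=
    weightSpace_le_genWeightSpace g ν ((mem_weightSpace ν x).mpr hν)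
  have hbot : rootSpace H ν ≠ ⊥ := fun h0 ↦ hx0 (by simpa [h0] using hmem)
  have hν1 : ν (gradingElement b q) = 1 := by
    have h1 := mem_gr.mp hx
    rw [hν, Int.cast_one] at h1
    exact smul_left_injective ℂ hx0 h1
  let W : Weight ℂ H g := ⟨ν, hbot⟩
  have hW : ¬ W.IsZero := fun h0 ↦ by
    have : ν (gradingElement b q) = 0 := congrFun h0 _
    rw [hν1] at this
    exact one_ne_zero this
  have hWG : (rootSpace H W).toSubmodule ≤ G := by
    intro z hz
    obtain ⟨k, hk⟩ := (finrank_eq_one_iff_of_nonzero' (⟨x, hmem⟩ : rootSpace H W)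
      (by simpa using hx0)).mp (finrank_rootSpace_eq_one W hW) ⟨z, hz⟩
    have hk' : k • x = z := congrArg Subtype.val hk
    rw [← hk']
    exact G.smul_mem _ hxG
  have hq := rootSpace_node_le hG (i := ⟨W, by simpa using hW⟩)
    (isPos_of_apply_gradingElement_pos h one_pos (hν1.trans Int.cast_one.symm)) hν1 hWG
  refine (gr_le_iSup_rootSpace b q 1).trans (iSup₂_le fun α hα ↦ ?_)
  have hα1 : α (gradingElement b q) = 1 := by simpa using hα
  have hα0 : ¬ α.IsZero := fun h0 ↦ by
    rw [h0.eq, Pi.zero_apply] at hα1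
    exact zero_ne_one hα1
  exact rootSpace_le_of_rootSpace_node_le hG (i := ⟨α, by simpa using hα0⟩)
    (isPos_of_apply_gradingElement_pos h one_pos hα) hα1 hq

namespace QuasiHeisenbergDatum

variable {P : QuasiHeisenbergDatum H}

/-- `V*` is irreducible as `V` is: a submodule of `V*` is determined by its annihilator in `V`. -/
lemma eq_of_le_of_isKillingDual {V Vd : LieSubmodule ℂ P.levi (g ⊗[ℂ] g)}
    (hV : LieModule.IsIrreducible ℂ P.levi V) (hVd : P.IsKillingDual V Vd)
    {N : LieSubmodule ℂ P.levi (g ⊗[ℂ] g)} (hN : N ≤ Vd) (hN0 : N ≠ ⊥) : N = Vd := by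
  -- the annihilator of `N` in `V`
  let K : LieSubmodule ℂ P.levi V :=
    { carrier := {v | ∀ y ∈ N, tensorPairing y (v : g ⊗[ℂ] g) = 0}
      add_mem' := fun {v w} hv hw y hy ↦ by
        rw [Submodule.coe_add, map_add, hv y hy, hw y hy, add_zero]
      zero_mem' := fun y _ ↦ by simp
      smul_mem' := fun c v hv y hy ↦ by
        rw [Submodule.coe_smul, map_smul, hv y hy, smul_zero]
      lie_mem := fun {A v} hv y hy ↦ by
        have h1 := tensorPairing_lie (A : g) y (v : g ⊗[ℂ] g)
        rw [hv ⁅(A : g), y⁆ (N.lie_mem (x := A) hy)] at h1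
        exact neg_eq_zero.mp h1.symm }
  rcases hV.eq_bot_or_eq_top K with hK | hK
  · have hinj {U W : Submodule ℂ (g ⊗[ℂ] g)} (B : (g ⊗[ℂ] g) →ₗ[ℂ] (g ⊗[ℂ] g) →ₗ[ℂ] ℂ)
        (hU : ∀ u ∈ U, (∀ w ∈ W, B u w = 0) → u = 0) : finrank ℂ U ≤ finrank ℂ W := by
      rw [← Subspace.dual_finrank_eq (V := W)]
      refine LinearMap.finrank_le_finrank_of_injective (f := B.domRestrict₁₂ U W) ?_
      rw [injective_iff_map_eq_zero]
      rintro ⟨u, hu⟩ h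
      ext
      exact hU u hu fun w hw ↦ LinearMap.congr_fun h ⟨w, hw⟩
    have h1 : finrank ℂ Vd ≤ finrank ℂ V :=
      hinj (U := Vd.toSubmodule) (W := V.toSubmodule) tensorPairing hVd.left_nondegenerate
    have h2 : finrank ℂ V ≤ finrank ℂ N := by
      refine hinj (U := V.toSubmodule) (W := N.toSubmodule) tensorPairing.flip fun v hv h ↦ ?_
      have : (⟨v, hv⟩ : V) ∈ K := h
      rw [hK] at this
      exact congrArg Subtype.val ((LieSubmodule.mem_bot _).mp this)
    exact LieSubmodule.toSubmodule_injective
      (Submodule.eq_of_le_of_finrank_le hN (h1.trans h2))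
  · refine absurd ((LieSubmodule.eq_bot_iff _).mpr fun y hy ↦ ?_) hN0
    refine hVd.left_nondegenerate y (hN hy) fun v hv ↦ ?_
    have : (⟨v, hv⟩ : V) ∈ K := by rw [hK]; trivial
    exact this y hy

/-- An irreducible `l`-module is generated by a lowest weight vector under the root spaces of the
positive roots of `l`. -/
lemma le_of_isLowestWeightVector_mem {W : LieSubmodule ℂ P.levi (g ⊗[ℂ] g)}
    (hW : ∀ N : LieSubmodule ℂ P.levi (g ⊗[ℂ] g), N ≤ W → N ≠ ⊥ → N = W)
    {v : g ⊗[ℂ] g} (hvW : v ∈ W) {ν : Dual ℂ H} (hv : P.IsLowestWeightVector v ν)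
    {N : Submodule ℂ (g ⊗[ℂ] g)} (hvN : v ∈ N)
    (hN : ∀ α : H.root, P.base.IsPos α →
      (rootSpace H (α : Weight ℂ H g)).toSubmodule ≤ gr P.base P.node 0 →
        ∀ x ∈ rootSpace H (α : Weight ℂ H g), ∀ y ∈ W, y ∈ N → ⁅x, y⁆ ∈ N) :
    W.toSubmodule ≤ N := by
  -- the smallest subspace that contains `v` and is stable under the positive root spaces
  let S : Set (Submodule ℂ (g ⊗[ℂ] g)) := {N | v ∈ N ∧ ∀ α : H.root, P.base.IsPos α →
      (rootSpace H (α : Weight ℂ H g)).toSubmodule ≤ gr P.base P.node 0 →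
        ∀ x ∈ rootSpace H (α : Weight ℂ H g), ∀ y ∈ N, ⁅x, y⁆ ∈ N}
  have hS : sInf S ∈ S := by
    refine ⟨Submodule.mem_sInf.mpr fun N hN ↦ hN.1, fun α hα hα0 x hx y hy ↦ ?_⟩
    exact Submodule.mem_sInf.mpr fun N hN ↦ hN.2 α hα hα0 x hx y (Submodule.mem_sInf.mp hy N hN)
  have hle : sInf S ≤ W.toSubmodule ⊓ N := by
    refine sInf_le ⟨⟨hvW, hvN⟩, fun α hα hα0 x hx y hy ↦ ⟨?_, hN α hα hα0 x hx y hy.1 hy.2⟩⟩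
    exact W.lie_mem (x := (⟨x, hα0 hx⟩ : P.levi)) hy.1
  have hv_lie {A : g} (hA : A ∈ gr P.base P.node 0) : ⁅A, v⁆ ∈ sInf S := by
    let T : g →ₗ[ℂ] g ⊗[ℂ] g :=
      { toFun := fun x ↦ ⁅x, v⁆
        map_add' := fun x y ↦ add_lie x y v
        map_smul' := fun c x ↦ smul_lie c x v }
    have : gr P.base P.node 0 ≤ (sInf S).comap T := by
      refine (gr_le_iSup_rootSpace _ _ 0).trans (iSup₂_le fun α hα x hx ↦ ?_)
      change ⁅x, v⁆ ∈ sInf S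
      have hgr {β : H → ℂ} (hβ : β (gradingElement P.base P.node) = 0) :
          (rootSpace H β).toSubmodule ≤ gr P.base P.node 0 :=
        rootSpace_le_gr P.base P.node (m := 0) (by simpa using hβ)
      have hα' : α (gradingElement P.base P.node) = 0 := by simpa using hα
      by_cases hα0 : α.IsZero
      · rw [hα0.eq, rootSpace_zero_eq] at hx
        rw [show ⁅x, v⁆ = ν ⟨x, hx⟩ • v from hv.weight ⟨x, hx⟩]
        exact Submodule.smul_mem _ _ hS.1
      · obtain ⟨i, rfl⟩ : ∃ i : H.root, (i : Weight ℂ H g) = α := ⟨⟨α, by simpa using hα0⟩, rfl⟩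
        obtain ⟨j, hj, hp | hp⟩ := exists_root_neg P.base i
        · exact hS.2 i hp (hgr hα') x hx v hS.1
        · rw [hv.lie_eq_zero j hp (hgr (by rw [hj, Pi.neg_apply, hα', neg_zero])) x
            (by rw [hj, neg_neg]; exact hx)]
          exact zero_mem _
    exact this hA
  -- the `y` with `[l, y]` in that subspace form a subspace with the same two properties, so that
  -- the smallest one is an `l`-submodule
  let N' : Submodule ℂ (g ⊗[ℂ] g) :=
    { carrier := {y | y ∈ sInf S ∧ ∀ A ∈ gr P.base P.node 0, ⁅A, y⁆ ∈ sInf S}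
      add_mem' := fun hx hy ↦ ⟨add_mem hx.1 hy.1, fun A hA ↦ by
        rw [lie_add]; exact add_mem (hx.2 A hA) (hy.2 A hA)⟩
      zero_mem' := ⟨zero_mem _, fun A _ ↦ by rw [lie_zero]; exact zero_mem _⟩
      smul_mem' := fun c y hy ↦ ⟨Submodule.smul_mem _ _ hy.1, fun A hA ↦ by
        rw [lie_smul]; exact Submodule.smul_mem _ _ (hy.2 A hA)⟩ }
  have hN' : N' ∈ S := by
    refine ⟨⟨hS.1, fun A hA ↦ hv_lie hA⟩, fun α hα hα0 x hx y hy ↦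
      ⟨hS.2 α hα hα0 x hx y hy.1, fun A hA ↦ ?_⟩⟩
    rw [leibniz_lie]
    exact add_mem (hy.2 _ (by simpa using lie_mem_gr hA (hα0 hx)))
      (hS.2 α hα hα0 x hx _ (hy.2 A hA))
  let L : LieSubmodule ℂ P.levi (g ⊗[ℂ] g) :=
    { sInf S with
      lie_mem := fun {A y} hy ↦ (sInf_le hN' hy : y ∈ N').2 A A.2 }
  have hL : L = W := by
    refine hW L (fun y hy ↦ (hle hy).1) fun h0 ↦ hv.ne_zero ?_
    have : v ∈ L := hS.1
    rw [h0] at this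
    exact (LieSubmodule.mem_bot _).mp this
  rw [← hL]
  exact fun y hy ↦ (hle hy).2

end QuasiHeisenbergDatum

end ConfInv

namespace ConfInv
namespace QuasiHeisenbergDatum

variable {g : Type*} [LieRing g] [LieAlgebra ℂ g] [Module.Finite ℂ g] [LieAlgebra.IsSimple ℂ g]
  {H : LieSubalgebra ℂ g} [H.IsCartanSubalgebra] (P : QuasiHeisenbergDatum H)

/-! ### Commutators with `π_s` -/

/-- The commutator `[π_s(X), D]`. -/
def piComm (s : ℂ) : g →ₗ[ℂ] Module.End ℂ P.SmoothFn →ₗ[ℂ] Module.End ℂ P.SmoothFn :=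
  have h1 {A : Type _} [Ring A] (p q D : A) :
      (p + q) * D - D * (p + q) = (p * D - D * p) + (q * D - D * q) := by noncomm_ring
  have h2 {A : Type _} [Ring A] [Algebra ℂ A] (c : ℂ) (p D : A) :
      (c • p) * D - D * (c • p) = c • (p * D - D * p) := by
    rw [smul_mul_assoc, mul_smul_comm, smul_sub]
  have h3 {A : Type _} [Ring A] (p D E : A) :
      p * (D + E) - (D + E) * p = (p * D - D * p) + (p * E - E * p) := by noncomm_ring
  have h4 {A : Type _} [Ring A] [Algebra ℂ A] (c : ℂ) (p D : A) :
      p * (c • D) - (c • D) * p = c • (p * D - D * p) := by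
    rw [smul_mul_assoc, mul_smul_comm, smul_sub]
  LinearMap.mk₂ ℂ (fun X D ↦ P.piS s X * D - D * P.piS s X)
    (fun X X' D ↦ by rw [piS_add]; exact h1 (A := Module.End ℂ P.SmoothFn) _ _ _)
    (fun c X D ↦ by rw [piS_smul]; exact h2 (A := Module.End ℂ P.SmoothFn) _ _ _)
    (fun X D E ↦ h3 (A := Module.End ℂ P.SmoothFn) _ _ _)
    (fun c X D ↦ h4 (A := Module.End ℂ P.SmoothFn) _ _ _)

variable {P}

lemma piComm_apply (s : ℂ) (X : g) (D : Module.End ℂ P.SmoothFn) :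
    P.piComm s X D = P.piS s X * D - D * P.piS s X := rfl

lemma piComm_lie (s : ℂ) (X X' : g) (D : Module.End ℂ P.SmoothFn) :
    P.piComm s ⁅X, X'⁆ D = P.piComm s X (P.piComm s X' D) - P.piComm s X' (P.piComm s X D) := by
  have h {A : Type _} [Ring A] (p q D : A) : (p * q - q * p) * D - D * (p * q - q * p) =
      (p * (q * D - D * q) - (q * D - D * q) * p) -
        (q * (p * D - D * p) - (p * D - D * p) * q) := by noncomm_ring
  simp only [piComm_apply]
  rw [piS_lie]
  exact h (A := Module.End ℂ P.SmoothFn) _ _ _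

lemma piComm_smul (s : ℂ) (X : g) (a : P.SmoothFn) (D : Module.End ℂ P.SmoothFn) :
    P.piComm s X (a • D) = P.piS 0 X a • D + a • P.piComm s X D :=
  piS_smul_sub s X a D

lemma piComm_Omega₂_of_mem_levi (s : ℂ) {A : g} (hA : A ∈ gr P.base P.node 0) (Y : g ⊗[ℂ] g) :
    P.piComm s A (P.Omega₂ Y) = P.Omega₂ ⁅A, Y⁆ :=
  (sub_eq_iff_eq_add (G := Module.End ℂ P.SmoothFn)).mpr (piS_mul_Omega₂ s hA Y)

lemma piComm_Omega₂_of_mem_nbar (s : ℂ) {X : g} (hX : X ∈ P.nbar) (Y : g ⊗[ℂ] g) :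
    P.piComm s X (P.Omega₂ Y) = 0 :=
  (sub_eq_zero (G := Module.End ℂ P.SmoothFn)).mpr (piS_mul_Omega₂_of_mem_nbar s hX Y)

/-- The commutator at `n` is the left translate of a commutator at the identity. -/
lemma evalAt_piComm_Omega₂ (s : ℂ) (n : P.NBar) (X : g) (Y : g ⊗[ℂ] g) :
    P.evalAt n (P.piComm s X (P.Omega₂ Y)) =
      P.evalAt 1 (P.piComm s (Ad n⁻¹ X) (P.Omega₂ Y)) ∘ₗ leftTranslate n := by
  have h {A : Type _} [Ring A] (l p p' D : A) (h1 : l * p = p' * l) (h2 : l * D = D * l) :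
      l * (p * D - D * p) = (p' * D - D * p') * l := by
    rw [mul_sub, sub_mul, ← mul_assoc, h1, mul_assoc, h2, ← mul_assoc l, h2, mul_assoc D, h1]
    simp only [mul_assoc]
  rw [evalAt_eq, piComm_apply, piComm_apply]
  exact congrArg (P.evalAt 1) (h (A := Module.End ℂ P.SmoothFn) _ _ _ _
    (leftTranslate_mul_piS s n X) (leftTranslate_mul_Omega₂ n Y))

lemma evalAt_Omega₂ (n : P.NBar) (Y : g ⊗[ℂ] g) :
    P.evalAt n (P.Omega₂ Y) = P.evalAt 1 (P.Omega₂ Y) ∘ₗ leftTranslate n := by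
  rw [evalAt_eq, leftTranslate_mul_Omega₂]
  rfl

variable (P) in
/-- The map `D ↦ D_n` as a linear map. -/
def evalAtHom (n : P.NBar) : Module.End ℂ P.SmoothFn →ₗ[ℂ] Dual ℂ P.SmoothFn where
  toFun := P.evalAt n
  map_add' _ _ := rfl
  map_smul' _ _ := rfl

variable (P) in
/-- The map `Y* ↦ Ω₂(Y*)_n`. -/
def Omega₂At (n : P.NBar) : g ⊗[ℂ] g →ₗ[ℂ] Dual ℂ P.SmoothFn := P.evalAtHom n ∘ₗ P.Omega₂Hom

lemma Omega₂At_apply (n : P.NBar) (Y : g ⊗[ℂ] g) : P.Omega₂At n Y = P.evalAt n (P.Omega₂ Y) := rfl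

variable (P) in
/-- The map `(X, Y*) ↦ [π_s(X), Ω₂(Y*)]_e`. -/
def commAtOne (s : ℂ) : g →ₗ[ℂ] g ⊗[ℂ] g →ₗ[ℂ] Dual ℂ P.SmoothFn :=
  (P.piComm s).compl₁₂ LinearMap.id P.Omega₂Hom |>.compr₂ (P.evalAtHom 1)

lemma commAtOne_apply (s : ℂ) (X : g) (Y : g ⊗[ℂ] g) :
    P.commAtOne s X Y = P.evalAt 1 (P.piComm s X (P.Omega₂ Y)) := rfl

lemma Omega₂At_one_comp_piS (s : ℂ) {A : g} (hA : A ∈ gr P.base P.node 0) (Y : g ⊗[ℂ] g) :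
    P.Omega₂At 1 Y ∘ₗ P.piS s A = (s * P.lambdaQ A) • P.Omega₂At 1 Y - P.Omega₂At 1 ⁅A, Y⁆ := by
  have h := congrArg (P.evalAt 1) (piS_mul_Omega₂ s hA Y)
  rw [evalAt_one_piS_mul s hA] at h
  rw [Omega₂At_apply, h]
  ext f
  exact (add_sub_cancel_left (G := ℂ) _ _).symm

/-! ### The commutators at the identity -/

variable {Vd : LieSubmodule ℂ P.levi (g ⊗[ℂ] g)}

lemma lie_mem_of_mem_levi {A : g} (hA : A ∈ gr P.base P.node 0) {Y : g ⊗[ℂ] g} (hY : Y ∈ Vd) :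
    ⁅A, Y⁆ ∈ Vd := Vd.lie_mem (x := (⟨A, hA⟩ : P.levi)) hY

/-- The tensors `X ⊗ Y*` for which `[π_s(X), Ω₂(Y*)]_e` is in the span of the system are stable under
`l`: at the identity, `[π_s(A), [π_s(X), Ω₂(Y*)]]` only involves `[π_s(X), Ω₂(Y*)]_e`. -/
lemma commAtOne_lie_add_mem (s : ℂ) {A : g} (hA : A ∈ gr P.base P.node 0) {X : g} {Y : g ⊗[ℂ] g}
    (h : P.commAtOne s X Y ∈ Vd.toSubmodule.map (P.Omega₂At 1)) :
    P.commAtOne s ⁅A, X⁆ Y + P.commAtOne s X ⁅A, Y⁆ ∈ Vd.toSubmodule.map (P.Omega₂At 1) := by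
  obtain ⟨Y', hY', e⟩ := h
  have h1 : P.commAtOne s ⁅A, X⁆ Y + P.commAtOne s X ⁅A, Y⁆ =
      P.evalAt 1 (P.piComm s A (P.piComm s X (P.Omega₂ Y))) := by
    rw [commAtOne_apply, commAtOne_apply, piComm_lie, ← piComm_Omega₂_of_mem_levi s hA]
    ext f
    exact sub_add_cancel (G := ℂ) _ _
  have h2 : P.evalAt 1 (P.piComm s A (P.piComm s X (P.Omega₂ Y))) =
      (s * P.lambdaQ A) • P.commAtOne s X Y - P.commAtOne s X Y ∘ₗ P.piS s A := by
    rw [commAtOne_apply, ← evalAt_one_piS_mul s hA]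
    rfl
  rw [h1, h2, ← e, Omega₂At_one_comp_piS s hA, sub_sub_cancel]
  exact Submodule.mem_map_of_mem (lie_mem_of_mem_levi hA hY')

/-- If `[π_s(X_h), Ω₂(Y_l*)]_e` is in the span of the system, then so is `[π_s(X), Ω₂(Y*)]_e` for
all `X ∈ g(1)` and `Y* ∈ V*`. -/
lemma commAtOne_mem_of_mem_gr_one (s : ℂ)
    (hVd : ∀ N : LieSubmodule ℂ P.levi (g ⊗[ℂ] g), N ≤ Vd → N ≠ ⊥ → N = Vd)
    {Xh : g} (hXh : Xh ∈ gr P.base P.node 1) {ν : Dual ℂ H} (hν : P.IsHighestWeightVector Xh ν)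
    {Yl : g ⊗[ℂ] g} (hYl : Yl ∈ Vd) {ν' : Dual ℂ H} (hν' : P.IsLowestWeightVector Yl ν')
    (h : P.commAtOne s Xh Yl ∈ Vd.toSubmodule.map (P.Omega₂At 1))
    {X : g} (hX : X ∈ gr P.base P.node 1) {Y : g ⊗[ℂ] g} (hY : Y ∈ Vd) :
    P.commAtOne s X Y ∈ Vd.toSubmodule.map (P.Omega₂At 1) := by
  have h1 : Vd.toSubmodule ≤ (Vd.toSubmodule.map (P.Omega₂At 1)).comap (P.commAtOne s Xh) := by
    refine le_of_isLowestWeightVector_mem hVd hYl hν' h fun α hα hα0 x hx y _ hyN ↦ ?_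
    have h2 := commAtOne_lie_add_mem s (hα0 hx) hyN
    rwa [hν.lie_eq_zero α hα hα0 x hx, map_zero, LinearMap.zero_apply, zero_add] at h2
  let G : Submodule ℂ g := ⨅ y : Vd, (Vd.toSubmodule.map (P.Omega₂At 1)).comap
    ((P.commAtOne s).flip y)
  have hG (x : g) : x ∈ G ↔ ∀ y ∈ Vd, P.commAtOne s x y ∈ Vd.toSubmodule.map (P.Omega₂At 1) := by
    simp [G, Submodule.mem_iInf]
  have h3 : gr P.base P.node 1 ≤ G := by
    refine gr_one_le_of_mem P.lie_lie_nilrad (x := Xh) (fun A hA x hx ↦ ?_)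
      ((hG Xh).mpr fun y hy ↦ h1 hy) hXh hν.ne_zero hν.weight
    rw [hG] at hx ⊢
    intro y hy
    have h4 := commAtOne_lie_add_mem s hA (hx y hy)
    simpa using sub_mem h4 (hx _ (lie_mem_of_mem_levi hA hy))
  exact (hG X).mp (h3 hX) Y hY

lemma commAtOne_mem_of_mem_grLE_one (s : ℂ)
    (h : ∀ X ∈ gr P.base P.node 1, ∀ Y ∈ Vd,
      P.commAtOne s X Y ∈ Vd.toSubmodule.map (P.Omega₂At 1))
    {X : g} (hX : X ∈ grLE P.base P.node 1) {Y : g ⊗[ℂ] g} (hY : Y ∈ Vd) :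
    P.commAtOne s X Y ∈ Vd.toSubmodule.map (P.Omega₂At 1) := by
  have : grLE P.base P.node 1 ≤
      (Vd.toSubmodule.map (P.Omega₂At 1)).comap ((P.commAtOne s).flip Y) := by
    refine iSup₂_le fun j hj X hX ↦ ?_
    rw [Submodule.mem_comap, LinearMap.flip_apply]
    rcases lt_trichotomy j 0 with hj0 | rfl | hj0
    · rw [commAtOne_apply, piComm_Omega₂_of_mem_nbar s (gr_le_oppNilrad _ _ hj0 hX)]
      exact zero_mem _
    · rw [commAtOne_apply, piComm_Omega₂_of_mem_levi s hX]
      exact Submodule.mem_map_of_mem (f := P.Omega₂At 1) (lie_mem_of_mem_levi hX hY)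
    · obtain rfl : j = 1 := by omega
      exact h X hX Y hY
  exact this hX

/-- `Y* ↦ Ω₂(Y*)_n` is injective on `V*`: the kernel at the identity is an `l`-submodule, and it is
proper as `Ω₂(Y*)` is left-invariant. -/
lemma Omega₂At_injOn (hVd : ∀ N : LieSubmodule ℂ P.levi (g ⊗[ℂ] g), N ≤ Vd → N ≠ ⊥ → N = Vd)
    (hΩ : ∃ Y ∈ Vd, P.Omega₂ Y ≠ 0) (n : P.NBar) {Y : g ⊗[ℂ] g} (hY : Y ∈ Vd)
    (h : P.Omega₂At n Y = 0) : Y = 0 := by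
  have h1 : P.Omega₂At 1 Y = 0 := by
    have e : P.Omega₂At n Y ∘ₗ leftTranslate n⁻¹ = P.Omega₂At 1 Y := by
      rw [Omega₂At_apply, Omega₂At_apply, evalAt_Omega₂ n, LinearMap.comp_assoc]
      exact congrArg (P.evalAt 1 (P.Omega₂ Y) ∘ₗ ·) (leftTranslate_inv n)
    rw [← e, h, LinearMap.zero_comp]
  by_contra hY0
  let K : LieSubmodule ℂ P.levi (g ⊗[ℂ] g) :=
    { Vd.toSubmodule ⊓ LinearMap.ker (P.Omega₂At 1) with
      lie_mem := fun {A y} hy ↦ by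
        refine ⟨Vd.lie_mem hy.1, ?_⟩
        have h2 : P.Omega₂At 1 y = 0 := hy.2
        have h3 := Omega₂At_one_comp_piS 0 A.2 y
        rw [h2, smul_zero, zero_sub, LinearMap.zero_comp] at h3
        exact neg_eq_zero.mp h3.symm }
  have hK : K = Vd := by
    refine hVd K (fun y hy ↦ hy.1) fun hK ↦ hY0 ?_
    have : Y ∈ K := ⟨hY, h1⟩
    rw [hK] at this
    exact (LieSubmodule.mem_bot _).mp this
  obtain ⟨Y', hY', hne⟩ := hΩ
  refine hne ?_
  rw [← hK] at hY'
  have h4 : P.Omega₂At 1 Y' = 0 := hY'.2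
  ext f n
  have h5 := evalAt_Omega₂ n Y'
  rw [← Omega₂At_apply 1, h4, LinearMap.zero_comp] at h5
  exact LinearMap.congr_fun h5 f

/-! ### From the identity to the whole group -/

/-- For `X` of degree at most one, `[π_s(X), Ω₂(Y_i*)]_n` is a left translate of a functional in the
span of the `Ω₂(Y_j*)_e`. Its coefficients are those of `Ad(n⁻¹) X` under a linear map, and so they are
smooth in `n`. -/
lemma exists_structure_of_mem_grLE_one (s : ℂ)
    (hVd : ∀ N : LieSubmodule ℂ P.levi (g ⊗[ℂ] g), N ≤ Vd → N ≠ ⊥ → N = Vd)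
    (hΩ : ∃ Y ∈ Vd, P.Omega₂ Y ≠ 0) {m : ℕ} (Y : Basis (Fin m) ℂ Vd)
    (h : ∀ X ∈ gr P.base P.node 1, ∀ Y ∈ Vd,
      P.commAtOne s X Y ∈ Vd.toSubmodule.map (P.Omega₂At 1))
    {X : g} (hX : X ∈ grLE P.base P.node 1) : ∃ C : Matrix (Fin m) (Fin m) P.SmoothFn, ∀ i,
      P.piComm s X (P.Omega₂ (Y i)) = ∑ j, C j i • P.Omega₂ (Y j) := by
  let e : Vd →ₗ[ℂ] Dual ℂ P.SmoothFn := P.Omega₂At 1 ∘ₗ Vd.toSubmodule.subtype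
  obtain ⟨r, hr⟩ := LinearMap.exists_leftInverse_of_injective e (by
    rw [LinearMap.ker_eq_bot']
    intro y hy
    ext
    exact Omega₂At_injOn hVd hΩ 1 y.2 hy)
  refine ⟨fun j i ↦ P.adCoeff (Y.coord j ∘ₗ r ∘ₗ (P.commAtOne s).flip (Y i)) X, fun i ↦ ?_⟩
  ext f n
  have h1 := LinearMap.congr_fun (evalAt_piComm_Omega₂ s n X (Y i)) f
  obtain ⟨y, hy, hye⟩ := commAtOne_mem_of_mem_grLE_one s h (Ad_mem_grLE n⁻¹ hX) (Y i).2
  have h2 : r (P.commAtOne s (Ad n⁻¹ X) (Y i)) = ⟨y, hy⟩ := by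
    rw [← hye]
    exact LinearMap.congr_fun hr ⟨y, hy⟩
  have h3 : P.commAtOne s (Ad n⁻¹ X) (Y i) =
      ∑ j, Y.coord j (r (P.commAtOne s (Ad n⁻¹ X) (Y i))) • P.Omega₂At 1 (Y j) := by
    conv_lhs => rw [← hye]
    rw [h2]
    have h4 := congrArg e (Y.sum_repr ⟨y, hy⟩)
    rw [map_sum] at h4
    simp only [map_smul] at h4
    exact h4.symm
  rw [LinearMap.comp_apply, ← commAtOne_apply, h3, LinearMap.sum_apply] at h1
  change (P.evalAt n (P.piComm s X (P.Omega₂ (Y i)))) f = _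
  rw [h1, LinearMap.sum_apply]
  simp only [AddSubmonoidClass.coe_finsetSum, Finset.sum_apply]
  refine Finset.sum_congr rfl fun j _ ↦ ?_
  have h5 := LinearMap.congr_fun (evalAt_Omega₂ n (Y j)) f
  change _ * P.evalAt 1 (P.Omega₂ (Y j)) (leftTranslate n f) = _ * P.evalAt n (P.Omega₂ (Y j)) f
  rw [h5]
  rfl

variable (P) in
/-- The elements `X` of `g` such that the span of `D_1, …, D_m` over the smooth functions is stable
under the commutator with `π_s(X)`. -/
def stabilizer (s : ℂ) {m : ℕ} (D : Fin m → Module.End ℂ P.SmoothFn) : Submodule ℂ g where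
  carrier := {X | ∀ i, P.piComm s X (D i) ∈ Submodule.span P.SmoothFn (Set.range D)}
  add_mem' hX hX' i := by
    rw [map_add, LinearMap.add_apply]
    exact add_mem (hX i) (hX' i)
  zero_mem' i := by
    rw [map_zero, LinearMap.zero_apply]
    exact zero_mem _
  smul_mem' c X hX i := by
    rw [map_smul, LinearMap.smul_apply]
    have := Submodule.smul_mem _ (algebraMap ℂ P.SmoothFn c) (hX i)
    rwa [algebraMap_smul] at this

lemma piComm_mem_span (s : ℂ) {m : ℕ} {D : Fin m → Module.End ℂ P.SmoothFn} {X : g}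
    (hX : X ∈ P.stabilizer s D) {E : Module.End ℂ P.SmoothFn}
    (hE : E ∈ Submodule.span P.SmoothFn (Set.range D)) :
    P.piComm s X E ∈ Submodule.span P.SmoothFn (Set.range D) := by
  induction hE using Submodule.span_induction with
  | mem E hE =>
    obtain ⟨i, rfl⟩ := hE
    exact hX i
  | zero => rw [map_zero]; exact zero_mem _
  | add E E' _ _ h h' => rw [map_add]; exact add_mem h h'
  | smul a E hE h =>
    rw [piComm_smul]
    exact add_mem (Submodule.smul_mem _ _ hE) (Submodule.smul_mem _ _ h)

lemma lie_mem_stabilizer (s : ℂ) {m : ℕ} {D : Fin m → Module.End ℂ P.SmoothFn} {X X' : g}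
    (hX : X ∈ P.stabilizer s D) (hX' : X' ∈ P.stabilizer s D) : ⁅X, X'⁆ ∈ P.stabilizer s D := by
  have h {R M : Type _} [CommRing R] [AddCommGroup M] [Module R M] (S : Submodule R M) {x y : M}
      (hx : x ∈ S) (hy : y ∈ S) : x - y ∈ S := sub_mem hx hy
  intro i
  rw [piComm_lie]
  exact h (M := Module.End ℂ P.SmoothFn) _ (piComm_mem_span s hX (hX' i))
    (piComm_mem_span s hX' (hX i))

/-- `g` is generated by the sum of the `g(j)` with `j ≤ 1`, as `g(2) = [g(1), g(1)]`. -/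
lemma eq_top_of_grLE_one_le {K : Submodule ℂ g} (hK : ∀ x ∈ K, ∀ y ∈ K, ⁅x, y⁆ ∈ K)
    (h : grLE P.base P.node 1 ≤ K) : K = ⊤ := by
  have h1 : gr P.base P.node 1 ≤ K := (gr_le_grLE _ _ le_rfl).trans h
  have hlie (j k : ℕ) {x y : g} (hx : x ∈ gr P.base P.node (j + 1))
      (hy : y ∈ gr P.base P.node (k + 1)) : ⁅x, y⁆ ∈ K := by
    by_cases hjk : j = 0 ∧ k = 0
    · obtain ⟨rfl, rfl⟩ := hjk
      exact hK x (h1 (by simpa using hx)) y (h1 (by simpa using hy))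
    · have := lie_mem_gr hx hy
      rw [gr_eq_bot_of_two_lt P.lie_lie_nilrad (by omega)] at this
      rw [(Submodule.mem_bot ℂ).mp this]
      exact zero_mem _
  have hd : nilradDerived P.base P.node ≤ K := by
    refine Submodule.span_le.mpr ?_
    rintro _ ⟨x, hx, y, hy, rfl⟩
    change ⁅x, y⁆ ∈ K
    rw [nilrad] at hx hy
    induction hx using Submodule.iSup_induction' with
    | zero => simp
    | add x x' _ _ h1 h2 => rw [add_lie]; exact add_mem h1 h2
    | mem j x hx =>
    induction hy using Submodule.iSup_induction' with
    | zero => simp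
    | add y y' _ _ h1 h2 => rw [lie_add]; exact add_mem h1 h2
    | mem k y hy => exact hlie j k hx hy
  have h2 : gr P.base P.node 2 ≤ K := by
    refine (gr_le_iSup_rootSpace _ _ 2).trans (iSup₂_le fun α hα ↦ ?_)
    have hα0 : ¬ α.IsZero := fun h0 ↦ by
      rw [h0.eq, Pi.zero_apply] at hα
      norm_num at hα
    obtain ⟨i, rfl⟩ : ∃ i : H.root, (i : Weight ℂ H g) = α := ⟨⟨α, by simpa using hα0⟩, rfl⟩
    obtain ⟨m, hm, -, -, hm2⟩ := posRoot_apply_le_two P.lie_lie_nilrad i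
      (isPos_of_apply_gradingElement_pos P.lie_lie_nilrad two_pos hα)
    rw [hm] at hα
    exact (hm2 (by exact_mod_cast hα)).trans hd
  rw [eq_top_iff, ← grLE_two P.lie_lie_nilrad]
  refine iSup₂_le fun j hj ↦ ?_
  rcases hj.lt_or_eq with hj | rfl
  · exact (gr_le_grLE _ _ (by omega)).trans h
  · exact h2

lemma exists_matrix_of_forall_mem_span {m : ℕ} {D E : Fin m → Module.End ℂ P.SmoothFn}
    (h : ∀ i, E i ∈ Submodule.span P.SmoothFn (Set.range D)) :
    ∃ C : Matrix (Fin m) (Fin m) P.SmoothFn, ∀ i, E i = ∑ j, C j i • D j := by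
  choose c hc using fun i ↦ (Submodule.mem_span_range_iff_exists_fun P.SmoothFn).mp (h i)
  exact ⟨fun j i ↦ c i j, fun i ↦ (hc i).symm⟩

lemma isConformallyInvariant_Omega₂ (s : ℂ)
    (hVd : ∀ N : LieSubmodule ℂ P.levi (g ⊗[ℂ] g), N ≤ Vd → N ≠ ⊥ → N = Vd)
    (hΩ : ∃ Y ∈ Vd, P.Omega₂ Y ≠ 0) {m : ℕ} (Y : Basis (Fin m) ℂ Vd)
    (h : ∀ X ∈ gr P.base P.node 1, ∀ Y ∈ Vd,
      P.commAtOne s X Y ∈ Vd.toSubmodule.map (P.Omega₂At 1)) :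
    IsConformallyInvariant (P.piS s) fun i ↦ P.Omega₂ (Y i) where
  mem_diffOps i := Omega₂_mem_diffOps _
  linearIndependent n := by
    refine Y.linearIndependent.map' (P.Omega₂At n ∘ₗ Vd.toSubmodule.subtype) ?_
    rw [LinearMap.ker_eq_bot']
    intro y hy
    ext
    exact Omega₂At_injOn hVd hΩ n y.2 hy
  exists_structure X := by
    have htop : P.stabilizer s (fun i ↦ P.Omega₂ (Y i)) = ⊤ := by
      refine eq_top_of_grLE_one_le (P := P) (fun x hx y hy ↦ lie_mem_stabilizer s hx hy)
        fun x hx i ↦ ?_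
      obtain ⟨C, hC⟩ := exists_structure_of_mem_grLE_one s hVd hΩ Y h hx
      rw [hC i]
      exact sum_mem fun j _ ↦ Submodule.smul_mem _ _ (Submodule.subset_span ⟨j, rfl⟩)
    have hX : X ∈ P.stabilizer s (fun i ↦ P.Omega₂ (Y i)) := by rw [htop]; trivial
    exact exists_matrix_of_forall_mem_span (P := P) hX

/-! ### Equivalent systems -/

lemma mem_span_range_of_eq_sum {R M : Type*} [CommRing R] [AddCommGroup M] [Module R M] {m : ℕ}
    {B : GL (Fin m) R} {x x' : Fin m → M}
    (hx : ∀ i, x' i = ∑ j, (B : Matrix (Fin m) (Fin m) R) j i • x j) (k : Fin m) :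
    x k ∈ Submodule.span R (Set.range x') := by
  have e : x k = ∑ l, ((B⁻¹ : GL (Fin m) R) : Matrix (Fin m) (Fin m) R) l k • x' l := by
    simp only [hx, Finset.smul_sum, smul_smul]
    rw [Finset.sum_comm]
    have h1 (p) : ∑ l, ((B⁻¹ : GL (Fin m) R) : Matrix (Fin m) (Fin m) R) l k *
        (B : Matrix (Fin m) (Fin m) R) p l = (1 : Matrix (Fin m) (Fin m) R) p k := by
      rw [← Units.mul_inv B, Matrix.mul_apply]
      exact Finset.sum_congr rfl fun l _ ↦ mul_comm _ _
    simp only [← Finset.sum_smul, h1, Matrix.one_apply, ite_smul, one_smul, zero_smul,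
      Finset.sum_ite_eq', Finset.mem_univ, if_true]
  rw [e]
  exact sum_mem fun l _ ↦ Submodule.smul_mem _ _ (Submodule.subset_span ⟨l, rfl⟩)

lemma span_range_le_of_eq_sum {R M : Type*} [CommRing R] [AddCommGroup M] [Module R M] {m : ℕ}
    {B : GL (Fin m) R} {x x' : Fin m → M}
    (hx : ∀ i, x' i = ∑ j, (B : Matrix (Fin m) (Fin m) R) j i • x j) :
    Submodule.span R (Set.range x) ≤ Submodule.span R (Set.range x') :=
  Submodule.span_le.mpr (Set.range_subset_iff.mpr (mem_span_range_of_eq_sum hx))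

lemma linearIndependent_of_eq_sum {K M : Type*} [Field K] [AddCommGroup M] [Module K M] {m : ℕ}
    {B : GL (Fin m) K} {x x' : Fin m → M}
    (hx : ∀ i, x' i = ∑ j, (B : Matrix (Fin m) (Fin m) K) j i • x j)
    (h : LinearIndependent K x) : LinearIndependent K x' := by
  have : FiniteDimensional K (Submodule.span K (Set.range x')) :=
    FiniteDimensional.span_of_finite K (Set.finite_range x')
  rw [linearIndependent_iff_card_le_finrank_span] at h ⊢
  exact h.trans (Submodule.finrank_mono (span_range_le_of_eq_sum hx))

lemma linearIndependent_evalAt_of_areEquivalent {m : ℕ} {D D' : Fin m → Module.End ℂ P.SmoothFn}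
    (h : AreEquivalent D D') (n : P.NBar) (hD : LinearIndependent ℂ fun i ↦ P.evalAt n (D i)) :
    LinearIndependent ℂ fun i ↦ P.evalAt n (D' i) := by
  obtain ⟨A, hA⟩ := h
  let ev : P.SmoothFn →+* ℂ := (Pi.evalRingHom (fun _ : P.NBar ↦ ℂ) n).comp
    P.SmoothFn.val.toRingHom
  refine linearIndependent_of_eq_sum (M := Dual ℂ P.SmoothFn)
    (B := Matrix.GeneralLinearGroup.map ev A) (fun i ↦ ?_) hD
  ext f
  rw [hA]
  change ((∑ j, (A : Matrix (Fin m) (Fin m) P.SmoothFn) j i • D j) f : P.NBar → ℂ) n = _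
  simp only [LinearMap.sum_apply, AddSubmonoidClass.coe_finsetSum, Finset.sum_apply]
  rfl

lemma span_range_le_of_areEquivalent {m : ℕ} {D D' : Fin m → Module.End ℂ P.SmoothFn}
    (h : AreEquivalent D D') :
    Submodule.span P.SmoothFn (Set.range D) ≤ Submodule.span P.SmoothFn (Set.range D') := by
  obtain ⟨A, hA⟩ := h
  exact span_range_le_of_eq_sum (R := P.SmoothFn) (M := Module.End ℂ P.SmoothFn) hA

lemma mem_span_range_of_areEquivalent {m : ℕ} {D D' : Fin m → Module.End ℂ P.SmoothFn}
    (h : AreEquivalent D D') (i : Fin m) : D' i ∈ Submodule.span P.SmoothFn (Set.range D) := by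
  obtain ⟨A, hA⟩ := h
  rw [hA]
  exact sum_mem fun j _ ↦ Submodule.smul_mem _ _ (Submodule.subset_span ⟨j, rfl⟩)

lemma mem_stabilizer_of_isConformallyInvariant {s : ℂ} {m : ℕ}
    {D : Fin m → Module.End ℂ P.SmoothFn} (hD : IsConformallyInvariant (P.piS s) D) (X : g) :
    X ∈ P.stabilizer s D := fun i ↦ by
  obtain ⟨C, hC⟩ := hD.exists_structure X
  rw [piComm_apply, hC i]
  exact sum_mem fun j _ ↦ Submodule.smul_mem _ _ (Submodule.subset_span ⟨j, rfl⟩)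

/-- A list of differential operators that is equivalent to a conformally invariant system is itself
a conformally invariant system. -/
lemma isConformallyInvariant_of_areEquivalent {s : ℂ} {m : ℕ}
    {D D' : Fin m → Module.End ℂ P.SmoothFn} (hD : IsConformallyInvariant (P.piS s) D)
    (h : AreEquivalent D D') (hD' : ∀ i, D' i ∈ P.diffOps) :
    IsConformallyInvariant (P.piS s) D' where
  mem_diffOps := hD'
  linearIndependent n := linearIndependent_evalAt_of_areEquivalent h n (hD.linearIndependent n)
  exists_structure X := exists_matrix_of_forall_mem_span (P := P) fun i ↦
    span_range_le_of_areEquivalent h (piComm_mem_span s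
      (mem_stabilizer_of_isConformallyInvariant hD X) (mem_span_range_of_areEquivalent h i))

end QuasiHeisenbergDatum
end ConfInv

end

theorem proposition7p1p2 {g : Type*} [LieRing g] [LieAlgebra ℂ g] [Module.Finite ℂ g]
    [LieAlgebra.IsSimple ℂ g] {H : LieSubalgebra ℂ g} [H.IsCartanSubalgebra]
    (P : ConfInv.QuasiHeisenbergDatum H) (s : ℂ) (μ ε : Module.Dual ℂ H)
    (V Vd : LieSubmodule ℂ P.levi (g ⊗[ℂ] g))
    (hV : P.IsSpecialConstituent V μ ε) (hVd : P.IsKillingDual V Vd)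
    (hΩ : ∃ Y ∈ Vd, P.Omega₂ Y ≠ 0)
    (Xh : g) (hXh : Xh ∈ ConfInv.gr P.base P.node 1) (hXh_highest : ∃ ν, P.IsHighestWeightVector Xh ν)
    (Yl : g ⊗[ℂ] g) (hYl : Yl ∈ Vd) (hYl_lowest : ∃ ν, P.IsLowestWeightVector Yl ν)
    {m : ℕ} (Y : Module.Basis (Fin m) ℂ Vd)
    (hspan : P.evalAt 1 (P.piS s Xh * P.Omega₂ Yl - P.Omega₂ Yl * P.piS s Xh) ∈
      Submodule.span ℂ (Set.range fun i ↦ P.evalAt 1 (P.Omega₂ (Y i)))) :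
    ConfInv.QuasiHeisenbergDatum.IsConformallyInvariant (P.piS s) (fun i ↦ P.Omega₂ (Y i)) ∧
      ∀ D : Fin m → Module.End ℂ P.SmoothFn, P.IsOmega₂System s Vd D →
        ConfInv.QuasiHeisenbergDatum.IsConformallyInvariant (P.piS s) D := by
  have hirr : ∀ N : LieSubmodule ℂ P.levi (g ⊗[ℂ] g), N ≤ Vd → N ≠ ⊥ → N = Vd :=
    fun N hN hN0 ↦ ConfInv.QuasiHeisenbergDatum.eq_of_le_of_isKillingDual hV.irreducible hVd hN hN0
  obtain ⟨ν, hν⟩ := hXh_highest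
  obtain ⟨ν', hν'⟩ := hYl_lowest
  have hmem : P.commAtOne s Xh Yl ∈ Vd.toSubmodule.map (P.Omega₂At 1) := by
    refine Submodule.span_le.mpr ?_ hspan
    rintro _ ⟨i, rfl⟩
    exact Submodule.mem_map_of_mem (f := P.Omega₂At 1) (Y i).2
  have hinv (Y : Module.Basis (Fin m) ℂ Vd) :=
    ConfInv.QuasiHeisenbergDatum.isConformallyInvariant_Omega₂ s hirr hΩ Y fun X hX Z hZ ↦
      ConfInv.QuasiHeisenbergDatum.commAtOne_mem_of_mem_gr_one s hirr hXh hν hYl hν' hmem hX hZ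
  refine ⟨hinv Y, fun D hD ↦ ?_⟩
  obtain ⟨Y', hY'⟩ := hD.exists_equivalent
  exact ConfInv.QuasiHeisenbergDatum.isConformallyInvariant_of_areEquivalent (hinv Y') hY'
    hD.mem_diffOps
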